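/- Let $D\subset\mathbb{R}^2$ be a bounded open set with $0\in D$, let $g$ be a positive continuous function on $\partial D$, and let $f:\mathbb{R}^2\to\mathbb{R}$ be continuous with $0<\lambda<f<\Lambda$ for constants $\lambda,\Lambda$. For $v:\mathbb{R}^2\setminus D\to[0,\infty)$ put $\Omega(v)=\{v>0\}$. A *subsolution* is a continuous $v:\mathbb{R}^2\setminus D\to[0,\infty)$ such that 1. $\Delta v\ge 0$ in $\Omega(v)\setminus\overline D$ in the viscosity sense (if $\varphi$ is $C^2$ near $x_0$ and $v-\varphi$ has a local maximum at $x_0$, then $\Delta\varphi(x_0)\ge 0$); 2. $v\le g$ on $\partial D$; 3. if $x_0\in\partial\Omega(v)\setminus\overline D$, if $B_s(y)$ is a ball disjoint from $\Omega(v)$ with $|x_0-y|=s>0$, and if, with $\nu=(x_0-y)/s$, $v(x)\le\alpha\langle x-x_0,\nu\rangle^+ + o(|x-x_0|)$ near $x_0$, then $\alpha\ge\sqrt{f(x_0)}$. Let $M,r>0$ with $D\subseteq B_r(0)$, and let $$R_0=\inf\Big\{R>r:\ \frac{M^2}{R^2\ln^2(r/R)}<\lambda\Big\},\qquad h(x)=M\Big(\frac{\ln(|x|/R_0)}{\ln(r/R_0)}\Big)^+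 .$$ Let $u$ be the largest subsolution, that is, $u(x)=\sup\{v(x): v \text{ is a subsolution and } v\le h \text{ on } \mathbb{R}^2\setminus D\}$ for $x\in\mathbb{R}^2\setminus D$, and assume that $u$ is continuous on $\mathbb{R}^2\setminus D$. Let $x_0\in\partial\Omega(u)$ and $\rho>0$ with $B_\rho(x_0)\subseteq\mathbb{R}^2\setminus D$, and let $\tilde u(x)=u(x_0-\rho x)/\rho$ for $x\in B_1(0)$. Then no connected component of the interior of the zero set $\{x\in B_1(0):\tilde u(x)=0\}$ is compactly contained in $B_1(0)$, i.e. has its closure contained in $B_1(0)$. -/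

import Mathlib

open Set Filter Topology Asymptotics
open scoped InnerProductSpace Laplacian

noncomputable section

namespace FreeBoundary

/-! The plane `ℝ²` is represented by `ℂ` with its real Euclidean structure: `‖z‖` is the Euclidean
norm, `⟪z, w⟫_ℝ` the Euclidean inner product, and `Δ` Mathlib's Laplacian of a function on a real
inner product space. A function on `ℝ² \ D` is a function `ℂ → ℝ` of which only the values outside
`D` are ever used. -/

/-- The positivity set `Ω(v) = {v > 0}` of a function `v` on `ℝ² \ D`. -/
def posSet (D : Set ℂ) (v : ℂ → ℝ) : Set ℂ := {x | x ∉ D ∧ 0 < v x}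

/-- `Δ v ≥ 0` at `x₀` in the viscosity sense: every `C²` function `φ` that touches `v` from above
at `x₀` (that is, `v - φ` has a local maximum at `x₀`) satisfies `Δ φ (x₀) ≥ 0`. -/
def ViscLaplacianNonneg (v : ℂ → ℝ) (x₀ : ℂ) : Prop :=
  ∀ φ : ℂ → ℝ, ContDiffAt ℝ 2 φ x₀ → IsLocalMax (fun x => v x - φ x) x₀ → 0 ≤ Δ φ x₀

/-- The disk `B_s(y)` is tangent at `x₀` to the set `Ω` from outside of `Ω`. When `x₀ ∈ ∂Ω`, the
unit normal at `x₀` pointing into `Ω` is then `(x₀ - y) / s`. -/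
def TangentBallOutside (Ω : Set ℂ) (x₀ y : ℂ) (s : ℝ) : Prop :=
  0 < s ∧ dist x₀ y = s ∧ Disjoint (Metric.ball y s) Ω

/-- `v(x) ≤ α ⟨x - x₀, ν⟩⁺ + o(|x - x₀|)` in a neighbourhood of `x₀`. -/
def BelowPlane (v : ℂ → ℝ) (x₀ ν : ℂ) (α : ℝ) : Prop :=
  ∃ ω : ℂ → ℝ, ω =o[𝓝 x₀] (fun x => x - x₀) ∧
    ∀ᶠ x in 𝓝 x₀, v x ≤ α * max ⟪x - x₀, ν⟫_ℝ 0 + ω x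

/-- Viscosity subsolutions `v : ℝ² \ D → [0, ∞)` of the free boundary problem
`Δ u = 0` in `Ω(u) \ D`, `u = g` on `∂D`, `u = 0` and `|∇u|² = f` on `∂Ω(u)`.
The interior and the free boundary conditions are imposed at points off `closure D`, where `v` is
defined in a full neighbourhood. -/
structure IsSubsolution (D : Set ℂ) (g f v : ℂ → ℝ) : Prop where
  continuousOn : ContinuousOn v Dᶜ
  nonneg : ∀ x ∉ D, 0 ≤ v x
  subharmonic : ∀ x ∈ posSet D v, x ∉ closure D → ViscLaplacianNonneg v x
  le_boundary : ∀ x ∈ frontier D, v x ≤ g x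
  freeBoundary : ∀ x₀ ∈ frontier (posSet D v), x₀ ∉ closure D →
    ∀ (y : ℂ) (s : ℝ), TangentBallOutside (posSet D v) x₀ y s →
      ∀ α : ℝ, BelowPlane v x₀ ((s : ℂ)⁻¹ * (x₀ - y)) α → √(f x₀) ≤ α

/-- The radius `R₀ = inf {R > r : M² / (R² ln²(r/R)) < lam}`. -/
def outerRadius (lam M r : ℝ) : ℝ :=
  sInf {R : ℝ | r < R ∧ M ^ 2 / (R ^ 2 * Real.log (r / R) ^ 2) < lam}

/-- The barrier `h(x) = M (ln(|x|/R₀) / ln(r/R₀))⁺`: it equals `M` on `∂B_r(0)`, vanishes outside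
`B_{R₀}(0)`, and `|∇h|² = lam` on `∂B_{R₀}(0)`. -/
def barrier (lam M r : ℝ) (x : ℂ) : ℝ :=
  M * max (Real.log (‖x‖ / outerRadius lam M r) / Real.log (r / outerRadius lam M r)) 0

/-- `u` is the largest subsolution: a continuous function on `ℝ² \ D` which is the pointwise
supremum of all subsolutions lying below the barrier. -/
structure IsLargestSubsolution (D : Set ℂ) (g f : ℂ → ℝ) (lam M r : ℝ) (u : ℂ → ℝ) : Prop where
  continuousOn : ContinuousOn u Dᶜ
  isLUB : ∀ x ∉ D, IsLUB {t : ℝ | ∃ v : ℂ → ℝ, IsSubsolution D g f v ∧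
    (∀ z ∉ D, v z ≤ barrier lam M r z) ∧ t = v x} (u x)

/-- The normalization `x ↦ u(x₀ - ρ x) / ρ` of `u` in `B_ρ(x₀)`, a function on `B_1(0)`. -/
def normalized (u : ℂ → ℝ) (x₀ : ℂ) (ρ : ℝ) (x : ℂ) : ℝ := u (x₀ - ρ * x) / ρ

/-- The interior of the zero set of a function on `B_1(0)`. -/
def zeroInterior (w : ℂ → ℝ) : Set ℂ := interior {x | x ∈ Metric.ball (0 : ℂ) 1 ∧ w x = 0}

end FreeBoundary

end

/-! Suppose that a component `E` of the zero set is compactly contained in the ball. Inside `E`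
pick a disk touching `∂E`, and let `a` be the smallest slope of a cone around this disk that lies
above `u` near the touching point. Then `√f ≤ a` there by the free boundary condition. Where the
cone is almost attained, `u` is close to a plane of slope `a` in a small frame: by maximality the
gap between them behaves like a positive harmonic function, so Harnack's inequality propagates its
smallness. In that frame `u` can be raised to a slightly lifted and steeper harmonic function,
whose free boundary satisfies the condition with room to spare. The raised function is strictly
above `u` on a small disk that reaches into `E`. Filling the rest of `E` with a small bump,
positive on `E` and subharmonic outside that disk, removes the boundary of the zero set along `∂E`.
The result is a larger subsolution, contradicting the maximality of `u`. -/

open scoped ComplexConjugate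

noncomputable section

namespace FreeBoundary

/-! ### The Laplacian at a local maximum -/

section Laplacian

variable {E : Type*} [NormedAddCommGroup E]

lemma deriv_deriv_nonpos_of_isLocalMax {q : ℝ → ℝ} {x : ℝ} (hq : ContinuousAt q x)
    (h : IsLocalMax q x) : deriv (deriv q) x ≤ 0 := by
  by_contra! hpos
  have hmin := isLocalMin_of_deriv_deriv_pos hpos h.deriv_eq_zero hq
  have hconst : q =ᶠ[𝓝 x] fun _ => q x := by
    filter_upwards [h, hmin] with y h₁ h₂ using le_antisymm h₁ h₂
  have hzero : deriv (deriv q) x = 0 := by simpa using hconst.deriv.deriv_eq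
  exact hpos.ne' hzero

lemma deriv_deriv_comp_line [NormedSpace ℝ E] {G : E → ℝ} {x : E} (hG : ContDiffAt ℝ 2 G x)
    (e : E) : deriv (deriv fun t : ℝ => G (x + t • e)) 0 = iteratedFDeriv ℝ 2 G x ![e, e] := by
  have hline (t : ℝ) : HasDerivAt (fun t : ℝ => x + t • e) e t := by
    simpa using ((hasDerivAt_id t).smul_const e).const_add x
  have hline_tendsto : Tendsto (fun t : ℝ => x + t • e) (𝓝 0) (𝓝 x) := by
    simpa using (hline 0).continuousAt.tendsto
  have hdiff : ∀ᶠ y in 𝓝 x, DifferentiableAt ℝ G y :=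
    (hG.eventually (by simp)).mono fun y hy => hy.differentiableAt (by simp)
  have hderiv : deriv (fun t : ℝ => G (x + t • e)) =ᶠ[𝓝 0] fun t => fderiv ℝ G (x + t • e) e :=
    (hline_tendsto.eventually hdiff).mono fun t ht =>
      (ht.hasFDerivAt.comp_hasDerivAt t (hline t)).deriv
  have hfderiv : HasFDerivAt (fderiv ℝ G) (fderiv ℝ (fderiv ℝ G) x) (x + (0 : ℝ) • e) := by
    simpa using
      ((hG.fderiv_right (m := 1) (by norm_num)).differentiableAt (by simp)).hasFDerivAt
  have hderiv₂ : HasDerivAt (fun t : ℝ => fderiv ℝ G (x + t • e) e)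
      (fderiv ℝ (fderiv ℝ G) x e e) 0 := by
    have hcomp := hfderiv.comp_hasDerivAt 0 (hline 0)
    simpa using hcomp.clm_apply (hasDerivAt_const (0 : ℝ) e)
  simpa [hderiv.deriv_eq, iteratedFDeriv_two_apply] using hderiv₂.deriv

lemma iteratedFDeriv_two_nonpos_of_isLocalMax [NormedSpace ℝ E] {G : E → ℝ} {x : E}
    (hG : ContDiffAt ℝ 2 G x) (h : IsLocalMax G x) (e : E) :
    iteratedFDeriv ℝ 2 G x ![e, e] ≤ 0 := by
  have hline : ContinuousAt (fun t : ℝ => x + t • e) 0 := by fun_prop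
  have hmax : IsLocalMax (fun t : ℝ => G (x + t • e)) 0 :=
    IsLocalMax.comp_continuous (f := G) (by simpa using h) hline
  rw [← deriv_deriv_comp_line hG]
  exact deriv_deriv_nonpos_of_isLocalMax
    (ContinuousAt.comp (g := G) (by simpa using hG.continuousAt) hline) hmax

variable [InnerProductSpace ℝ E]

lemma hasFDerivAt_norm_sub_sq (q x : E) :
    HasFDerivAt (fun y : E => ‖y - q‖ ^ 2) (2 • innerSL ℝ (x - q)) x := by
  simpa using ((hasFDerivAt_id x).sub_const q).norm_sq

lemma contDiff_norm_sub_sq (q : E) : ContDiff ℝ 2 (fun x : E => ‖x - q‖ ^ 2) :=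
  (contDiff_id.sub contDiff_const).norm_sq ℝ

lemma contDiffAt_add_mul_norm_sub_sq {G : E → ℝ} {x : E} (hG : ContDiffAt ℝ 2 G x) (c : ℝ)
    (q : E) : ContDiffAt ℝ 2 (fun y => G y + c * ‖y - q‖ ^ 2) x :=
  hG.add (contDiffAt_const.mul (contDiff_norm_sub_sq q).contDiffAt)

variable [FiniteDimensional ℝ E]

lemma laplacian_nonpos_of_isLocalMax {G : E → ℝ} {x : E} (hG : ContDiffAt ℝ 2 G x)
    (h : IsLocalMax G x) : Δ G x ≤ 0 := by
  rw [InnerProductSpace.laplacian_eq_iteratedFDeriv_stdOrthonormalBasis]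
  exact Finset.sum_nonpos fun i _ => iteratedFDeriv_two_nonpos_of_isLocalMax hG h _

lemma continuousAt_laplacian {G : E → ℝ} {x : E} (hG : ContDiffAt ℝ 2 G x) :
    ContinuousAt (Δ G) x := by
  rw [InnerProductSpace.laplacian_eq_iteratedFDeriv_stdOrthonormalBasis]
  have h : ContinuousAt (iteratedFDeriv ℝ 2 G) x :=
    (hG.iteratedFDeriv_right (m := 0) (by norm_num)).continuousAt
  exact tendsto_finsetSum _ fun i _ =>
    (ContinuousMultilinearMap.apply ℝ (fun _ : Fin 2 => E) ℝ _).continuous.continuousAt.comp h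

lemma laplacian_norm_sub_sq (q x : E) :
    Δ (fun y : E => ‖y - q‖ ^ 2) x = 2 * Module.finrank ℝ E := by
  have hfderiv : fderiv ℝ (fun y : E => ‖y - q‖ ^ 2) = fun y => 2 • innerSL ℝ (y - q) :=
    funext fun y => (hasFDerivAt_norm_sub_sq q y).fderiv
  have hsecond : HasFDerivAt (fun y : E => 2 • innerSL ℝ (y - q)) (2 • innerSL ℝ) x :=
    (((innerSL ℝ : E →L[ℝ] E →L[ℝ] ℝ).hasFDerivAt (x := x - q)).comp x
      ((hasFDerivAt_id x).sub_const q)).const_smul 2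
  rw [InnerProductSpace.laplacian_eq_iteratedFDeriv_stdOrthonormalBasis]
  have hdiag (i : Fin (Module.finrank ℝ E)) : iteratedFDeriv ℝ 2 (fun y : E => ‖y - q‖ ^ 2) x
      ![stdOrthonormalBasis ℝ E i, stdOrthonormalBasis ℝ E i] = 2 := by
    rw [iteratedFDeriv_two_apply, hfderiv, hsecond.fderiv]
    change (2 • innerSL ℝ (stdOrthonormalBasis ℝ E i)) (stdOrthonormalBasis ℝ E i) = 2
    simp
  simp [hdiag, mul_comm]

lemma laplacian_add_mul_norm_sub_sq {G : E → ℝ} {x : E} (hG : ContDiffAt ℝ 2 G x) (c : ℝ)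
    (q : E) :
    Δ (fun y => G y + c * ‖y - q‖ ^ 2) x = Δ G x + 2 * Module.finrank ℝ E * c := by
  have hq : ContDiffAt ℝ 2 (fun y : E => ‖y - q‖ ^ 2) x := (contDiff_norm_sub_sq q).contDiffAt
  have hcq : ContDiffAt ℝ 2 (c • fun y : E => ‖y - q‖ ^ 2) x := contDiffAt_const.smul hq
  change Δ (G + c • fun y : E => ‖y - q‖ ^ 2) x = _
  rw [hG.laplacian_add hcq, InnerProductSpace.laplacian_smul _ hq,
    laplacian_norm_sub_sq, smul_eq_mul, mul_comm c]

end Laplacian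

/-! ### Viscosity subharmonicity and comparison -/

lemma viscLaplacianNonneg_of_laplacian_nonneg {v : ℂ → ℝ} {x : ℂ} (hv : ContDiffAt ℝ 2 v x)
    (h : 0 ≤ Δ v x) : ViscLaplacianNonneg v x := by
  intro φ hφ hmax
  have hdiff : Δ v x - Δ φ x ≤ 0 :=
    hv.laplacian_sub hφ ▸ laplacian_nonpos_of_isLocalMax (hv.sub hφ) hmax
  linarith

lemma viscLaplacianNonneg_of_harmonicAt {v : ℂ → ℝ} {x : ℂ}
    (hv : InnerProductSpace.HarmonicAt v x) : ViscLaplacianNonneg v x :=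
  viscLaplacianNonneg_of_laplacian_nonneg hv.1 hv.2.self_of_nhds.ge

namespace ViscLaplacianNonneg

lemma of_touching {v w : ℂ → ℝ} {x : ℂ} (hv : ViscLaplacianNonneg v x)
    (hx : v x = w x) (hle : ∀ᶠ y in 𝓝 x, v y ≤ w y) : ViscLaplacianNonneg w x := by
  intro φ hφ hmax
  refine hv φ hφ ?_
  filter_upwards [hle, hmax] with y hvw hwφ
  linarith

lemma const_mul {v : ℂ → ℝ} {x : ℂ} (hv : ViscLaplacianNonneg v x) {c : ℝ}
    (hc : 0 < c) : ViscLaplacianNonneg (fun y => c * v y) x := by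
  intro φ hφ hmax
  have hscaled : 0 ≤ Δ (c⁻¹ • φ) x := by
    refine hv _ (contDiffAt_const.smul hφ) ?_
    filter_upwards [hmax] with y hy
    simpa [mul_sub, hc.ne'] using mul_le_mul_of_nonneg_left hy (inv_nonneg.2 hc.le)
  rw [InnerProductSpace.laplacian_smul _ hφ, smul_eq_mul] at hscaled
  exact nonneg_of_mul_nonneg_right hscaled (inv_pos.2 hc)

lemma laplacian_add_nonneg {v G : ℂ → ℝ} {x : ℂ} (hv : ViscLaplacianNonneg v x)
    (hG : ContDiffAt ℝ 2 G x) (c : ℝ) (q : ℂ)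
    (hmax : IsLocalMax (fun y => v y - (G y + c * ‖y - q‖ ^ 2)) x) : 0 ≤ Δ G x + 4 * c := by
  have h := hv _ (contDiffAt_add_mul_norm_sub_sq hG c q) hmax
  rw [laplacian_add_mul_norm_sub_sq hG, Complex.finrank_real_complex] at h
  norm_num at h
  exact h

end ViscLaplacianNonneg

lemma le_of_viscLaplacianNonneg {K : Set ℂ} (hK : IsCompact K) {w H : ℂ → ℝ}
    (hw : ContinuousOn w K) (hH : ContinuousOn H K)
    (h : ∀ x ∈ K, H x < w x →
      K ∈ 𝓝 x ∧ ViscLaplacianNonneg w x ∧ ContDiffAt ℝ 2 H x ∧ Δ H x ≤ 0) :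
    ∀ x ∈ K, w x ≤ H x := by
  intro x₁ hx₁
  by_contra! hlt
  obtain ⟨B, hB⟩ := hK.isBounded.subset_closedBall x₁
  set m := w x₁ - H x₁ with hm
  have hm0 : 0 < m := sub_pos.2 hlt
  -- `ε` is so small that `ε ‖x - x₁‖² ≤ m / 2` on `K`; the test function is `H - ε ‖x - x₁‖²`.
  set ε := m / (2 * (B ^ 2 + 1)) with hε
  have hε0 : 0 < ε := div_pos hm0 (by positivity)
  have hεB : ε * B ^ 2 ≤ m / 2 := by
    rw [hε, div_mul_eq_mul_div, div_le_div_iff₀ (by positivity) (by positivity)]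
    nlinarith
  obtain ⟨z, hzK, hz⟩ := hK.exists_isMaxOn ⟨x₁, hx₁⟩
    (f := fun x => w x - (H x + -ε * ‖x - x₁‖ ^ 2)) (by fun_prop)
  have hm_le : m ≤ w z - (H z + -ε * ‖z - x₁‖ ^ 2) := by simpa [hm] using hz hx₁
  have hzB : ‖z - x₁‖ ≤ B := by simpa [dist_eq_norm] using hB hzK
  have hquad : ε * ‖z - x₁‖ ^ 2 ≤ m / 2 := hεB.trans' (by gcongr)
  obtain ⟨hKz, hwz, hHz, hΔ⟩ := h z hzK (by linarith)
  have hnonneg := hwz.laplacian_add_nonneg hHz (-ε) x₁ (hz.isLocalMax hKz)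
  linarith

lemma le_of_le_on_sphere {c : ℂ} {R : ℝ} {w H : ℂ → ℝ}
    (hw : ContinuousOn w (Metric.closedBall c R))
    (hH : InnerProductSpace.HarmonicOnNhd H (Metric.closedBall c R))
    (hsphere : ∀ x ∈ Metric.sphere c R, w x ≤ H x)
    (hvisc : ∀ x ∈ Metric.ball c R, H x < w x → ViscLaplacianNonneg w x) :
    ∀ x ∈ Metric.closedBall c R, w x ≤ H x := by
  refine le_of_viscLaplacianNonneg (isCompact_closedBall c R) hw
    (fun x hx => (hH x hx).1.continuousAt.continuousWithinAt) fun x hx hlt => ?_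
  have hxball : x ∈ Metric.ball c R :=
    (Metric.mem_closedBall.1 hx).lt_of_ne fun heq => (hsphere x heq).not_gt hlt
  exact ⟨Metric.closedBall_mem_nhds_of_mem hxball, hvisc x hxball hlt, (hH x hx).1,
    (hH x hx).2.self_of_nhds.le⟩

lemma exists_isLocalMax_sub_add_norm_sub_sq {E : Type*} [NormedAddCommGroup E] [ProperSpace E]
    {u v φ : E → ℝ} {x₀ : E} {δ ε : ℝ} (hδ : 0 < δ)
    (hv : ContinuousOn v (Metric.closedBall x₀ δ)) (hφ : ContinuousOn φ (Metric.closedBall x₀ δ))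
    (hvu : ∀ x ∈ Metric.closedBall x₀ δ, v x ≤ u x)
    (hmax : ∀ x ∈ Metric.closedBall x₀ δ, u x - φ x ≤ u x₀ - φ x₀)
    (hx₀ : u x₀ - ε * δ ^ 2 < v x₀) :
    ∃ z ∈ Metric.ball x₀ δ, IsLocalMax (fun x => v x - (φ x + ε * ‖x - x₀‖ ^ 2)) z ∧
      v x₀ - φ x₀ ≤ v z - (φ z + ε * ‖z - x₀‖ ^ 2) := by
  obtain ⟨z, hz, hzmax⟩ := (isCompact_closedBall x₀ δ).exists_isMaxOn
    ⟨x₀, Metric.mem_closedBall_self hδ.le⟩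
    (f := fun x => v x - (φ x + ε * ‖x - x₀‖ ^ 2)) (by fun_prop)
  have hle : v x₀ - φ x₀ ≤ v z - (φ z + ε * ‖z - x₀‖ ^ 2) := by
    simpa using hzmax (Metric.mem_closedBall_self hδ.le)
  have hzball : z ∈ Metric.ball x₀ δ := by
    refine (Metric.mem_closedBall.1 hz).lt_of_ne fun hzδ => ?_
    rw [dist_eq_norm] at hzδ
    rw [hzδ] at hle
    linarith [hvu z hz, hmax z hz]
  exact ⟨z, hzball, hzmax.isLocalMax (Metric.closedBall_mem_nhds_of_mem hzball), hle⟩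

/-! ### The largest subsolution is a subsolution -/

lemma posSet_mono {D : Set ℂ} {v w : ℂ → ℝ} (h : ∀ x ∉ D, v x ≤ w x) :
    posSet D v ⊆ posSet D w := fun x hx => ⟨hx.1, hx.2.trans_le (h x hx.1)⟩

lemma BelowPlane.eventually_le {v : ℂ → ℝ} {x₀ ν : ℂ} {α β ε : ℝ} (h : BelowPlane v x₀ ν α)
    (hαβ : α ≤ β) (hε : 0 < ε) :
    ∀ᶠ x in 𝓝 x₀, v x ≤ β * max ⟪x - x₀, ν⟫_ℝ 0 + ε * ‖x - x₀‖ := by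
  obtain ⟨ω, hω, hle⟩ := h
  filter_upwards [hle, hω.def hε] with x hx hωx
  calc v x ≤ α * max ⟪x - x₀, ν⟫_ℝ 0 + ω x := hx
    _ ≤ β * max ⟪x - x₀, ν⟫_ℝ 0 + ε * ‖x - x₀‖ := by
      gcongr
      exact (le_abs_self _).trans hωx

namespace TangentBallOutside

variable {Ω : Set ℂ} {x₀ y : ℂ} {s : ℝ}

lemma norm_normal (h : TangentBallOutside Ω x₀ y s) : ‖(s : ℂ)⁻¹ * (x₀ - y)‖ = 1 := by
  rw [norm_mul, ← dist_eq_norm, h.2.1]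
  simp [abs_of_pos h.1, h.1.ne']

lemma center_eq (h : TangentBallOutside Ω x₀ y s) : y = x₀ - s • ((s : ℂ)⁻¹ * (x₀ - y)) := by
  have hs : (s : ℂ) ≠ 0 := by exact_mod_cast h.1.ne'
  rw [Complex.real_smul, mul_inv_cancel_left₀ hs, sub_sub_cancel]

lemma le_norm_sub (h : TangentBallOutside Ω x₀ y s) {x : ℂ} (hx : x ∈ closure Ω) :
    s ≤ ‖x - y‖ := by
  simpa [dist_eq_norm] using (h.2.2.closure_right Metric.isOpen_ball).notMem_of_mem_right hx

lemma neg_sq_le_inner (h : TangentBallOutside Ω x₀ y s) {x : ℂ} (hx : x ∈ closure Ω) :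
    -‖x - x₀‖ ^ 2 ≤ 2 * s * ⟪x - x₀, (s : ℂ)⁻¹ * (x₀ - y)⟫_ℝ := by
  have hsplit : x - y = (x - x₀) + s • ((s : ℂ)⁻¹ * (x₀ - y)) := by
    conv_lhs => rw [h.center_eq]
    ring
  have hsq : s ^ 2 ≤ ‖x - y‖ ^ 2 := pow_le_pow_left₀ h.1.le (h.le_norm_sub hx) 2
  rw [hsplit, norm_add_sq_real, inner_smul_right, norm_smul, h.norm_normal, mul_one,
    Real.norm_eq_abs, sq_abs] at hsq
  linarith

lemma of_inner_add_norm_sq_pos {n : ℂ} (hn : ‖n‖ = 1) {a C σ : ℝ}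
    (ha : 0 < a) (hσ : 0 < σ) (hCσ : 2 * C * σ ≤ a)
    (h : ∀ x ∈ Metric.ball x₀ (2 * σ), x ∈ Ω → 0 < a * ⟪x - x₀, n⟫_ℝ + C * ‖x - x₀‖ ^ 2) :
    TangentBallOutside Ω x₀ (x₀ - σ • n) σ := by
  have hσn : ‖σ • n‖ = σ := by rw [norm_smul, hn, mul_one, Real.norm_of_nonneg hσ.le]
  refine ⟨hσ, by rw [dist_eq_norm, sub_sub_cancel, hσn], Set.disjoint_left.2 fun x hx hxΩ => ?_⟩
  rw [Metric.mem_ball, dist_eq_norm, sub_sub_eq_add_sub, add_sub_right_comm] at hx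
  have hxball : x ∈ Metric.ball x₀ (2 * σ) := by
    have htri : ‖x - x₀‖ ≤ ‖(x - x₀) + σ • n‖ + ‖σ • n‖ := by
      simpa using norm_sub_le ((x - x₀) + σ • n) (σ • n)
    rw [Metric.mem_ball, dist_eq_norm]
    linarith
  have hinside : ‖x - x₀‖ ^ 2 + 2 * (σ * ⟪x - x₀, n⟫_ℝ) < 0 := by
    have hsq : ‖(x - x₀) + σ • n‖ ^ 2 < σ ^ 2 := pow_lt_pow_left₀ hx (norm_nonneg _) two_ne_zero
    rw [norm_add_sq_real, inner_smul_right, hσn] at hsq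
    linarith
  have hneg : a * (‖x - x₀‖ ^ 2 + 2 * (σ * ⟪x - x₀, n⟫_ℝ)) < 0 := mul_neg_of_pos_of_neg ha hinside
  have hpos : 0 < 2 * σ * (a * ⟪x - x₀, n⟫_ℝ + C * ‖x - x₀‖ ^ 2) :=
    mul_pos (by positivity) (h x hxball hxΩ)
  have hquad : 2 * C * σ * ‖x - x₀‖ ^ 2 ≤ a * ‖x - x₀‖ ^ 2 := by gcongr
  linarith

end TangentBallOutside

lemma isLittleO_const_mul_norm_sub_sq {E : Type*} [NormedAddCommGroup E] (C : ℝ) (x₀ : E) :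
    (fun x => C * ‖x - x₀‖ ^ 2) =o[𝓝 x₀] fun x => x - x₀ := by
  have hsub : Tendsto (fun x : E => x - x₀) (𝓝 x₀) (𝓝 0) := tendsto_sub_nhds_zero_iff.2 tendsto_id
  exact ((isLittleO_norm_pow_id (E' := E) one_lt_two).comp_tendsto hsub).const_mul_left C

/-- A free boundary point below a quadratic touching function is regular from outside, so the free
boundary condition applies to the gradient of that function. -/
lemma IsSubsolution.sqrt_le_of_quadratic {D : Set ℂ} {g f v : ℂ → ℝ} (hv : IsSubsolution D g f v)
    {x₁ G : ℂ} (hG : G ≠ 0) {C : ℝ} (hC : 0 < C)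
    (hx₁ : x₁ ∈ closure (posSet D v)) (hx₁D : x₁ ∉ closure D) (hv0 : v x₁ ≤ 0)
    (hle : ∀ᶠ x in 𝓝 x₁, x ∈ posSet D v → v x ≤ ⟪x - x₁, G⟫_ℝ + C * ‖x - x₁‖ ^ 2) :
    √(f x₁) ≤ ‖G‖ := by
  have ha : 0 < ‖G‖ := norm_pos_iff.2 hG
  set n := ‖G‖⁻¹ • G with hn
  have hn1 : ‖n‖ = 1 := norm_smul_inv_norm hG
  have hinner (k : ℂ) : ⟪k, G⟫_ℝ = ‖G‖ * ⟪k, n⟫_ℝ := by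
    rw [hn, inner_smul_right, mul_inv_cancel_left₀ ha.ne']
  simp only [hinner] at hle
  obtain ⟨ε, hε, hleε⟩ := Metric.eventually_nhds_iff_ball.1 hle
  set σ := min (ε / 2) (‖G‖ / (2 * C))
  have hσ : 0 < σ := lt_min (half_pos hε) (div_pos ha (by positivity))
  have hσε : 2 * σ ≤ ε := by linarith [min_le_left (ε / 2) (‖G‖ / (2 * C))]
  have hCσ : 2 * C * σ ≤ ‖G‖ := by
    rw [← le_div_iff₀' (by positivity)]
    exact min_le_right _ _
  have htangent : TangentBallOutside (posSet D v) x₁ (x₁ - σ • n) σ :=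
    .of_inner_add_norm_sq_pos hn1 ha hσ hCσ fun x hx hxv =>
      hxv.2.trans_le (hleε x (Metric.ball_subset_ball hσε hx) hxv)
  have hnormal : (σ : ℂ)⁻¹ * (x₁ - (x₁ - σ • n)) = n := by
    rw [sub_sub_cancel, Complex.real_smul, inv_mul_cancel_left₀ (by exact_mod_cast hσ.ne')]
  have hfront : x₁ ∈ frontier (posSet D v) :=
    ⟨hx₁, fun h => hv0.not_gt (interior_subset h).2⟩
  refine hv.freeBoundary x₁ hfront hx₁D _ σ htangent ‖G‖ ?_
  rw [hnormal]
  refine ⟨_, isLittleO_const_mul_norm_sub_sq C x₁, ?_⟩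
  filter_upwards [hle, isClosed_closure.isOpen_compl.mem_nhds hx₁D] with x hx hxD
  by_cases hxv : x ∈ posSet D v
  · exact (hx hxv).trans (by gcongr; exact le_max_left _ _)
  · have hvx : v x ≤ 0 := not_lt.1 fun h => hxv ⟨fun h => hxD (subset_closure h), h⟩
    exact hvx.trans (by positivity)

/-- The quadratic polynomial `α t + 2c (X² - 2t²)` in the orthonormal coordinates `t`, `X` along and
across the unit vector `ν` at `x₀`: the strict supersolution against which the free boundary
condition is tested. -/
def quadBarrier (x₀ ν : ℂ) (α c : ℝ) (x : ℂ) : ℝ :=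
  α * ⟪x - x₀, ν⟫_ℝ + 2 * c * (‖x - x₀‖ ^ 2 - 3 * ⟪x - x₀, ν⟫_ℝ ^ 2)

/-- The gradient of `quadBarrier` at `x₁`. -/
def quadBarrierGradient (x₀ ν : ℂ) (α c : ℝ) (x₁ : ℂ) : ℂ :=
  α • ν + (4 * c) • (x₁ - x₀) - (12 * c * ⟪x₁ - x₀, ν⟫_ℝ) • ν

section QuadBarrier

variable {x₀ ν : ℂ} {α c : ℝ}

lemma quadBarrier_self : quadBarrier x₀ ν α c x₀ = 0 := by simp [quadBarrier]

lemma quadBarrier_eq_re (hν : ‖ν‖ = 1) (x : ℂ) :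
    quadBarrier x₀ ν α c x =
      (α * ((x - x₀) * conj ν) - (3 * c : ℝ) * ((x - x₀) * conj ν) ^ 2).re + -c * ‖x - x₀‖ ^ 2 := by
  have hinner : ⟪x - x₀, ν⟫_ℝ = ((x - x₀) * conj ν).re := by simp [Complex.inner]; ring
  have hnorm : ‖x - x₀‖ ^ 2 = ((x - x₀) * conj ν).re ^ 2 + ((x - x₀) * conj ν).im ^ 2 := by
    have : ‖x - x₀‖ = ‖(x - x₀) * conj ν‖ := by simp [hν]
    rw [this, ← Complex.normSq_eq_norm_sq, Complex.normSq_apply]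
    ring
  rw [quadBarrier, hinner, hnorm]
  generalize (x - x₀) * conj ν = ζ
  simp [pow_two]
  ring

lemma harmonicAt_re_quadratic (x : ℂ) : InnerProductSpace.HarmonicAt (fun x : ℂ =>
    (α * ((x - x₀) * conj ν) - (3 * c : ℝ) * ((x - x₀) * conj ν) ^ 2).re) x :=
  AnalyticAt.harmonicAt_re (by fun_prop)

lemma contDiffAt_quadBarrier (hν : ‖ν‖ = 1) (x : ℂ) :
    ContDiffAt ℝ 2 (quadBarrier x₀ ν α c) x := by
  rw [funext (quadBarrier_eq_re hν)]
  exact contDiffAt_add_mul_norm_sub_sq (harmonicAt_re_quadratic x).1 _ _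

lemma laplacian_quadBarrier (hν : ‖ν‖ = 1) (x : ℂ) : Δ (quadBarrier x₀ ν α c) x = -(4 * c) := by
  rw [funext (quadBarrier_eq_re hν), laplacian_add_mul_norm_sub_sq (harmonicAt_re_quadratic x).1,
    (harmonicAt_re_quadratic x).2.self_of_nhds, Complex.finrank_real_complex, Pi.zero_apply]
  push_cast
  ring

lemma quadBarrier_sub_le (hc : 0 ≤ c) (x₁ x : ℂ) :
    quadBarrier x₀ ν α c x - quadBarrier x₀ ν α c x₁ ≤
      ⟪x - x₁, quadBarrierGradient x₀ ν α c x₁⟫_ℝ + 2 * c * ‖x - x₁‖ ^ 2 := by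
  have hsplit : x - x₀ = (x - x₁) + (x₁ - x₀) := by ring
  rw [quadBarrier, quadBarrier, quadBarrierGradient, hsplit, norm_add_sq_real, inner_add_left,
    inner_sub_right _ (_ + _), inner_add_right]
  simp only [inner_smul_right]
  nlinarith [mul_nonneg hc (sq_nonneg ⟪x - x₁, ν⟫_ℝ)]

lemma norm_quadBarrierGradient_sub_le (hν : ‖ν‖ = 1) (hc : 0 ≤ c) (x₁ : ℂ) :
    ‖quadBarrierGradient x₀ ν α c x₁ - α • ν‖ ≤ 16 * c * ‖x₁ - x₀‖ := by
  have hinner : |⟪x₁ - x₀, ν⟫_ℝ| ≤ ‖x₁ - x₀‖ := by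
    simpa [hν] using abs_real_inner_le_norm (x₁ - x₀) ν
  calc ‖quadBarrierGradient x₀ ν α c x₁ - α • ν‖
      = ‖(4 * c) • (x₁ - x₀) - (12 * c * ⟪x₁ - x₀, ν⟫_ℝ) • ν‖ := by
        rw [quadBarrierGradient, add_sub_assoc, add_sub_cancel_left]
    _ ≤ ‖(4 * c) • (x₁ - x₀)‖ + ‖(12 * c * ⟪x₁ - x₀, ν⟫_ℝ) • ν‖ := norm_sub_le _ _
    _ = 4 * c * ‖x₁ - x₀‖ + 12 * c * |⟪x₁ - x₀, ν⟫_ℝ| := by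
        rw [norm_smul, norm_smul, hν, mul_one, Real.norm_of_nonneg (by positivity),
          Real.norm_eq_abs, abs_mul, abs_of_nonneg (by positivity)]
    _ ≤ 4 * c * ‖x₁ - x₀‖ + 12 * c * ‖x₁ - x₀‖ := by gcongr
    _ = 16 * c * ‖x₁ - x₀‖ := by ring

lemma abs_norm_quadBarrierGradient_sub_le (hν : ‖ν‖ = 1) (hα : 0 ≤ α) (hc : 0 ≤ c) (x₁ : ℂ) :
    |‖quadBarrierGradient x₀ ν α c x₁‖ - α| ≤ 16 * c * ‖x₁ - x₀‖ := by
  have hαν : ‖α • ν‖ = α := by rw [norm_smul, hν, mul_one, Real.norm_of_nonneg hα]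
  calc |‖quadBarrierGradient x₀ ν α c x₁‖ - α|
      = |‖quadBarrierGradient x₀ ν α c x₁‖ - ‖α • ν‖| := by rw [hαν]
    _ ≤ ‖quadBarrierGradient x₀ ν α c x₁ - α • ν‖ := abs_norm_sub_norm_le _ _
    _ ≤ 16 * c * ‖x₁ - x₀‖ := norm_quadBarrierGradient_sub_le hν hc x₁

end QuadBarrier

lemma IsSubsolution.le_quadBarrier_add {D : Set ℂ} {g f v : ℂ → ℝ} (hv : IsSubsolution D g f v)
    {x₀ ν : ℂ} (hν : ‖ν‖ = 1) {α c δ m : ℝ} (hc : 0 < c) (hα : 16 * c * δ < α)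
    (hfar : ∀ x ∈ Metric.closedBall x₀ δ, x ∉ closure D)
    (hf : ∀ x ∈ Metric.closedBall x₀ δ, α + 16 * c * δ < √(f x))
    (hsphere : ∀ x ∈ Metric.sphere x₀ δ, x ∈ closure (posSet D v) →
      v x ≤ quadBarrier x₀ ν α c x + m)
    {x : ℂ} (hx : x ∈ Metric.closedBall x₀ δ) (hxv : x ∈ posSet D v) :
    v x ≤ quadBarrier x₀ ν α c x + m := by
  set Φ := quadBarrier x₀ ν α c
  have hΦ : Continuous Φ :=
    continuous_iff_continuousAt.2 fun x => (contDiffAt_quadBarrier hν x).continuousAt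
  have hfarD : ∀ x ∈ Metric.closedBall x₀ δ, x ∉ D := fun x hx h => hfar x hx (subset_closure h)
  have hvc : ContinuousOn v (Metric.closedBall x₀ δ) := hv.continuousOn.mono hfarD
  obtain ⟨x₁, ⟨hx₁, hx₁v⟩, hmax⟩ :=
    ((isCompact_closedBall x₀ δ).inter_right isClosed_closure).exists_isMaxOn
      ⟨x, hx, subset_closure hxv⟩ (f := fun x => v x - Φ x)
      ((hvc.mono inter_subset_left).sub hΦ.continuousOn)
  by_contra! hlt
  have hx₁lt : Φ x₁ + m < v x₁ := by
    have : v x - Φ x ≤ v x₁ - Φ x₁ := hmax ⟨hx, subset_closure hxv⟩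
    linarith
  have hx₁δ : ‖x₁ - x₀‖ ≤ δ := by simpa [dist_eq_norm] using hx₁
  have hx₁ball : x₁ ∈ Metric.ball x₀ δ := (Metric.mem_closedBall.1 hx₁).lt_of_ne fun h =>
    (hsphere x₁ h hx₁v).not_gt hx₁lt
  have hnhds : Metric.closedBall x₀ δ ∈ 𝓝 x₁ := Metric.closedBall_mem_nhds_of_mem hx₁ball
  have hmax_nhds : ∀ᶠ z in 𝓝 x₁, z ∈ posSet D v → v z - Φ z ≤ v x₁ - Φ x₁ := by
    filter_upwards [hnhds] with z hz hzv using hmax ⟨hz, subset_closure hzv⟩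
  rcases lt_or_ge 0 (v x₁) with hpos | hnonpos
  · have hlocal : IsLocalMax (fun z => v z - Φ z) x₁ := by
      filter_upwards [hmax_nhds, hnhds, (hvc.continuousAt hnhds).eventually_const_lt hpos]
        with z hz hzδ hvz using hz ⟨hfarD z hzδ, hvz⟩
    have hnonneg := hv.subharmonic x₁ ⟨hfarD x₁ hx₁, hpos⟩ (hfar x₁ hx₁) Φ
      (contDiffAt_quadBarrier hν x₁) hlocal
    rw [laplacian_quadBarrier hν] at hnonneg
    linarith
  · have hv0 : v x₁ = 0 := hnonpos.antisymm (hv.nonneg x₁ (hfarD x₁ hx₁))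
    have hδ : 0 ≤ δ := (norm_nonneg _).trans hx₁δ
    obtain ⟨hslope_gt, hslope_lt⟩ := abs_sub_le_iff.1
      ((abs_norm_quadBarrierGradient_sub_le hν (hα.le.trans' (by positivity)) hc.le x₁).trans
        (mul_le_mul_of_nonneg_left hx₁δ (by positivity)))
    have hslope : √(f x₁) ≤ ‖quadBarrierGradient x₀ ν α c x₁‖ := by
      refine hv.sqrt_le_of_quadratic (C := 2 * c) (norm_pos_iff.1 (by linarith))
        (by positivity) hx₁v (hfar x₁ hx₁) hnonpos ?_
      filter_upwards [hmax_nhds] with z hz hzv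
      linarith [hz hzv, hv0, quadBarrier_sub_le (x₀ := x₀) (ν := ν) (α := α) hc.le x₁ z]
    linarith [hf x₁ hx₁]

lemma mul_max_add_le_of_neg_sq_le {α γ δ s t : ℝ} (hα : 0 ≤ α) (hγ : 0 < γ) (hδ : 0 < δ)
    (hs : 0 < s) (hδs : δ ≤ s) (hγs : (α + γ / 4) * δ ≤ γ * s / 512)
    (htδ : t ≤ δ) (ht : -δ ^ 2 ≤ 2 * s * t) :
    α * max t 0 + 3 * γ / 1024 * δ ≤
      (α + γ / 4) * t + 2 * (γ / (128 * δ)) * (δ ^ 2 - 3 * t ^ 2) := by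
  have hquad : 2 * (γ / (128 * δ)) * (δ ^ 2 - 3 * t ^ 2) =
      γ * δ / 64 - 3 * γ * t ^ 2 / (64 * δ) := by
    field_simp
    ring
  rw [hquad]
  rcases le_total 0 t with h0 | h0
  · have hsq : 3 * γ * t ^ 2 / (64 * δ) ≤ 3 * γ * t / 64 := by
      rw [div_le_div_iff₀ (by positivity) (by norm_num)]
      nlinarith [mul_nonneg (mul_nonneg hγ.le h0) (sub_nonneg.2 htδ)]
    rw [max_eq_left h0]
    nlinarith [mul_nonneg hγ.le h0, mul_pos hγ hδ]
  · have htδ' : -(δ / 2) ≤ t := by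
      by_contra! h
      nlinarith
    have hsq : 3 * γ * t ^ 2 / (64 * δ) ≤ 3 * γ * δ / 256 := by
      rw [div_le_div_iff₀ (by positivity) (by norm_num)]
      nlinarith [mul_nonneg hγ.le (mul_nonneg (sub_nonneg.2 (h0.trans (half_pos hδ).le))
        (neg_le_iff_add_nonneg.1 htδ'))]
    have hlin : -(γ * δ / 1024) ≤ (α + γ / 4) * t := by
      have hslope : (α + γ / 4) * δ * δ ≤ γ * s / 512 * δ := by gcongr
      have hscaled : (α + γ / 4) * (-δ ^ 2) ≤ (α + γ / 4) * (2 * s * t) := by gcongr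
      exact le_of_mul_le_mul_left (by linarith) hs
    rw [max_eq_right h0]
    nlinarith [mul_pos hγ hδ]

lemma TangentBallOutside.add_le_quadBarrier {Ω : Set ℂ} {x₀ y x : ℂ} {s α γ δ : ℝ}
    (h : TangentBallOutside Ω x₀ y s) (hα : 0 ≤ α) (hγ : 0 < γ) (hδ : 0 < δ) (hδs : δ ≤ s)
    (hγs : (α + γ / 4) * δ ≤ γ * s / 512) (hx : x ∈ closure Ω) (hxδ : ‖x - x₀‖ = δ) :
    α * max ⟪x - x₀, (s : ℂ)⁻¹ * (x₀ - y)⟫_ℝ 0 + 3 * γ / 1024 * δ ≤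
      quadBarrier x₀ ((s : ℂ)⁻¹ * (x₀ - y)) (α + γ / 4) (γ / (128 * δ)) x := by
  have htδ : ⟪x - x₀, (s : ℂ)⁻¹ * (x₀ - y)⟫_ℝ ≤ δ := by
    simpa only [h.norm_normal, hxδ, mul_one] using
      real_inner_le_norm (x - x₀) ((s : ℂ)⁻¹ * (x₀ - y))
  rw [quadBarrier, hxδ]
  exact mul_max_add_le_of_neg_sq_le hα hγ hδ h.1 hδs hγs htδ (hxδ ▸ h.neg_sq_le_inner hx)

namespace IsLargestSubsolution

variable {D : Set ℂ} {g f : ℂ → ℝ} {lam M r : ℝ} {u : ℂ → ℝ}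

lemma exists_gt (hu : IsLargestSubsolution D g f lam M r u) {x : ℂ} (hx : x ∉ D) {c : ℝ}
    (hc : c < u x) : ∃ v, IsSubsolution D g f v ∧ (∀ z ∉ D, v z ≤ u z) ∧ c < v x := by
  obtain ⟨t, ⟨v, hv, hvb, rfl⟩, ht⟩ := (lt_isLUB_iff (hu.isLUB x hx)).1 hc
  exact ⟨v, hv, fun z hz => (hu.isLUB z hz).1 ⟨v, hv, hvb, rfl⟩, ht⟩

lemma viscLaplacianNonneg (hu : IsLargestSubsolution D g f lam M r u) {x₀ : ℂ}
    (hx₀ : x₀ ∉ closure D) (hpos : 0 < u x₀) : ViscLaplacianNonneg u x₀ := by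
  intro φ hφ hmax
  by_contra! hneg
  set ε := -(Δ φ x₀) / 8 with hε
  have hε0 : 0 < ε := by linarith
  have hev : ∀ᶠ x in 𝓝 x₀, (u x - φ x ≤ u x₀ - φ x₀ ∧ ContDiffAt ℝ 2 φ x ∧ Δ φ x < -(4 * ε)) ∧
      x ∉ closure D ∧ φ x₀ - u x₀ / 2 < φ x :=
    (hmax.and ((hφ.eventually (by simp)).and
      ((continuousAt_laplacian hφ).eventually_lt_const (by linarith)))).and
      ((isClosed_closure.isOpen_compl.eventually_mem hx₀).and
        (hφ.continuousAt.eventually_const_lt (by linarith)))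
  obtain ⟨δ, hδ, hball⟩ := Metric.nhds_basis_closedBall.mem_iff.1 hev
  have hfarD : ∀ x ∈ Metric.closedBall x₀ δ, x ∉ D := fun x hx h =>
    (hball hx).2.1 (subset_closure h)
  obtain ⟨v, hv, hvu, hvx⟩ := hu.exists_gt (hfarD x₀ (Metric.mem_closedBall_self hδ.le))
    (c := max (u x₀ - ε * δ ^ 2) (u x₀ / 2))
    (max_lt (sub_lt_self _ (by positivity)) (half_lt_self hpos))
  obtain ⟨hvε, hvhalf⟩ := max_lt_iff.1 hvx
  obtain ⟨z, hz, hzmax, hle⟩ := exists_isLocalMax_sub_add_norm_sub_sq hδ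
    (hv.continuousOn.mono hfarD)
    (fun x hx => (hball hx).1.2.1.continuousAt.continuousWithinAt)
    (fun x hx => hvu x (hfarD x hx)) (fun x hx => (hball hx).1.1) hvε
  have hzδ := Metric.ball_subset_closedBall hz
  obtain ⟨⟨-, hφz, hΔz⟩, hzD, hφz_gt⟩ := hball hzδ
  have hvz : 0 < v z := by
    have : 0 ≤ ε * ‖z - x₀‖ ^ 2 := by positivity
    linarith
  have hnonneg := (hv.subharmonic z ⟨hfarD z hzδ, hvz⟩ hzD).laplacian_add_nonneg hφz ε x₀ hzmax
  linarith

lemma notMem_closure_posSet (hu : IsLargestSubsolution D g f lam M r u) {x₀ ν : ℂ} (hν : ‖ν‖ = 1)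
    {α c δ m : ℝ} (hδ : 0 < δ) (hm : 0 < m) (hc : 0 < c) (hα : 16 * c * δ < α)
    (hfar : ∀ x ∈ Metric.closedBall x₀ δ, x ∉ closure D)
    (hf : ∀ x ∈ Metric.closedBall x₀ δ, α + 16 * c * δ < √(f x))
    (hsphere : ∀ x ∈ Metric.sphere x₀ δ, x ∈ closure (posSet D u) →
      u x + m ≤ quadBarrier x₀ ν α c x) : x₀ ∉ closure (posSet D u) := by
  intro hx₀
  have hΦ : ContinuousAt (quadBarrier x₀ ν α c) x₀ := (contDiffAt_quadBarrier hν x₀).continuousAt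
  obtain ⟨x, ⟨hxm, hxδ⟩, hxu⟩ := mem_closure_iff_nhds.1 hx₀
    ({x | quadBarrier x₀ ν α c x < m} ∩ Metric.closedBall x₀ δ)
    (inter_mem (hΦ.eventually_lt_const (quadBarrier_self.trans_lt hm))
      (Metric.closedBall_mem_nhds _ hδ))
  obtain ⟨v, hv, hvu, hvpos⟩ := hu.exists_gt hxu.1 hxu.2
  have hle : v x ≤ quadBarrier x₀ ν α c x + -m := by
    refine hv.le_quadBarrier_add hν hc hα hfar hf (fun z hz hzv => ?_) hxδ ⟨hxu.1, hvpos⟩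
    have hzD : z ∉ D := fun h => hfar z (Metric.sphere_subset_closedBall hz) (subset_closure h)
    linarith [hvu z hzD, hsphere z hz (closure_mono (posSet_mono hvu) hzv)]
  have hxm' : quadBarrier x₀ ν α c x < m := hxm
  linarith

lemma sqrt_le (hu : IsLargestSubsolution D g f lam M r u) (hf : Continuous f)
    (hfpos : ∀ x, 0 < f x) {x₀ y : ℂ} {s α : ℝ} (hx₀ : x₀ ∈ frontier (posSet D u))
    (hx₀D : x₀ ∉ closure D) (hT : TangentBallOutside (posSet D u) x₀ y s)
    (hB : BelowPlane u x₀ ((s : ℂ)⁻¹ * (x₀ - y)) α) : √(f x₀) ≤ α := by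
  by_contra! hlt
  set ν := (s : ℂ)⁻¹ * (x₀ - y)
  set α₀ := max α 0
  have hα₀ : 0 ≤ α₀ := le_max_right _ _
  set γ := √(f x₀) - α₀ with hγdef
  have hγ : 0 < γ := sub_pos.2 (max_lt hlt (Real.sqrt_pos.2 (hfpos _)))
  have hev : ∀ᶠ x in 𝓝 x₀, u x ≤ α₀ * max ⟪x - x₀, ν⟫_ℝ 0 + γ / 1024 * ‖x - x₀‖ ∧
      x ∉ closure D ∧ α₀ + γ / 2 < √(f x) :=
    (hB.eventually_le (le_max_left α 0) (by positivity)).and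
      ((isClosed_closure.isOpen_compl.eventually_mem hx₀D).and
        (hf.sqrt.continuousAt.eventually_const_lt (by linarith [hγdef])))
  obtain ⟨δ₁, hδ₁, hball⟩ := Metric.nhds_basis_closedBall.mem_iff.1 hev
  have hs := hT.1
  obtain ⟨δ, hδ, hδ_le⟩ : ∃ δ, 0 < δ ∧ δ ≤ min δ₁ (min s (γ * s / 512 / (α₀ + γ / 4))) :=
    ⟨_, by positivity, le_rfl⟩
  obtain ⟨hδδ₁, hδs, hγs⟩ := by simpa only [le_min_iff] using hδ_le
  rw [le_div_iff₀' (by positivity)] at hγs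
  replace hball : ∀ x ∈ Metric.closedBall x₀ δ, _ := fun x hx =>
    hball (Metric.closedBall_subset_closedBall hδδ₁ hx)
  have hcδ : 16 * (γ / (128 * δ)) * δ = γ / 8 := by
    field_simp
    norm_num
  refine hu.notMem_closure_posSet hT.norm_normal (α := α₀ + γ / 4) (c := γ / (128 * δ))
    (m := γ / 512 * δ) hδ (by positivity) (by positivity) (by linarith)
    (fun z hz => (hball z hz).2.1) (fun z hz => by linarith [(hball z hz).2.2])
    (fun z hz hzu => ?_) hx₀.1
  have hzδ : ‖z - x₀‖ = δ := by simpa [dist_eq_norm] using hz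
  have huz := (hball z (Metric.sphere_subset_closedBall hz)).1
  rw [hzδ] at huz
  linarith [hT.add_le_quadBarrier hα₀ hγ hδ hδs hγs hzu hzδ]

lemma isSubsolution (hD : IsOpen D) (hu : IsLargestSubsolution D g f lam M r u)
    (hf : Continuous f) (hfpos : ∀ x, 0 < f x) : IsSubsolution D g f u where
  continuousOn := hu.continuousOn
  nonneg x hx := by
    obtain ⟨v, hv, hvu, -⟩ := hu.exists_gt hx (sub_one_lt (u x))
    exact (hv.nonneg x hx).trans (hvu x hx)
  subharmonic x hx hxD := hu.viscLaplacianNonneg hxD hx.2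
  le_boundary x hx := by
    refine (isLUB_le_iff (hu.isLUB x fun h => hx.2 (by rwa [hD.interior_eq]))).2 ?_
    rintro _ ⟨v, hv, -, rfl⟩
    exact hv.le_boundary x hx
  freeBoundary x₀ hx₀ hx₀D y s hT α hB := hu.sqrt_le hf hfpos hx₀ hx₀D hT hB

lemma le_barrier (hu : IsLargestSubsolution D g f lam M r u) {x : ℂ} (hx : x ∉ D) :
    u x ≤ barrier lam M r x := by
  refine (isLUB_le_iff (hu.isLUB x hx)).2 ?_
  rintro _ ⟨v, -, hvb, rfl⟩
  exact hvb x hx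

end IsLargestSubsolution

/-! ### The barrier -/

lemma harmonicAt_log_norm_sub {q x : ℂ} (hx : x ≠ q) (A B : ℝ) :
    InnerProductSpace.HarmonicAt (fun y => A * Real.log ‖y - q‖ + B) x := by
  have hanalytic : AnalyticAt ℂ (fun y : ℂ => y - q) x := by fun_prop
  exact ((hanalytic.harmonicAt_log_norm (sub_ne_zero.2 hx)).const_smul (c := A)).add
    (InnerProductSpace.harmonicAt_const B)

section Barrier

variable {lam M r : ℝ}

lemma exists_div_sq_mul_log_sq_lt (hlam : 0 < lam) (hr : 0 < r) :
    ∃ R, r < R ∧ M ^ 2 / (R ^ 2 * Real.log (r / R) ^ 2) < lam := by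
  set t := 1 + M ^ 2 / (lam * r ^ 2) with ht
  have ht1 : 1 ≤ t := le_add_of_nonneg_right (by positivity)
  have hrR : r < r * Real.exp t :=
    lt_mul_of_one_lt_right hr (Real.one_lt_exp_iff.2 (by linarith))
  have hlog : Real.log (r / (r * Real.exp t)) ^ 2 = t ^ 2 := by
    rw [div_mul_cancel_left₀ hr.ne', Real.log_inv, Real.log_exp, neg_sq]
  refine ⟨r * Real.exp t, hrR, ?_⟩
  rw [hlog, div_lt_iff₀ (by positivity)]
  calc M ^ 2 = lam * (r ^ 2 * (t - 1)) := by rw [ht]; field_simp; ring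
    _ < lam * (r ^ 2 * t ^ 2) := by gcongr; nlinarith
    _ ≤ lam * ((r * Real.exp t) ^ 2 * t ^ 2) := by gcongr

lemma lt_outerRadius (hlam : 0 < lam) (hM : 0 < M) (hr : 0 < r) : r < outerRadius lam M r := by
  have hcont : ContinuousAt (fun R => lam * (R ^ 2 * Real.log (r / R) ^ 2)) r := by
    have hdiv : ContinuousAt (fun R => r / R) r := continuousAt_const.div continuousAt_id hr.ne'
    have hlog : ContinuousAt (fun R => Real.log (r / R)) r := hdiv.log (by simp [hr.ne'])
    fun_prop
  have hsmall : ∀ᶠ R in 𝓝 r, lam * (R ^ 2 * Real.log (r / R) ^ 2) < M ^ 2 :=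
    hcont.eventually_lt_const (by simpa [hr.ne'] using pow_pos hM 2)
  obtain ⟨δ, hδ, hball⟩ := Metric.eventually_nhds_iff_ball.1 hsmall
  refine (lt_add_of_pos_right r hδ).trans_le
    (le_csInf (exists_div_sq_mul_log_sq_lt hlam hr) fun R ⟨hrR, hR⟩ => ?_)
  by_contra! hRδ
  have hRball : R ∈ Metric.ball r δ := by
    rw [Metric.mem_ball, Real.dist_eq, abs_of_pos (by linarith)]
    linarith
  have hR0 : 0 < R := hr.trans hrR
  have hlog : Real.log (r / R) ≠ 0 :=
    (Real.log_neg (div_pos hr hR0) ((div_lt_one hR0).2 hrR)).ne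
  rw [div_lt_iff₀ (by positivity)] at hR
  exact (hball R hRball).not_gt hR

lemma log_div_outerRadius_neg (hr : 0 < r) (hR : r < outerRadius lam M r) :
    Real.log (r / outerRadius lam M r) < 0 :=
  Real.log_neg (div_pos hr (hr.trans hR)) ((div_lt_one (hr.trans hR)).2 hR)

lemma continuousAt_barrier (hR : outerRadius lam M r ≠ 0) {x : ℂ} (hx : x ≠ 0) :
    ContinuousAt (barrier lam M r) x := by
  have hlog : ContinuousAt (fun x : ℂ => Real.log (‖x‖ / outerRadius lam M r)) x :=
    ContinuousAt.log (by fun_prop) (div_ne_zero (norm_ne_zero_iff.2 hx) hR)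
  unfold barrier
  fun_prop

lemma barrier_eq_zero (hr : 0 < r) (hR : r < outerRadius lam M r) {x : ℂ}
    (hx : outerRadius lam M r ≤ ‖x‖) : barrier lam M r x = 0 := by
  have hlog : 0 ≤ Real.log (‖x‖ / outerRadius lam M r) :=
    Real.log_nonneg ((one_le_div (hr.trans hR)).2 hx)
  rw [barrier, max_eq_right (div_nonpos_of_nonneg_of_nonpos hlog
    (log_div_outerRadius_neg hr hR).le), mul_zero]

lemma harmonicAt_barrier (hr : 0 < r) (hR : r < outerRadius lam M r) {x : ℂ}
    (hx0 : x ≠ 0) (hx : ‖x‖ < outerRadius lam M r) :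
    InnerProductSpace.HarmonicAt (barrier lam M r) x := by
  have hR0 := hr.trans hR
  have hneg := log_div_outerRadius_neg hr hR
  set R := outerRadius lam M r
  set k := Real.log (r / R)
  have hev : barrier lam M r =ᶠ[𝓝 x]
      fun y => M / k * Real.log ‖y - 0‖ + (-(M / k * Real.log R)) := by
    filter_upwards [continuous_norm.continuousAt.eventually_lt_const hx,
      continuous_norm.continuousAt.eventually_const_lt (norm_pos_iff.2 hx0)] with y hyR hy0
    have hlog : Real.log (‖y‖ / R) ≤ 0 :=
      Real.log_nonpos (by positivity) ((div_le_one hR0).2 hyR.le)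
    rw [barrier, max_eq_left (div_nonneg_of_nonpos hlog hneg.le), Real.log_div hy0.ne' hR0.ne',
      sub_zero]
    ring
  exact (InnerProductSpace.harmonicAt_congr_nhds hev).2 (harmonicAt_log_norm_sub hx0 _ _)

end Barrier

/-! ### Competitors -/

lemma continuousAt_of_notMem_closure {D : Set ℂ} {v : ℂ → ℝ} (hv : ContinuousOn v Dᶜ) {x : ℂ}
    (hx : x ∉ closure D) : ContinuousAt v x :=
  hv.continuousAt (mem_of_superset (isClosed_closure.isOpen_compl.mem_nhds hx)
    (compl_subset_compl.2 subset_closure))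

/-- `w` modifies `u` upwards inside a compact set `K` away from `D`, increasing it only in `G`; it
is subharmonic where it exceeds `u`, and steep enough at the free boundary points which it
creates. -/
structure IsCompetitor (D : Set ℂ) (f u : ℂ → ℝ) (G K : Set ℂ) (w : ℂ → ℝ) : Prop where
  isCompact : IsCompact K
  disjoint : Disjoint K (closure D)
  eq_outside : ∀ x ∉ K, w x = u x
  continuousOn : ContinuousOn w Dᶜ
  le : ∀ x, u x ≤ w x
  mem_of_lt : ∀ x, u x < w x → x ∈ G
  subharmonic : ∀ x, u x < w x → ViscLaplacianNonneg w x
  freeBoundary : ∀ x ∈ frontier (posSet D w), x ∉ closure D → x ∉ closure (posSet D u) →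
    ∀ (ν : ℂ) (α : ℝ), ‖ν‖ = 1 → BelowPlane w x ν α → √(f x) ≤ α

/-- No competitor exceeds `u` within `G`. -/
def MaximalOn (D : Set ℂ) (f u : ℂ → ℝ) (G : Set ℂ) : Prop :=
  ∀ (w : ℂ → ℝ) (K : Set ℂ), IsCompetitor D f u G K w → ∀ x, w x ≤ u x

lemma BelowPlane.mono {v w : ℂ → ℝ} {x ν : ℂ} {α : ℝ} (h : BelowPlane w x ν α)
    (hle : ∀ y, v y ≤ w y) : BelowPlane v x ν α := by
  obtain ⟨ω, hω, hw⟩ := h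
  exact ⟨ω, hω, hw.mono fun y hy => (hle y).trans hy⟩

namespace IsCompetitor

variable {D G K : Set ℂ} {f g u w : ℂ → ℝ}

lemma isSubsolution (h : IsCompetitor D f u G K w) (hu : IsSubsolution D g f u) :
    IsSubsolution D g f w where
  continuousOn := h.continuousOn
  nonneg x hx := (hu.nonneg x hx).trans (h.le x)
  subharmonic x hx hxD := by
    rcases (h.le x).lt_or_eq with hlt | heq
    · exact h.subharmonic x hlt
    · exact (hu.subharmonic x ⟨hx.1, heq ▸ hx.2⟩ hxD).of_touching heq (Eventually.of_forall h.le)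
  le_boundary x hx := by
    rw [h.eq_outside x fun hxK => h.disjoint.notMem_of_mem_left hxK hx.1]
    exact hu.le_boundary x hx
  freeBoundary x hx hxD y s hT α hB := by
    have hΩ : posSet D u ⊆ posSet D w := posSet_mono fun x _ => h.le x
    by_cases hxu : x ∈ closure (posSet D u)
    · exact hu.freeBoundary x ⟨hxu, fun hint => hx.2 (interior_mono hΩ hint)⟩ hxD y s
        ⟨hT.1, hT.2.1, hT.2.2.mono_right hΩ⟩ α (hB.mono h.le)
    · exact h.freeBoundary x hx hxD hxu _ α hT.norm_normal hB

lemma le_barrier {lam M r : ℝ}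
    (h : IsCompetitor D f u (Metric.ball 0 (outerRadius lam M r)) K w) (h0 : (0 : ℂ) ∈ D)
    (hr : 0 < r) (hR : r < outerRadius lam M r) (hu : ContinuousOn u Dᶜ)
    (hub : ∀ x ∉ D, u x ≤ barrier lam M r x) {x : ℂ} (hx : x ∉ D) :
    w x ≤ barrier lam M r x := by
  by_cases hxK : x ∈ K
  swap
  · exact (h.eq_outside x hxK).trans_le (hub x hx)
  have hKD : ∀ y ∈ K, y ∉ closure D := fun y hy => h.disjoint.notMem_of_mem_left hy
  have hKD' : ∀ y ∈ K, y ∉ D := fun y hy hyD => hKD y hy (subset_closure hyD)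
  have hK0 : ∀ y ∈ K, y ≠ 0 := fun y hy hy0 => hKD' y hy (hy0 ▸ h0)
  refine le_of_viscLaplacianNonneg h.isCompact (h.continuousOn.mono hKD')
    (fun y hy => (continuousAt_barrier (hr.trans hR).ne' (hK0 y hy)).continuousWithinAt)
    (fun y hy hlt => ?_) x hxK
  have huw : u y < w y := (hub y (hKD' y hy)).trans_lt hlt
  have hharm := harmonicAt_barrier hr hR (hK0 y hy) (by simpa using h.mem_of_lt y huw)
  refine ⟨?_, h.subharmonic y huw, hharm.1, hharm.2.self_of_nhds.le⟩
  filter_upwards [(continuousAt_of_notMem_closure hu (hKD y hy)).eventually_lt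
    (continuousAt_of_notMem_closure h.continuousOn (hKD y hy)) huw] with z hz
  by_contra hzK
  exact hz.ne (h.eq_outside z hzK).symm

end IsCompetitor

lemma IsLargestSubsolution.maximalOn {D : Set ℂ} {g f : ℂ → ℝ} {lam M r : ℝ} {u : ℂ → ℝ}
    (hu : IsLargestSubsolution D g f lam M r u) (hD : IsOpen D) (h0 : (0 : ℂ) ∈ D)
    (hf : Continuous f) (hfpos : ∀ x, 0 < f x) (hr : 0 < r)
    (hR : r < outerRadius lam M r) :
    MaximalOn D f u (Metric.ball 0 (outerRadius lam M r)) := by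
  intro w K hw x
  by_cases hx : x ∈ D
  · exact (hw.eq_outside x fun hxK =>
      hw.disjoint.notMem_of_mem_left hxK (subset_closure hx)).le
  · exact (hu.isLUB x hx).1 ⟨w, hw.isSubsolution (hu.isSubsolution hD hf hfpos),
      fun z hz => hw.le_barrier h0 hr hR hu.continuousOn (fun _ => hu.le_barrier) hz, rfl⟩

lemma BelowPlane.apply_le {w φ : ℂ → ℝ} {x ν : ℂ} {α : ℝ} {L : ℂ →L[ℝ] ℝ}
    (hB : BelowPlane w x ν α) (hφ : HasFDerivAt φ L x) (hφx : φ x = 0)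
    (hle : ∀ᶠ y in 𝓝 x, φ y ≤ w y) (e : ℂ) : L e ≤ α * max ⟪e, ν⟫_ℝ 0 := by
  obtain ⟨ω, hω, hωle⟩ := hB
  have hψ : (fun y => φ y - φ x - L (y - x) - ω y) =o[𝓝 x] fun y => y - x := hφ.isLittleO.sub hω
  have hline : Tendsto (fun t : ℝ => x + t • e) (𝓝[>] 0) (𝓝 x) := by
    have : ContinuousAt (fun t : ℝ => x + t • e) 0 := by fun_prop
    simpa [ContinuousAt] using this.tendsto.mono_left nhdsWithin_le_nhds
  refine le_of_forall_pos_le_add fun ε hε => ?_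
  have hη : 0 < ε / (‖e‖ + 1) := by positivity
  obtain ⟨t, ⟨hψt, hwt, hφt⟩, ht⟩ :=
    ((hline.eventually ((hψ.def hη).and (hωle.and hle))).and self_mem_nhdsWithin).exists
  have ht : 0 < t := ht
  have hmax : max (t * ⟪e, ν⟫_ℝ) 0 = t * max ⟪e, ν⟫_ℝ 0 := by
    rw [mul_max_of_nonneg _ _ ht.le, mul_zero]
  have herr : ε / (‖e‖ + 1) * (t * ‖e‖) ≤ t * ε := by
    rw [div_mul_eq_mul_div, div_le_iff₀ (by positivity)]
    nlinarith [mul_pos ht hε]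
  rw [add_sub_cancel_left, real_inner_smul_left, hmax] at hwt
  rw [add_sub_cancel_left, norm_smul, Real.norm_of_nonneg ht.le, map_smul, smul_eq_mul, hφx,
    Real.norm_eq_abs] at hψt
  refine le_of_mul_le_mul_left ?_ ht
  linarith [(abs_le.1 hψt).1]

lemma BelowPlane.apply_le_slope {w φ : ℂ → ℝ} {x ν e : ℂ} {α : ℝ} {L : ℂ →L[ℝ] ℝ}
    (hB : BelowPlane w x ν α) (hν : ‖ν‖ = 1) (he : ‖e‖ = 1) (hφ : HasFDerivAt φ L x)
    (hφx : φ x = 0) (hle : ∀ᶠ y in 𝓝 x, φ y ≤ w y) (hpos : 0 < L e) : L e ≤ α := by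
  have hLe : L e ≤ α * max ⟪e, ν⟫_ℝ 0 := hB.apply_le hφ hφx hle e
  have hmax_le : max ⟪e, ν⟫_ℝ 0 ≤ 1 :=
    max_le (by simpa only [he, hν, mul_one] using real_inner_le_norm e ν) zero_le_one
  have hα : 0 ≤ α := by
    by_contra! h
    nlinarith [le_max_right ⟪e, ν⟫_ℝ 0]
  exact hLe.trans (mul_le_of_le_one_right hα hmax_le)

/-! ### Harmonic functions on disks -/

lemma poissonKernel_mem_Icc {c w x : ℂ} {R : ℝ} (hR : 0 < R) (hx : x ∈ Metric.sphere c R)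
    (hw : ‖w - c‖ ≤ R / 2) : poissonKernel c w x ∈ Icc (1 / 3) 3 := by
  have hwb : w ∈ Metric.ball c R := by
    rw [Metric.mem_ball, dist_eq_norm]
    linarith
  have hkernel : poissonKernel c w x = ((x - c + (w - c)) / (x - c - (w - c))).re := by
    rw [poissonKernel_eq_re_herglotzRieszKernel]
    rfl
  have hn := norm_nonneg (w - c)
  rw [hkernel]
  refine ⟨le_trans ?_ (le_re_herglotzRieszKernel hx hwb),
    (re_herglotzRieszKernel_le hx hwb).trans ?_⟩
  · rw [div_le_div_iff₀ (by norm_num) (by linarith)]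
    linarith
  · rw [div_le_iff₀ (by linarith)]
    linarith

lemma harnack {H : ℂ → ℝ} {c w : ℂ} {R : ℝ} (hR : 0 < R)
    (hH : InnerProductSpace.HarmonicOnNhd H (Metric.closedBall c R))
    (hpos : ∀ x ∈ Metric.sphere c R, 0 ≤ H x) (hw : ‖w - c‖ ≤ R / 2) :
    H c ≤ 3 * H w ∧ H w ≤ 3 * H c := by
  have hwb : w ∈ Metric.ball c R := by
    rw [Metric.mem_ball, dist_eq_norm]
    linarith
  have habs : |R| = R := abs_of_pos hR
  have hHc : ContinuousOn H (Metric.sphere c R) :=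
    hH.continuousOn.mono Metric.sphere_subset_closedBall
  have hkernel : ContinuousOn (poissonKernel c w) (Metric.sphere c R) := by
    have hcont := continuousOn_herglotzRieszKernel_sphere hwb
    rw [habs] at hcont
    rw [poissonKernel_eq_re_herglotzRieszKernel]
    exact Complex.continuous_re.comp_continuousOn hcont
  have hint : CircleIntegrable H c R := hHc.circleIntegrable hR.le
  have hkint : CircleIntegrable (poissonKernel c w • H) c R :=
    (hkernel.smul hHc).circleIntegrable hR.le
  have haverage (a : ℝ) : Real.circleAverage (a • H) c R = a * H c := by
    rw [Real.circleAverage_smul, smul_eq_mul,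
      InnerProductSpace.HarmonicOnNhd.circleAverage_eq (by rwa [habs])]
  have hlower := Real.circleAverage_mono (hint.const_smul (a := (1 / 3 : ℝ))) hkint
    fun x hx => mul_le_mul_of_nonneg_right (poissonKernel_mem_Icc hR (habs ▸ hx) hw).1
      (hpos x (habs ▸ hx))
  have hupper := Real.circleAverage_mono hkint (hint.const_smul (a := (3 : ℝ)))
    fun x hx => mul_le_mul_of_nonneg_right (poissonKernel_mem_Icc hR (habs ▸ hx) hw).2
      (hpos x (habs ▸ hx))
  rw [haverage, hH.circleAverage_poissonKernel_smul hwb] at hlower hupper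
  exact ⟨by linarith, hupper⟩

lemma exists_harmonicAt_eq_of_mem_span_fourier (c : ℂ) {R : ℝ} (hR : R ≠ 0)
    {P : C(UnitAddCircle, ℂ)} (hP : P ∈ Submodule.span ℂ (range (@fourier 1))) :
    ∃ H : ℂ → ℂ, (∀ z, InnerProductSpace.HarmonicAt H z) ∧
      ∀ t, P t = H (c + R * AddCircle.toCircle t) := by
  induction hP using Submodule.span_induction with
  | mem P hP =>
    obtain ⟨n, rfl⟩ := hP
    have hpow (k : ℕ) (z : ℂ) : AnalyticAt ℂ (fun z : ℂ => ((R : ℂ)⁻¹ * (z - c)) ^ k) z := by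
      fun_prop
    have hfourier (k : ℕ) (t : UnitAddCircle) :
        fourier (k : ℤ) t = ((R : ℂ)⁻¹ * (c + R * AddCircle.toCircle t - c)) ^ k := by
      rw [fourier_apply, AddCircle.toCircle_zsmul, zpow_natCast, Circle.coe_pow,
        add_sub_cancel_left, inv_mul_cancel_left₀ (Complex.ofReal_ne_zero.2 hR)]
    obtain ⟨k, rfl | rfl⟩ := n.eq_nat_or_neg
    · exact ⟨_, fun z => (hpow k z).harmonicAt, hfourier k⟩
    · refine ⟨_, fun z => (hpow k z).harmonicAt_conj, fun t => ?_⟩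
      rw [fourier_neg, hfourier]
      rfl
  | zero => exact ⟨0, fun _ => InnerProductSpace.harmonicAt_const 0, fun _ => rfl⟩
  | add P Q _ _ hP hQ =>
    obtain ⟨H, hH, hPH⟩ := hP
    obtain ⟨J, hJ, hQJ⟩ := hQ
    exact ⟨H + J, fun z => (hH z).add (hJ z), fun t => congrArg₂ (· + ·) (hPH t) (hQJ t)⟩
  | smul a P _ hP =>
    obtain ⟨H, hH, hPH⟩ := hP
    exact ⟨fun z => a * H z, fun z => (hH z).comp_CLM (ContinuousLinearMap.mul ℝ ℂ a),
      fun t => congrArg (a * ·) (hPH t)⟩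

lemma exists_add_mul_toCircle_eq {c x : ℂ} {R : ℝ} (hR : 0 < R) (hx : x ∈ Metric.sphere c R) :
    ∃ t : UnitAddCircle, c + R * AddCircle.toCircle t = x := by
  have hR0 : (R : ℂ) ≠ 0 := Complex.ofReal_ne_zero.2 hR.ne'
  have hunit : (x - c) / R ∈ Submonoid.unitSphere ℂ := by
    rw [mem_sphere_iff_norm] at hx
    simp [Submonoid.unitSphere, hx, abs_of_pos hR, hR.ne']
  obtain ⟨t, ht⟩ := (AddCircle.homeomorphCircle one_ne_zero).surjective ⟨_, hunit⟩
  rw [AddCircle.homeomorphCircle_apply] at ht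
  exact ⟨t, by rw [ht]; field_simp; ring⟩

lemma exists_harmonicAt_near_on_sphere {u : ℂ → ℝ} {c : ℂ} {R : ℝ} (hR : 0 < R)
    (hu : ContinuousOn u (Metric.sphere c R)) {ε : ℝ} (hε : 0 < ε) :
    ∃ H : ℂ → ℝ, (∀ x, InnerProductSpace.HarmonicAt H x) ∧
      ∀ x ∈ Metric.sphere c R, |u x - H x| ≤ ε := by
  have hcircle : Continuous (fun t : UnitAddCircle => c + R * (AddCircle.toCircle t : ℂ)) := by
    have : Continuous (fun t : UnitAddCircle => (AddCircle.toCircle t : ℂ)) :=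
      continuous_subtype_val.comp AddCircle.continuous_toCircle
    fun_prop
  let F : C(UnitAddCircle, ℂ) := ⟨fun t => (u (c + R * AddCircle.toCircle t) : ℂ),
    Complex.continuous_ofReal.comp (hu.comp_continuous hcircle fun t => by
      simp [abs_of_pos hR, Circle.norm_coe])⟩
  have hF : F ∈ (Submodule.span ℂ (range (@fourier 1))).topologicalClosure := by
    rw [span_fourier_closure_eq_top]
    trivial
  obtain ⟨P, hP, hFP⟩ := Metric.mem_closure_iff.1 hF ε hε
  obtain ⟨H, hH, hPH⟩ := exists_harmonicAt_eq_of_mem_span_fourier c hR.ne' hP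
  refine ⟨fun z => (H z).re, fun z => (hH z).comp_CLM Complex.reCLM, fun x hx => ?_⟩
  obtain ⟨t, rfl⟩ := exists_add_mul_toCircle_eq hR hx
  calc |u (c + R * AddCircle.toCircle t) - (H (c + R * AddCircle.toCircle t)).re|
      = |(F t - P t).re| := by rw [hPH]; rfl
    _ ≤ ‖F t - P t‖ := Complex.abs_re_le_norm _
    _ ≤ dist F P := dist_eq_norm (F t) (P t) ▸ ContinuousMap.dist_apply_le_dist t
    _ ≤ ε := hFP.le

lemma harmonic_nonneg_of_sphere {H : ℂ → ℝ} {c : ℂ} {R : ℝ}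
    (hH : InnerProductSpace.HarmonicOnNhd H (Metric.closedBall c R))
    (hpos : ∀ x ∈ Metric.sphere c R, 0 ≤ H x) : ∀ x ∈ Metric.closedBall c R, 0 ≤ H x :=
  le_of_le_on_sphere continuousOn_const hH hpos fun _ _ _ =>
    viscLaplacianNonneg_of_harmonicAt (InnerProductSpace.harmonicAt_const 0)

/-! ### Logarithmic bumps -/

/-- The logarithmic capacity potential of the annulus `σ < |x - q| < R`: it is `1` on the closed
disk of radius `σ` and harmonic outside, vanishes at distance `R` from `q`, and is continued by
negative values beyond. -/
def logBump (q : ℂ) (σ R : ℝ) (x : ℂ) : ℝ :=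
  (Real.log R - Real.log (max ‖x - q‖ σ)) / (Real.log R - Real.log σ)

section LogBump

variable {q x : ℂ} {σ R : ℝ}

lemma log_sub_log_pos (hσ : 0 < σ) (hR : σ < R) : 0 < Real.log R - Real.log σ :=
  sub_pos.2 (Real.log_lt_log hσ hR)

lemma continuous_logBump (hσ : 0 < σ) : Continuous (logBump q σ R) := by
  have hlog : Continuous fun x : ℂ => Real.log (max ‖x - q‖ σ) :=
    Continuous.log (by fun_prop) fun x => (lt_max_of_lt_right hσ).ne'
  unfold logBump
  fun_prop

lemma logBump_of_le (hσ : 0 < σ) (hR : σ < R) (hx : ‖x - q‖ ≤ σ) : logBump q σ R x = 1 := by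
  rw [logBump, max_eq_right hx, div_self (log_sub_log_pos hσ hR).ne']

lemma logBump_le_one (hσ : 0 < σ) (hR : σ < R) : logBump q σ R x ≤ 1 := by
  rw [logBump, div_le_one (log_sub_log_pos hσ hR)]
  gcongr
  exact le_max_right _ _

lemma logBump_pos (hσ : 0 < σ) (hR : σ < R) (hx : ‖x - q‖ < R) : 0 < logBump q σ R x :=
  div_pos (sub_pos.2 (Real.log_lt_log (lt_max_of_lt_right hσ) (max_lt hx hR)))
    (log_sub_log_pos hσ hR)

lemma logBump_nonpos (hσ : 0 < σ) (hR : σ < R) (hx : R ≤ ‖x - q‖) : logBump q σ R x ≤ 0 :=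
  div_nonpos_of_nonpos_of_nonneg
    (sub_nonpos.2 (Real.log_le_log (hσ.trans hR) (hx.trans (le_max_left _ _))))
    (log_sub_log_pos hσ hR).le

lemma logBump_eventuallyEq (hx : σ < ‖x - q‖) : logBump q σ R =ᶠ[𝓝 x] fun y =>
    -(Real.log R - Real.log σ)⁻¹ * Real.log ‖y - q‖ +
      Real.log R * (Real.log R - Real.log σ)⁻¹ := by
  have hcont : ContinuousAt (fun y : ℂ => ‖y - q‖) x := by fun_prop
  filter_upwards [hcont.eventually_const_lt hx] with y hy
  rw [logBump, max_eq_left hy.le]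
  ring

lemma harmonicAt_logBump (hσ : 0 < σ) (hx : σ < ‖x - q‖) :
    InnerProductSpace.HarmonicAt (logBump q σ R) x :=
  (InnerProductSpace.harmonicAt_congr_nhds (logBump_eventuallyEq hx)).2
    (harmonicAt_log_norm_sub (sub_ne_zero.1 (norm_pos_iff.1 (hσ.trans hx))) _ _)

lemma hasFDerivAt_log_norm_sub (hx : x ≠ q) :
    HasFDerivAt (fun y : ℂ => Real.log ‖y - q‖) ((‖x - q‖ ^ 2)⁻¹ • innerSL ℝ (x - q)) x := by
  have hne : ‖x - q‖ ^ 2 ≠ 0 := pow_ne_zero _ (norm_ne_zero_iff.2 (sub_ne_zero.2 hx))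
  have hlog : (fun y : ℂ => Real.log ‖y - q‖) =
      fun y => (1 / 2 : ℝ) • Real.log (‖y - q‖ ^ 2) := by
    ext y
    rw [Real.log_pow, Nat.cast_ofNat, smul_eq_mul, one_div, inv_mul_cancel_left₀ two_ne_zero]
  rw [hlog]
  refine (((hasFDerivAt_norm_sub_sq q x).log hne).const_smul (1 / 2 : ℝ)).congr_fderiv ?_
  ext e
  simp
  ring

lemma hasFDerivAt_logBump (hσ : 0 < σ) (hx : σ < ‖x - q‖) :
    HasFDerivAt (logBump q σ R) (-(Real.log R - Real.log σ)⁻¹ •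
      ((‖x - q‖ ^ 2)⁻¹ • innerSL ℝ (x - q))) x :=
  (((hasFDerivAt_log_norm_sub (sub_ne_zero.1 (norm_pos_iff.1 (hσ.trans hx)))).const_smul
    _).add_const _).congr_of_eventuallyEq (logBump_eventuallyEq hx)

end LogBump

lemma mem_closure_posSet_congr {D : Set ℂ} {u w : ℂ → ℝ} {x : ℂ} (h : w =ᶠ[𝓝 x] u)
    (hx : x ∈ closure (posSet D w)) : x ∈ closure (posSet D u) := by
  rw [mem_closure_iff_frequently] at hx ⊢
  exact (hx.and_eventually h).mono fun y ⟨⟨hyD, hy⟩, heq⟩ => ⟨hyD, heq ▸ hy⟩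

lemma notMem_frontier_posSet {D : Set ℂ} {w : ℂ → ℝ} {x : ℂ} (hxD : x ∉ closure D)
    (hw : ContinuousAt w x) (hpos : 0 < w x) : x ∉ frontier (posSet D w) := by
  refine fun h => h.2 (mem_interior_iff_mem_nhds.2 ?_)
  filter_upwards [isClosed_closure.isOpen_compl.mem_nhds hxD, hw.eventually_const_lt hpos]
    with y hyD hy
  exact ⟨fun h => hyD (subset_closure h), hy⟩

open Classical in
/-- The function `u` raised to `max u q` on `K`; the competitors are of this form. -/
def raiseOn (K : Set ℂ) (q u : ℂ → ℝ) (x : ℂ) : ℝ := if x ∈ K then max (u x) (q x) else u x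

section RaiseOn

variable {K S : Set ℂ} {q u : ℂ → ℝ} {x : ℂ}

lemma raiseOn_of_mem (hx : x ∈ K) : raiseOn K q u x = max (u x) (q x) := if_pos hx

lemma raiseOn_of_notMem (hx : x ∉ K) : raiseOn K q u x = u x := if_neg hx

lemma le_raiseOn (x : ℂ) : u x ≤ raiseOn K q u x := by
  by_cases hx : x ∈ K
  · exact (le_max_left _ _).trans_eq (raiseOn_of_mem hx).symm
  · exact (raiseOn_of_notMem hx).ge

lemma le_raiseOn_of_mem (hx : x ∈ K) : q x ≤ raiseOn K q u x :=
  (le_max_right _ _).trans_eq (raiseOn_of_mem hx).symm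

lemma continuousOn_raiseOn (hu : ContinuousOn u S) (hK : IsClosed K) (hq : ContinuousOn q K)
    (hle : ∀ x ∈ frontier K, q x ≤ u x) : ContinuousOn (raiseOn K q u) S := by
  classical
  refine ContinuousOn.piecewise (t := K) (f := fun x => max (u x) (q x))
    (fun x hx => max_eq_left (hle x hx.2)) ?_ (hu.mono inter_subset_left)
  rw [hK.closure_eq]
  exact (hu.mono inter_subset_left).sup (hq.mono inter_subset_right)

lemma raiseOn_eq_of_lt (hx : u x < raiseOn K q u x) : raiseOn K q u x = q x := by
  have hxK : x ∈ K := by_contra fun hxK => hx.ne (raiseOn_of_notMem hxK).symm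
  rw [raiseOn_of_mem hxK] at hx ⊢
  exact max_eq_right ((lt_max_iff.1 hx).resolve_left (lt_irrefl _)).le

lemma mem_interior_of_lt_raiseOn (hle : ∀ x ∈ frontier K, q x ≤ u x)
    (hx : u x < raiseOn K q u x) : x ∈ interior K := by
  by_contra hxint
  have hxK : x ∈ K := by_contra fun hxK => hx.ne (raiseOn_of_notMem hxK).symm
  exact (hle x ⟨subset_closure hxK, hxint⟩).not_gt (raiseOn_eq_of_lt hx ▸ hx)

lemma mem_of_mem_closure_posSet_raiseOn {D : Set ℂ} (hK : IsClosed K)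
    (hx : x ∈ closure (posSet D (raiseOn K q u))) (hxu : x ∉ closure (posSet D u)) : x ∈ K := by
  refine by_contra fun hxK => hxu (mem_closure_posSet_congr ?_ hx)
  filter_upwards [hK.isOpen_compl.mem_nhds hxK] with y hy using raiseOn_of_notMem hy

lemma mem_frontier_of_mem_frontier_posSet_raiseOn {D : Set ℂ} (hK : IsClosed K)
    (hxD : x ∉ closure D) (hw : ContinuousAt (raiseOn K q u) x) (hq : ∀ y ∈ interior K, 0 < q y)
    (hx : x ∈ frontier (posSet D (raiseOn K q u))) (hxu : x ∉ closure (posSet D u)) :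
    x ∈ frontier K :=
  ⟨subset_closure (mem_of_mem_closure_posSet_raiseOn hK hx.1 hxu), fun hxint =>
    notMem_frontier_posSet hxD hw
      ((hq x hxint).trans_le (le_raiseOn_of_mem (interior_subset hxint))) hx⟩

lemma eq_zero_of_mem_frontier_posSet_raiseOn {D : Set ℂ} (hxD : x ∉ closure D)
    (hw : ContinuousAt (raiseOn K q u) x) (hu : ∀ y ∉ D, 0 ≤ u y) (hq : ContinuousAt q x)
    (hxK : x ∈ K) (hx : x ∈ frontier (posSet D (raiseOn K q u)))
    (hxu : x ∉ closure (posSet D u)) : q x = 0 := by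
  refine le_antisymm ?_ ?_ <;> by_contra! hqx
  · exact notMem_frontier_posSet hxD hw (hqx.trans_le (le_raiseOn_of_mem hxK)) hx
  · refine hxu (mem_closure_posSet_congr ?_ hx.1)
    filter_upwards [hq.eventually_lt_const hqx, isClosed_closure.isOpen_compl.mem_nhds hxD]
      with y hqy hyD
    by_cases hy : y ∈ K
    · rw [raiseOn_of_mem hy, max_eq_left (hqy.le.trans (hu y fun h => hyD (subset_closure h)))]
    · exact raiseOn_of_notMem hy

end RaiseOn

/-! ### Harmonic approximation -/

lemma BelowPlane.slope_logBump_le {w : ℂ → ℝ} {q x ν : ℂ} {σ R m α : ℝ}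
    (hB : BelowPlane w x ν α) (hν : ‖ν‖ = 1) (hσ : 0 < σ) (hR : σ < R) (hm : 0 < m)
    (hx : ‖x - q‖ = R) (hle : ∀ᶠ y in 𝓝 x, m * logBump q σ R y ≤ w y) :
    m / (R * (Real.log R - Real.log σ)) ≤ α := by
  have hR0 : 0 < R := hσ.trans hR
  have hlog := log_sub_log_pos hσ hR
  set e : ℂ := -(R⁻¹ • (x - q)) with he
  have hnorm : ‖e‖ = 1 := by
    rw [he, norm_neg, norm_smul, hx, norm_inv, Real.norm_of_nonneg hR0.le,
      inv_mul_cancel₀ hR0.ne']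
  have hinner : innerSL ℝ (x - q) e = -R := by
    rw [innerSL_apply_apply, he, inner_neg_right, inner_smul_right, real_inner_self_eq_norm_sq, hx]
    field_simp
  have hderiv := (hasFDerivAt_logBump (R := R) hσ (hR.trans_eq hx.symm)).const_smul m
  have hslope : (m • -(Real.log R - Real.log σ)⁻¹ • (‖x - q‖ ^ 2)⁻¹ • innerSL ℝ (x - q)) e =
      m / (R * (Real.log R - Real.log σ)) := by
    simp only [smul_apply, smul_eq_mul, hinner, hx]
    field_simp
  rw [← hslope]
  refine hB.apply_le_slope hν hnorm hderiv ?_ hle (hslope ▸ by positivity)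
  simp only [Pi.smul_apply, smul_eq_mul, logBump, hx, max_eq_left hR.le, sub_self, zero_div,
    mul_zero]

section HarmonicApproximation

variable {D G : Set ℂ} {g f u H : ℂ → ℝ} {x₁ : ℂ} {r S : ℝ}

lemma viscLaplacianNonneg_max_logBump (hr : 0 < r) {x : ℂ} (hS : 0 < S)
    (hH : InnerProductSpace.HarmonicAt H x) (hHinner : ‖x - x₁‖ ≤ r / 2 → S * r ≤ H x) :
    ViscLaplacianNonneg (fun y => max (H y) (S * r * logBump x₁ (r / 2) r y)) x := by
  have hr2 : 0 < r / 2 := half_pos hr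
  rcases le_or_gt (S * r * logBump x₁ (r / 2) r x) (H x) with hle | hlt
  · exact (viscLaplacianNonneg_of_harmonicAt hH).of_touching (max_eq_left hle).symm
      (Eventually.of_forall fun _ => le_max_left _ _)
  · have hxr : r / 2 < ‖x - x₁‖ := by
      by_contra! hxr
      refine (hHinner hxr).not_gt ?_
      simpa only [logBump_of_le hr2 (half_lt_self hr) hxr, mul_one] using hlt
    exact ((viscLaplacianNonneg_of_harmonicAt (harmonicAt_logBump hr2 hxr)).const_mul
      (mul_pos hS hr)).of_touching (max_eq_right hlt.le).symm
      (Eventually.of_forall fun _ => le_max_right _ _)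

lemma BelowPlane.le_of_logBump_half_le {w : ℂ → ℝ} {x ν : ℂ} {α : ℝ}
    (hB : BelowPlane w x ν α) (hν : ‖ν‖ = 1) (hr : 0 < r) (hS : 0 < S) (hx : ‖x - x₁‖ = r)
    (hle : ∀ᶠ y in 𝓝 x, S * r * logBump x₁ (r / 2) r y ≤ w y) : S ≤ α := by
  have hr2 : 0 < r / 2 := half_pos hr
  have hr2r : r / 2 < r := half_lt_self hr
  refine le_trans ?_ (hB.slope_logBump_le hν hr2 hr2r (mul_pos hS hr) hx hle)
  -- `log r - log (r / 2) = log 2 ≤ 1`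
  have hlog : Real.log r - Real.log (r / 2) ≤ 1 := by
    rw [← Real.log_div hr.ne' hr2.ne', div_div_cancel₀ hr.ne']
    exact Real.log_two_lt_d9.le.trans (by norm_num)
  rw [le_div_iff₀ (mul_pos hr (log_sub_log_pos hr2 hr2r))]
  exact mul_le_mul_of_nonneg_left (mul_le_of_le_one_right hr.le hlog) hS.le

lemma IsSubsolution.isCompetitor_raiseOn_closedBall (hs : IsSubsolution D g f u) (hr : 0 < r)
    (hS : 0 < S) (hf : ∀ x ∈ Metric.sphere x₁ r, √(f x) ≤ S) (hG : Metric.ball x₁ r ⊆ G)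
    (hD : Disjoint (Metric.closedBall x₁ r) (closure D))
    (hH : InnerProductSpace.HarmonicOnNhd H (Metric.closedBall x₁ r))
    (hHu : ∀ x ∈ Metric.sphere x₁ r, H x ≤ u x)
    (hHinner : ∀ x, ‖x - x₁‖ ≤ r / 2 → S * r ≤ H x) :
    IsCompetitor D f u G (Metric.closedBall x₁ r) (raiseOn (Metric.closedBall x₁ r)
      (fun x => max (H x) (S * r * logBump x₁ (r / 2) r x)) u) := by
  set K := Metric.closedBall x₁ r
  set B : ℂ → ℝ := fun x => S * r * logBump x₁ (r / 2) r x
  set q : ℂ → ℝ := fun x => max (H x) (B x)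
  have hr2 : 0 < r / 2 := half_pos hr
  have hr2r : r / 2 < r := half_lt_self hr
  have hintK : interior K = Metric.ball x₁ r := interior_closedBall x₁ hr.ne'
  have hfrK : frontier K = Metric.sphere x₁ r := frontier_closedBall x₁ hr.ne'
  have hBout : ∀ x ∉ closure D, x ∉ interior K → B x ≤ u x := fun x hxD hx => by
    rw [hintK, mem_ball_iff_norm, not_lt] at hx
    exact (mul_nonpos_of_nonneg_of_nonpos (mul_pos hS hr).le (logBump_nonpos hr2 hr2r hx)).trans
      (hs.nonneg x fun h => hxD (subset_closure h))
  have hqfr : ∀ x ∈ frontier K, q x ≤ u x := fun x hx =>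
    max_le (hHu x (hfrK ▸ hx)) (hBout x (hD.notMem_of_mem_left
      (Metric.isClosed_closedBall.frontier_subset hx)) hx.2)
  have hqw : ∀ {x}, x ∈ K → q x ≤ raiseOn K q u x := le_raiseOn_of_mem
  have hcont : ContinuousOn (raiseOn K q u) Dᶜ :=
    continuousOn_raiseOn hs.continuousOn Metric.isClosed_closedBall
      (hH.continuousOn.sup (continuous_const.mul (continuous_logBump hr2)).continuousOn) hqfr
  refine ⟨isCompact_closedBall _ _, hD, fun _ => raiseOn_of_notMem, hcont, le_raiseOn,
    fun x hx => hG (hintK ▸ mem_interior_of_lt_raiseOn hqfr hx), fun x hx => ?_,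
    fun x hx hxD hxu ν α hν hB => ?_⟩
  · have hxK : K ∈ 𝓝 x := mem_interior_iff_mem_nhds.1 (mem_interior_of_lt_raiseOn hqfr hx)
    exact (viscLaplacianNonneg_max_logBump hr hS (hH x (mem_of_mem_nhds hxK))
      (hHinner x)).of_touching (raiseOn_eq_of_lt hx).symm
      (mem_of_superset hxK fun _ => hqw)
  · have hxfr : x ∈ frontier K := by
      refine mem_frontier_of_mem_frontier_posSet_raiseOn Metric.isClosed_closedBall hxD
        (continuousAt_of_notMem_closure hcont hxD) (fun y hy => ?_) hx hxu
      rw [hintK, mem_ball_iff_norm] at hy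
      exact (mul_pos (mul_pos hS hr) (logBump_pos hr2 hr2r hy)).trans_le (le_max_right _ _)
    rw [hfrK] at hxfr
    refine (hf x hxfr).trans (hB.le_of_logBump_half_le hν hr hS (mem_sphere_iff_norm.1 hxfr) ?_)
    filter_upwards [isClosed_closure.isOpen_compl.mem_nhds hxD] with y hyD
    by_cases hy : y ∈ K
    · exact (le_max_right _ _).trans (hqw hy)
    · exact (hBout y hyD fun h => hy (interior_subset h)).trans (le_raiseOn y)

lemma exists_harmonicAt_near_on_closedBall (hs : IsSubsolution D g f u)
    (hmax : MaximalOn D f u G) (hr : 0 < r) (hS : 0 < S)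
    (hf : ∀ x ∈ Metric.sphere x₁ r, √(f x) ≤ S) (hG : Metric.ball x₁ r ⊆ G)
    (hD : Disjoint (Metric.closedBall x₁ r) (closure D)) (hux : 6 * S * r ≤ u x₁)
    {ε : ℝ} (hε : 0 < ε) :
    ∃ H : ℂ → ℝ, (∀ x, InnerProductSpace.HarmonicAt H x) ∧
      ∀ x ∈ Metric.closedBall x₁ r, |u x - H x| ≤ ε := by
  have hKD : ∀ x ∈ Metric.closedBall x₁ r, x ∉ D := fun x hx h =>
    hD.notMem_of_mem_left hx (subset_closure h)
  have hucont : ContinuousOn u (Metric.closedBall x₁ r) := hs.continuousOn.mono hKD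
  obtain ⟨δ, hδ, hδε, hδS⟩ : ∃ δ > 0, 2 * δ ≤ ε ∧ 2 * δ ≤ S * r :=
    ⟨min ε (S * r) / 2, by positivity, by linarith [min_le_left ε (S * r)],
      by linarith [min_le_right ε (S * r)]⟩
  obtain ⟨H₀, hH₀, hH₀u⟩ := exists_harmonicAt_near_on_sphere hr
    (hucont.mono Metric.sphere_subset_closedBall) hδ
  have hlower : ∀ x, InnerProductSpace.HarmonicAt (fun x => H₀ x - δ) x := fun x =>
    (hH₀ x).sub (InnerProductSpace.harmonicAt_const δ)
  have hupper : InnerProductSpace.HarmonicOnNhd (fun x => H₀ x + δ) (Metric.closedBall x₁ r) :=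
    fun x _ => (hH₀ x).add (InnerProductSpace.harmonicAt_const δ)
  have hupper_sphere : ∀ x ∈ Metric.sphere x₁ r, u x ≤ H₀ x + δ := fun x hx => by
    linarith [(abs_le.1 (hH₀u x hx)).2]
  have hlower_sphere : ∀ x ∈ Metric.sphere x₁ r, H₀ x - δ ≤ u x := fun x hx => by
    linarith [(abs_le.1 (hH₀u x hx)).1]
  have hnonneg : ∀ x ∈ Metric.closedBall x₁ r, 0 ≤ H₀ x + δ :=
    harmonic_nonneg_of_sphere hupper fun x hx =>
      (hs.nonneg x (hKD x (Metric.sphere_subset_closedBall hx))).trans (hupper_sphere x hx)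
  have hu_le : ∀ x ∈ Metric.closedBall x₁ r, u x ≤ H₀ x + δ :=
    le_of_le_on_sphere hucont hupper hupper_sphere fun x hx hlt =>
      have hx' := Metric.ball_subset_closedBall hx
      hs.subharmonic x ⟨hKD x hx', (hnonneg x hx').trans_lt hlt⟩ (hD.notMem_of_mem_left hx')
  have hinner : ∀ x, ‖x - x₁‖ ≤ r / 2 → S * r ≤ H₀ x - δ := fun x hx => by
    linarith [(harnack hr hupper (fun x hx => hnonneg x (Metric.sphere_subset_closedBall hx)) hx).1,
      hu_le x₁ (Metric.mem_closedBall_self hr.le)]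
  have hle_u : ∀ x ∈ Metric.closedBall x₁ r, H₀ x - δ ≤ u x := fun x hx =>
    (le_max_left _ _).trans ((le_raiseOn_of_mem hx).trans (hmax _ _
      (hs.isCompetitor_raiseOn_closedBall hr hS hf hG hD (fun x _ => hlower x) hlower_sphere
        hinner) x))
  exact ⟨H₀, hH₀, fun x hx => abs_le.2 ⟨by linarith [hle_u x hx], by linarith [hu_le x hx]⟩⟩

end HarmonicApproximation

/-! ### Subharmonic functions positive on a connected open set -/

section Suprema

variable {X : Type*} [TopologicalSpace X]

lemma exists_forall_le_of_tendsto_zero {a : ℕ → ℝ} (ha : Tendsto a atTop (𝓝 0)) {j₀ : ℕ}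
    (hj₀ : 0 < a j₀) : ∃ j, ∀ n, a n ≤ a j := by
  obtain ⟨N, hN⟩ := eventually_atTop.1 (ha.eventually_lt_const hj₀)
  obtain ⟨j, -, hmax⟩ := Finset.exists_max_image (Finset.range (N + j₀ + 1)) a
    ⟨j₀, Finset.mem_range.2 (by omega)⟩
  refine ⟨j, fun n => ?_⟩
  by_cases hn : n < N + j₀ + 1
  · exact hmax n (Finset.mem_range.2 hn)
  · exact (hN n (by omega)).le.trans (hmax j₀ (Finset.mem_range.2 (by omega)))

lemma continuous_iSup_of_tendsto_zero {a : ℕ → X → ℝ} {b : ℕ → ℝ} (ha : ∀ j, Continuous (a j))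
    (ha0 : ∀ j x, 0 ≤ a j x) (hab : ∀ j x, a j x ≤ b j) (hb : Tendsto b atTop (𝓝 0)) :
    Continuous fun x => ⨆ j, a j x := by
  have hbdd : ∀ x, BddAbove (range fun j => a j x) := fun x =>
    hb.bddAbove_range.range_mono _ fun j => hab j x
  set F : ℕ → X → ℝ := fun n x => (Finset.range (n + 1)).sup' Finset.nonempty_range_add_one
    fun j => a j x
  have hFcont : ∀ n, Continuous (F n) := fun n => Continuous.finset_sup'_apply _ fun j _ => ha j
  refine TendstoUniformly.continuous (F := F) (p := atTop) ?_ (Frequently.of_forall hFcont)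
  rw [Metric.tendstoUniformly_iff]
  intro ε hε
  obtain ⟨N, hN⟩ := eventually_atTop.1 (hb.eventually_lt_const (half_pos hε))
  filter_upwards [eventually_ge_atTop N] with n hn x
  have hFle : F n x ≤ ⨆ j, a j x := Finset.sup'_le _ _ fun j _ => le_ciSup (hbdd x) j
  have hleF : ∀ j < n + 1, a j x ≤ F n x := fun j hj =>
    Finset.le_sup' (fun j => a j x) (Finset.mem_range.2 hj)
  have hsup : ⨆ j, a j x ≤ F n x + ε / 2 := by
    refine ciSup_le fun j => ?_
    by_cases hj : j < n + 1
    · linarith [hleF j hj]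
    · linarith [hab j x, hN j (by omega), ha0 0 x, hleF 0 n.succ_pos]
  rw [Real.dist_eq, abs_of_nonneg (sub_nonneg.2 hFle)]
  linarith

end Suprema

/-- A partial bump is a continuous function with values in `[0, 1]` which vanishes outside `E` and
is subharmonic where it is positive, except on the closed disk of radius `σ` about `q`. A small
multiple of it can be added to a subsolution without losing subharmonicity away from that disk. -/
structure IsPartialBump (E : Set ℂ) (q : ℂ) (σ : ℝ) (ψ : ℂ → ℝ) : Prop where
  continuous : Continuous ψ
  nonneg : ∀ x, 0 ≤ ψ x
  eq_zero : ∀ x ∉ E, ψ x = 0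
  le_one : ∀ x, ψ x ≤ 1
  visc : ∀ x, 0 < ψ x → σ < ‖x - q‖ → ViscLaplacianNonneg ψ x

section PartialBump

variable {E : Set ℂ} {q : ℂ} {σ R : ℝ}

lemma isPartialBump_logBump (hσ : 0 < σ) (hR : σ < R) (hE : Metric.ball q R ⊆ E) :
    IsPartialBump E q σ fun x => max 0 (logBump q σ R x) where
  continuous := continuous_const.max (continuous_logBump hσ)
  nonneg _ := le_max_left _ _
  eq_zero x hx := max_eq_left (logBump_nonpos hσ hR (by
    by_contra! h
    exact hx (hE (mem_ball_iff_norm.2 h))))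
  le_one _ := max_le zero_le_one (logBump_le_one hσ hR)
  visc x hx hxq :=
    (viscLaplacianNonneg_of_harmonicAt (harmonicAt_logBump hσ hxq)).of_touching
      (max_eq_right ((lt_max_iff.1 hx).resolve_left (lt_irrefl _)).le).symm
      (Eventually.of_forall fun _ => le_max_right _ _)

namespace IsPartialBump

lemma max_const_mul {ψ b : ℂ → ℝ} {p : ℂ} {τ m : ℝ} (hψ : IsPartialBump E q σ ψ)
    (hb : IsPartialBump E p τ b) (hm : 0 < m) (hm1 : m ≤ 1) (hmψ : ∀ x, ‖x - p‖ ≤ τ → m ≤ ψ x) :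
    IsPartialBump E q σ fun x => max (ψ x) (m * b x) where
  continuous := hψ.continuous.max (continuous_const.mul hb.continuous)
  nonneg x := (hψ.nonneg x).trans (le_max_left _ _)
  eq_zero x hx := by rw [hψ.eq_zero x hx, hb.eq_zero x hx, mul_zero, max_self]
  le_one x := max_le (hψ.le_one x) (mul_le_one₀ hm1 (hb.nonneg x) (hb.le_one x))
  visc x hx hxq := by
    rcases le_or_gt (m * b x) (ψ x) with hle | hlt
    · exact (hψ.visc x (max_eq_left hle ▸ hx) hxq).of_touching (max_eq_left hle).symm
        (Eventually.of_forall fun _ => le_max_left _ _)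
    · have hxp : τ < ‖x - p‖ := by
        by_contra! hxp
        exact ((mul_le_of_le_one_right hm.le (hb.le_one x)).trans (hmψ x hxp)).not_gt hlt
      have hbx : 0 < b x := pos_of_mul_pos_right ((hψ.nonneg x).trans_lt hlt) hm.le
      exact ((hb.visc x hbx hxp).const_mul hm).of_touching (max_eq_right hlt.le).symm
        (Eventually.of_forall fun _ => le_max_right _ _)

lemma exists_pos_on_ball {ψ : ℂ → ℝ} {p : ℂ} {ρ : ℝ} (hψ : IsPartialBump E q σ ψ)
    (hp : 0 < ψ p) (hρ : 0 < ρ) (hE : Metric.ball p ρ ⊆ E) :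
    ∃ φ : ℂ → ℝ, IsPartialBump E q σ φ ∧ ∀ x ∈ Metric.ball p ρ, 0 < φ x := by
  obtain ⟨τ₀, hτ₀, hψτ₀⟩ := Metric.nhds_basis_closedBall.mem_iff.1
    (hψ.continuous.continuousAt.eventually_const_lt (half_lt_self hp))
  obtain ⟨τ, hτ, hττ₀, hτρ⟩ : ∃ τ > 0, τ ≤ τ₀ ∧ τ < ρ :=
    ⟨min τ₀ (ρ / 2), by positivity, min_le_left _ _,
      (min_le_right _ _).trans_lt (half_lt_self hρ)⟩
  refine ⟨_, hψ.max_const_mul (isPartialBump_logBump hτ hτρ hE) (half_pos hp)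
    ((half_le_self hp.le).trans (hψ.le_one p))
    fun x hx => (hψτ₀ (mem_closedBall_iff_norm.2 (hx.trans hττ₀))).le, fun x hx => ?_⟩
  exact lt_max_of_lt_right (mul_pos (half_pos hp)
    (lt_max_of_lt_right (logBump_pos hτ hτρ (mem_ball_iff_norm.1 hx))))

lemma iSup_geometric {Ψ : ℕ → ℂ → ℝ} (hΨ : ∀ j, IsPartialBump E q σ (Ψ j)) :
    IsPartialBump E q σ (fun x => ⨆ j, (1 / 2 : ℝ) ^ j * Ψ j x) ∧
      ∀ j x, (1 / 2 : ℝ) ^ j * Ψ j x ≤ ⨆ i, (1 / 2 : ℝ) ^ i * Ψ i x := by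
  set a : ℕ → ℂ → ℝ := fun j x => (1 / 2 : ℝ) ^ j * Ψ j x
  have hgeom : Tendsto (fun j : ℕ => (1 / 2 : ℝ) ^ j) atTop (𝓝 0) :=
    tendsto_pow_atTop_nhds_zero_of_lt_one (by norm_num) (by norm_num)
  have ha0 : ∀ j x, 0 ≤ a j x := fun j x => mul_nonneg (by positivity) ((hΨ j).nonneg x)
  have ha : ∀ j x, a j x ≤ (1 / 2) ^ j := fun j x =>
    mul_le_of_le_one_right (by positivity) ((hΨ j).le_one x)
  have ha1 : ∀ j x, a j x ≤ 1 := fun j x =>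
    (ha j x).trans (pow_le_one₀ (by norm_num) (by norm_num))
  have hle : ∀ j x, a j x ≤ ⨆ i, a i x := fun j x =>
    le_ciSup (f := fun i => a i x) ⟨1, forall_mem_range.2 fun i => ha1 i x⟩ j
  refine ⟨⟨continuous_iSup_of_tendsto_zero (fun j => continuous_const.mul (hΨ j).continuous)
    ha0 ha hgeom, fun x => (ha0 0 x).trans (hle 0 x), fun x hx => ?_,
    fun x => ciSup_le fun j => ha1 j x, fun x hx hxq => ?_⟩, hle⟩
  · simp only [(hΨ _).eq_zero x hx, mul_zero, ciSup_const]
  · obtain ⟨j₀, hj₀⟩ := exists_lt_of_lt_ciSup hx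
    obtain ⟨j, hj⟩ := exists_forall_le_of_tendsto_zero
      (squeeze_zero (fun j => ha0 j x) (fun j => ha j x) hgeom) hj₀
    have hpos : 0 < Ψ j x := pos_of_mul_pos_right (hj₀.trans_le (hj j₀)) (by positivity)
    exact (((hΨ j).visc x hpos hxq).const_mul (by positivity)).of_touching
      ((hle j x).antisymm (ciSup_le hj)) (Eventually.of_forall fun y => hle j y)

end IsPartialBump

lemma exists_isPartialBump_pos (hE : IsOpen E) (hEc : IsPreconnected E) (hσ : 0 < σ) (hR : σ < R)
    (hq : Metric.ball q R ⊆ E) {x : ℂ} (hx : x ∈ E) : ∃ ψ, IsPartialBump E q σ ψ ∧ 0 < ψ x := by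
  have hqR : q ∈ Metric.ball q R := Metric.mem_ball_self (hσ.trans hR)
  suffices h : E ⊆ {x | ∃ ψ, IsPartialBump E q σ ψ ∧ 0 < ψ x} from h hx
  refine hEc.subset_of_closure_inter_subset ?_ ⟨q, hq hqR, ?_⟩ ?_
  · rw [isOpen_iff_mem_nhds]
    rintro y ⟨ψ, hψ, hy⟩
    filter_upwards [hψ.continuous.continuousAt.eventually_const_lt hy] with z hz
    exact ⟨ψ, hψ, hz⟩
  · exact ⟨_, isPartialBump_logBump hσ hR hq,
      lt_max_of_lt_right (logBump_pos hσ hR (mem_ball_iff_norm.1 hqR))⟩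
  · rintro y ⟨hyA, hyE⟩
    obtain ⟨ε, hε, hball⟩ := Metric.isOpen_iff.1 hE y hyE
    obtain ⟨p, ⟨ψ, hψ, hp⟩, hdist⟩ := Metric.mem_closure_iff.1 hyA (ε / 2) (half_pos hε)
    obtain ⟨φ, hφ, hpos⟩ := hψ.exists_pos_on_ball hp (half_pos hε)
      ((Metric.ball_subset_ball' (by rw [dist_comm p y]; linarith)).trans hball)
    exact ⟨φ, hφ, hpos y hdist⟩

lemma exists_isPartialBump_forall_pos (hE : IsOpen E) (hEc : IsPreconnected E) (hσ : 0 < σ)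
    (hR : σ < R) (hq : Metric.ball q R ⊆ E) : ∃ ψ, IsPartialBump E q σ ψ ∧ ∀ x ∈ E, 0 < ψ x := by
  have hqE : q ∈ E := hq (Metric.mem_ball_self (hσ.trans hR))
  have hexists : ∀ x, ∃ ψ, IsPartialBump E q σ ψ ∧ (x ∈ E → 0 < ψ x) := fun x => by
    by_cases hx : x ∈ E
    · obtain ⟨ψ, hψ, hpos⟩ := exists_isPartialBump_pos hE hEc hσ hR hq hx
      exact ⟨ψ, hψ, fun _ => hpos⟩
    · exact ⟨_, isPartialBump_logBump hσ hR hq, fun h => absurd h hx⟩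
  choose Ψ hΨ hΨpos using hexists
  obtain ⟨t, ht, -, hcov⟩ := (HereditarilyLindelofSpace.isLindelof E).elim_nhds_subcover
    (fun x => {y | 0 < Ψ x y})
    (fun x hx => (hΨ x).continuous.continuousAt.eventually_const_lt (hΨpos x hx))
  obtain ⟨x₀, hx₀, -⟩ := mem_iUnion₂.1 (hcov hqE)
  obtain ⟨e, rfl⟩ := ht.exists_eq_range ⟨x₀, hx₀⟩
  obtain ⟨hsup, hle⟩ := IsPartialBump.iSup_geometric fun j => hΨ (e j)
  refine ⟨_, hsup, fun x hx => ?_⟩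
  obtain ⟨_, ⟨j, rfl⟩, hj⟩ := mem_iUnion₂.1 (hcov hx)
  exact (mul_pos (by positivity) hj).trans_le (hle j x)

end PartialBump

/-! ### Similarity frames and flatness -/

/-- The coordinate of `x` with respect to the similarity that maps `0` to `p` and `1` to `p + k`
(all coordinates are `0` when `k = 0`). -/
def frameCoord (p k x : ℂ) : ℂ := (x - p) / k

lemma frameCoord_add_mul {k : ℂ} (hk : k ≠ 0) (p ζ : ℂ) : frameCoord p k (p + ζ * k) = ζ := by
  rw [frameCoord, add_sub_cancel_left, mul_div_cancel_right₀ ζ hk]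

lemma add_frameCoord_mul {k : ℂ} (hk : k ≠ 0) (p x : ℂ) : p + frameCoord p k x * k = x := by
  rw [frameCoord, div_mul_cancel₀ _ hk, add_sub_cancel]

lemma norm_frameCoord_sub_mul {k : ℂ} (hk : k ≠ 0) (p x y : ℂ) :
    ‖frameCoord p k x - frameCoord p k y‖ * ‖k‖ = ‖x - y‖ := by
  rw [← norm_mul, frameCoord, frameCoord, ← sub_div, div_mul_cancel₀ _ hk, sub_sub_sub_cancel_right]

lemma norm_frameCoord_sub_le_iff {k : ℂ} (hk : k ≠ 0) {p x y : ℂ} {R : ℝ} :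
    ‖frameCoord p k x - frameCoord p k y‖ ≤ R ↔ ‖x - y‖ ≤ R * ‖k‖ := by
  rw [← norm_frameCoord_sub_mul hk p x y, mul_le_mul_iff_left₀ (norm_pos_iff.2 hk)]

lemma mem_closedBall_iff_norm_frameCoord_le {k : ℂ} (hk : k ≠ 0) {p x : ℂ} {R : ℝ} :
    x ∈ Metric.closedBall p (R * ‖k‖) ↔ ‖frameCoord p k x‖ ≤ R := by
  rw [mem_closedBall_iff_norm, frameCoord, norm_div, div_le_iff₀ (norm_pos_iff.2 hk)]

@[fun_prop]
lemma continuous_frameCoord (p k : ℂ) : Continuous (frameCoord p k) := by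
  unfold frameCoord
  fun_prop

lemma harmonicAt_re_comp_frameCoord {F : ℂ → ℂ} {p k x : ℂ}
    (hF : AnalyticAt ℂ F (frameCoord p k x)) :
    InnerProductSpace.HarmonicAt (fun y => (F (frameCoord p k y)).re) x := by
  have hcoord : AnalyticAt ℂ (frameCoord p k) x := by
    unfold frameCoord
    simp only [div_eq_mul_inv]
    fun_prop
  exact (hF.comp hcoord).harmonicAt_re

lemma harmonicAt_mul_re_frameCoord_add (A B : ℝ) (p k x : ℂ) :
    InnerProductSpace.HarmonicAt (fun y => A * ((frameCoord p k y).re + B)) x := by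
  have h := harmonicAt_re_comp_frameCoord (p := p) (k := k) (x := x)
    (F := fun ζ => (A : ℂ) * (ζ + (B : ℂ))) (by fun_prop)
  simpa only [Complex.re_ofReal_mul, Complex.add_re, Complex.ofReal_re] using h

lemma sub_le_three_mul {D G : Set ℂ} {g f u L : ℂ → ℝ} (hs : IsSubsolution D g f u)
    (hmax : MaximalOn D f u G) {S r : ℝ} (hS : 0 < S) (hr : 0 < r) {x y : ℂ}
    (hf : ∀ z ∈ Metric.sphere x r, √(f z) ≤ S) (hG : Metric.ball x r ⊆ G)
    (hD : Disjoint (Metric.closedBall x r) (closure D)) (hux : 6 * S * r ≤ u x)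
    (hL : ∀ z, InnerProductSpace.HarmonicAt L z) (huL : ∀ z ∈ Metric.closedBall x r, u z ≤ L z)
    (hy : ‖y - x‖ ≤ r / 2) : L y - u y ≤ 3 * (L x - u x) := by
  refine le_of_forall_pos_le_add fun ε hε => ?_
  obtain ⟨H, hH, hHu⟩ := exists_harmonicAt_near_on_closedBall hs hmax hr hS hf hG hD hux
    (show 0 < ε / 6 by positivity)
  have hJ (z : ℂ) : InnerProductSpace.HarmonicAt (fun z => L z - H z + ε / 6) z :=
    ((hL z).sub (hH z)).add (InnerProductSpace.harmonicAt_const (ε / 6))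
  have hJ_nonneg : ∀ z ∈ Metric.sphere x r, 0 ≤ L z - H z + ε / 6 := fun z hz => by
    have hz' := Metric.sphere_subset_closedBall hz
    linarith [huL z hz', (abs_le.1 (hHu z hz')).1]
  have hJ_le := (harnack hr (fun z _ => hJ z) hJ_nonneg hy).2
  have hyb : y ∈ Metric.closedBall x r := mem_closedBall_iff_norm.2 (by linarith)
  linarith [(abs_le.1 (hHu y hyb)).1, (abs_le.1 (hHu x (Metric.mem_closedBall_self hr.le))).2]

lemma le_pow_mul_of_chain {E : Type*} [NormedAddCommGroup E] [NormedSpace ℝ E] {S : Set E}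
    (hS : Convex ℝ S) {W : E → ℝ} {C c m θ : ℝ} {N : ℕ} (hC : 1 ≤ C) (hN : 0 < N)
    (hstep : ∀ y ∈ S, W y ≤ θ → ∀ z, ‖z - y‖ ≤ c → W z ≤ C * W y) {x y : E} (hx : x ∈ S)
    (hy : y ∈ S) (hxy : ‖x - y‖ ≤ N * c) (hm : 0 ≤ m) (hym : W y ≤ m) (hθ : C ^ N * m ≤ θ) :
    W x ≤ C ^ N * m := by
  have hN' : (0 : ℝ) < N := by exact_mod_cast hN
  set P : ℕ → E := fun i => AffineMap.lineMap y x ((i : ℝ) / N) with hP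
  have hPS : ∀ i ≤ N, P i ∈ S := fun i hi => hS.lineMap_mem hy hx
    ⟨by positivity, (div_le_one hN').2 (by exact_mod_cast hi)⟩
  have hPc (i : ℕ) : ‖P (i + 1) - P i‖ ≤ c := by
    have hsub : P (i + 1) - P i = (1 / (N : ℝ)) • (x - y) := by
      simp only [hP, AffineMap.lineMap_apply_module']
      rw [add_sub_add_right_eq_sub, ← sub_smul]
      push_cast
      ring_nf
    rw [hsub, norm_smul, Real.norm_of_nonneg (by positivity), one_div, inv_mul_le_iff₀ hN']
    exact hxy
  have hind : ∀ i ≤ N, W (P i) ≤ C ^ i * m := by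
    intro i hi
    induction i with
    | zero => simpa [hP] using hym
    | succ i ih =>
      have ih := ih (by omega)
      have hle : W (P i) ≤ θ := ih.trans ((by gcongr; omega : C ^ i * m ≤ C ^ N * m).trans hθ)
      calc W (P (i + 1)) ≤ C * W (P i) := hstep _ (hPS i (by omega)) hle _ (hPc i)
        _ ≤ C * (C ^ i * m) := by gcongr
        _ = C ^ (i + 1) * m := by ring
  simpa [hP, div_self hN'.ne'] using hind N le_rfl

lemma sub_le_three_mul_of_frame {D G : Set ℂ} {g f u L : ℂ → ℝ} (hs : IsSubsolution D g f u)
    (hmax : MaximalOn D f u G) {S c R : ℝ} {p k : ℂ} (hk : k ≠ 0) (hS : 0 < S) (hc : 0 < c)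
    (hf : ∀ x ∈ Metric.closedBall p (R * ‖k‖), √(f x) ≤ S)
    (hG : Metric.closedBall p (R * ‖k‖) ⊆ G)
    (hD : Disjoint (Metric.closedBall p (R * ‖k‖)) (closure D))
    (hL : ∀ x, InnerProductSpace.HarmonicAt L x)
    (huL : ∀ x, ‖frameCoord p k x‖ ≤ R → 1 ≤ (frameCoord p k x).re → u x ≤ L x) {y z : ℂ}
    (hy : ‖frameCoord p k y‖ + c ≤ R) (hyre : 1 + c ≤ (frameCoord p k y).re)
    (huy : 6 * S * (c * ‖k‖) ≤ u y) (hz : ‖frameCoord p k z - frameCoord p k y‖ ≤ c / 2) :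
    L z - u z ≤ 3 * (L y - u y) := by
  have hball : ∀ x ∈ Metric.closedBall y (c * ‖k‖),
      ‖frameCoord p k x‖ ≤ R ∧ 1 ≤ (frameCoord p k x).re := by
    intro x hx
    rw [mem_closedBall_iff_norm, ← norm_frameCoord_sub_le_iff hk (p := p)] at hx
    refine ⟨by linarith [norm_sub_norm_le (frameCoord p k x) (frameCoord p k y)], ?_⟩
    have hre := (abs_le.1 ((Complex.abs_re_le_norm _).trans hx)).1
    rw [Complex.sub_re] at hre
    linarith
  have hsub : Metric.closedBall y (c * ‖k‖) ⊆ Metric.closedBall p (R * ‖k‖) := fun x hx =>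
    (mem_closedBall_iff_norm_frameCoord_le hk).2 (hball x hx).1
  refine sub_le_three_mul hs hmax hS (mul_pos hc (norm_pos_iff.2 hk))
    (fun x hx => hf x (hsub (Metric.sphere_subset_closedBall hx)))
    (Metric.ball_subset_closedBall.trans (hsub.trans hG)) (hD.mono_left hsub) huy hL
    (fun x hx => huL x (hball x hx).1 (hball x hx).2) ?_
  rwa [norm_frameCoord_sub_le_iff hk, div_mul_eq_mul_div] at hz

/-- The frame of `p` and `k` is admissible for the slope `a` if the ball which it covers lies in `G`
and off `closure D`, and the slope required by `f` on it hardly exceeds `a`. -/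
structure IsAdmissibleFrame (D G : Set ℂ) (f : ℂ → ℝ) (p k : ℂ) (a : ℝ) : Prop where
  ne_zero : k ≠ 0
  subset : Metric.closedBall p (20 * ‖k‖) ⊆ G
  disjoint : Disjoint (Metric.closedBall p (20 * ‖k‖)) (closure D)
  sqrt_le : ∀ x ∈ Metric.closedBall p (20 * ‖k‖), √(f x) ≤ 161 / 160 * a

/-- In the frame of `p` and `k`, the function `u` lies below the plane of slope `a` that vanishes on
`Re ζ = 1` up to an error `δ`, and almost attains it at `ζ = 2`. -/
structure IsFlatFrame (D G : Set ℂ) (f u : ℂ → ℝ) (p k : ℂ) (a δ : ℝ) : Prop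
    extends IsAdmissibleFrame D G f p k a where
  le_plane : ∀ x, ‖frameCoord p k x‖ ≤ 20 → 1 ≤ (frameCoord p k x).re →
    u x ≤ ‖k‖ * ((a + δ) * ((frameCoord p k x).re - 1 + δ))
  le_apply : ‖k‖ * (a - δ) ≤ u (p + 2 * k)

/-- The gap between `u` and its upper plane is propagated from `p + 2 k` along a Harnack chain. -/
lemma IsFlatFrame.sub_le_pow_mul {D G : Set ℂ} {g f u : ℂ → ℝ} {p k : ℂ} {a δ τ : ℝ} {N : ℕ}
    (hF : IsFlatFrame D G f u p k a δ) (hs : IsSubsolution D g f u) (hmax : MaximalOn D f u G)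
    (ha : 0 < a) (hδ : 0 < δ) (hδ1 : δ ≤ 1) (hτ : 0 < τ) (hτ1 : τ ≤ 1) (hN : 576 / τ < N)
    (hδN : 3 ^ N * ((a + 3) * δ) ≤ a * τ / 2) {x : ℂ} (hx : ‖frameCoord p k x‖ ≤ 10)
    (hxre : 1 + τ ≤ (frameCoord p k x).re) :
    ‖k‖ * ((a + δ) * ((frameCoord p k x).re - 1 + δ)) - u x
      ≤ 3 ^ N * (‖k‖ * ((a + 3) * δ)) := by
  have hk := hF.ne_zero
  have hN0 : (0 : ℝ) < N := lt_trans (by positivity) hN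
  set L : ℂ → ℝ := fun x => ‖k‖ * ((a + δ) * ((frameCoord p k x).re - 1 + δ)) with hL
  have hL_harmonic (y : ℂ) : InnerProductSpace.HarmonicAt L y := by
    convert harmonicAt_mul_re_frameCoord_add (‖k‖ * (a + δ)) (δ - 1) p k y using 2
    ring
  suffices h : L (p + frameCoord p k x * k) - u (p + frameCoord p k x * k) ≤
      3 ^ N * (‖k‖ * ((a + 3) * δ)) by
    rwa [add_frameCoord_mul hk] at h
  refine le_pow_mul_of_chain (y := 2) (c := τ / 48) (θ := ‖k‖ * (a * τ / 2))
    (W := fun ζ => L (p + ζ * k) - u (p + ζ * k))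
    ((convex_closedBall (0 : ℂ) 10).inter (convex_halfSpace_re_ge (1 + τ))) (by norm_num)
    (by exact_mod_cast hN0) ?_ ⟨mem_closedBall_zero_iff.2 hx, hxre⟩
    ⟨by norm_num, by simp only [mem_ofPred_eq, Complex.re_ofNat]; linarith⟩ ?_ (by positivity) ?_ ?_
  · rintro ζ ⟨hζ, hζre : 1 + τ ≤ ζ.re⟩ hζθ z hz
    rw [mem_closedBall_zero_iff] at hζ
    refine sub_le_three_mul_of_frame (c := τ / 24) hs hmax hk (by positivity : 0 < 2 * a)
      (by positivity) (fun x hx => (hF.sqrt_le x hx).trans (by linarith)) hF.subset hF.disjoint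
      hL_harmonic hF.le_plane (y := p + ζ * k) (z := p + z * k) ?_ ?_ ?_ ?_
    · rw [frameCoord_add_mul hk]
      linarith
    · rw [frameCoord_add_mul hk]
      linarith
    · have hζL : ‖k‖ * (a * τ) ≤ L (p + ζ * k) := by
        simp only [hL, frameCoord_add_mul hk]
        gcongr <;> linarith
      linarith
    · rw [frameCoord_add_mul hk, frameCoord_add_mul hk]
      linarith
  · rw [div_lt_iff₀ hτ] at hN
    have h12 := norm_sub_le (frameCoord p k x) 2
    rw [Complex.norm_two] at h12
    linarith
  · have hL2 : L (p + 2 * k) = ‖k‖ * ((a + δ) * (1 + δ)) := by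
      simp only [hL, frameCoord_add_mul hk, Complex.re_ofNat]
      ring
    have : ‖k‖ * ((a + δ) * (1 + δ)) ≤ ‖k‖ * (a - δ + (a + 3) * δ) := by gcongr; nlinarith
    linarith [hF.le_apply]
  · calc 3 ^ N * (‖k‖ * ((a + 3) * δ)) = ‖k‖ * (3 ^ N * ((a + 3) * δ)) := by ring
      _ ≤ ‖k‖ * (a * τ / 2) := by gcongr

lemma exists_forall_isFlatFrame_lower_bound {a τ κ : ℝ} (ha : 0 < a) (hτ : 0 < τ) (hτ1 : τ ≤ 1)
    (hκ : 0 < κ) : ∃ δ > 0, ∀ {D G : Set ℂ} {g f u : ℂ → ℝ} {p k : ℂ},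
      IsSubsolution D g f u → MaximalOn D f u G → IsFlatFrame D G f u p k a δ →
      ∀ x, ‖frameCoord p k x‖ ≤ 10 → 1 + τ ≤ (frameCoord p k x).re →
        ‖k‖ * ((a - κ) * ((frameCoord p k x).re - 1)) ≤ u x := by
  obtain ⟨N, hN⟩ := exists_nat_gt (576 / τ)
  set θ := min (a * τ / 2) (κ * τ)
  obtain ⟨δ, hδ, hδ1, hδθ⟩ : ∃ δ > 0, δ ≤ 1 ∧ 3 ^ N * ((a + 3) * δ) ≤ θ := by
    refine ⟨min 1 (θ / (3 ^ N * (a + 3))), by positivity, min_le_left _ _, ?_⟩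
    rw [← mul_assoc, mul_comm, ← le_div_iff₀ (by positivity)]
    exact min_le_right _ _
  refine ⟨δ, hδ, fun {D G g f u p k} hs hmax hF x hx hxre => ?_⟩
  have hgap := hF.sub_le_pow_mul hs hmax ha hδ hδ1 hτ hτ1 hN (hδθ.trans (min_le_left _ _)) hx hxre
  have hplane : ‖k‖ * (a * ((frameCoord p k x).re - 1)) ≤
      ‖k‖ * ((a + δ) * ((frameCoord p k x).re - 1 + δ)) := by
    have : 0 ≤ (frameCoord p k x).re - 1 := by linarith
    gcongr <;> linarith
  have hκτ : κ * τ ≤ κ * ((frameCoord p k x).re - 1) := by gcongr; linarith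
  have hgap_le : ‖k‖ * (3 ^ N * ((a + 3) * δ)) ≤ ‖k‖ * (κ * ((frameCoord p k x).re - 1)) :=
    mul_le_mul_of_nonneg_left ((hδθ.trans (min_le_right _ _)).trans hκτ) (norm_nonneg k)
  linarith

/-! ### Raising a flat transition -/

/-- The harmonic function `Re (159/160 a (ζ - 1) + a/8 (1/ζ - 1/4))`: a plane that vanishes on
`Re ζ = 1`, lifted inside the disk `|ζ - 2| < 2` and lowered outside of it. It is the lift that
makes its slope on the zero level near `Re ζ = 1` exceed `a`. -/
def liftedPlane (a : ℝ) (ζ : ℂ) : ℝ :=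
  (((159 / 160 * a : ℝ) : ℂ) * (ζ - 1) + ((a / 8 : ℝ) : ℂ) * (ζ⁻¹ - 1 / 4)).re

lemma norm_sq_eq_re_sq_add_im_sq (ζ : ℂ) : ‖ζ‖ ^ 2 = ζ.re ^ 2 + ζ.im ^ 2 := by
  rw [Complex.sq_norm, Complex.normSq_apply, sq, sq]

lemma norm_sub_four_sq (ζ : ℂ) : ‖ζ - 4‖ ^ 2 = ‖ζ‖ ^ 2 - 8 * ζ.re + 16 := by
  rw [norm_sq_eq_re_sq_add_im_sq, norm_sq_eq_re_sq_add_im_sq, Complex.sub_re, Complex.sub_im,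
    Complex.re_ofNat, Complex.im_ofNat]
  ring

lemma liftedPlane_eq (a : ℝ) (ζ : ℂ) : liftedPlane a ζ =
    a * (159 / 160 * (ζ.re - 1) + 1 / 8 * (ζ.re / ‖ζ‖ ^ 2 - 1 / 4)) := by
  have h : (1 / 4 : ℂ).re = 1 / 4 := by norm_num [Complex.div_re]
  rw [liftedPlane, Complex.add_re, Complex.re_ofReal_mul, Complex.re_ofReal_mul, Complex.sub_re,
    Complex.sub_re, Complex.inv_re, Complex.normSq_eq_norm_sq, Complex.one_re, h]
  ring

lemma liftedPlane_neg_of_norm_eq_half {a : ℝ} (ha : 0 < a) {ζ : ℂ} (h : ‖ζ‖ = 1 / 2) :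
    liftedPlane a ζ < 0 := by
  have hre := (Complex.re_le_norm ζ).trans h.le
  have hinv : ζ.re / (1 / 2) ^ 2 = 4 * ζ.re := by ring
  rw [liftedPlane_eq, h, hinv]
  exact mul_neg_of_pos_of_neg ha (by linarith)

lemma liftedPlane_of_norm_sub_four_eq (a : ℝ) {ζ : ℂ} (h : ‖ζ - 4‖ = 4) (h0 : 0 < ‖ζ‖) :
    liftedPlane a ζ = 159 / 160 * a * (ζ.re - 1) - a / 64 := by
  have hsq : ‖ζ‖ ^ 2 = 8 * ζ.re := by
    have := norm_sub_four_sq ζ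
    rw [h] at this
    linarith
  have hre : ζ.re ≠ 0 := fun hre => by
    rw [hre, mul_zero] at hsq
    exact (pow_pos h0 2).ne' hsq
  rw [liftedPlane_eq, hsq]
  field_simp
  ring

lemma norm_mem_Icc_of_norm_sub_le {ζ : ℂ} (h : ‖ζ - (19 / 20 : ℝ)‖ ≤ 1 / 50) :
    ‖ζ‖ ∈ Icc (93 / 100) (97 / 100) := by
  have habs := abs_le.1 ((abs_norm_sub_norm_le _ _).trans h)
  rw [Complex.norm_real, Real.norm_of_nonneg (by norm_num)] at habs
  constructor <;> linarith

lemma norm_sub_four_lt_of_norm_sub_le {ζ : ℂ} (h : ‖ζ - (19 / 20 : ℝ)‖ ≤ 1 / 50) :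
    ‖ζ - 4‖ < 4 := by
  have htri := norm_sub_le_norm_sub_add_norm_sub ζ ((19 / 20 : ℝ) : ℂ) 4
  have h4 : ‖((19 / 20 : ℝ) : ℂ) - 4‖ = 61 / 20 := by
    rw [← Complex.ofReal_ofNat, ← Complex.ofReal_sub, Complex.norm_real]
    norm_num
  linarith

lemma div_fifty_le_liftedPlane {a : ℝ} (ha : 0 < a) {ζ : ℂ} (h : ‖ζ - (19 / 20 : ℝ)‖ ≤ 1 / 50) :
    a / 50 ≤ liftedPlane a ζ := by
  have hre := (abs_le.1 ((Complex.abs_re_le_norm _).trans h)).1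
  rw [Complex.sub_re, Complex.ofReal_re] at hre
  obtain ⟨hn, hn'⟩ := norm_mem_Icc_of_norm_sub_le h
  have hinv : 98 / 100 ≤ ζ.re / ‖ζ‖ ^ 2 := by
    rw [le_div_iff₀ (by positivity)]
    nlinarith
  rw [liftedPlane_eq, div_eq_mul_inv]
  exact mul_le_mul_of_nonneg_left (by linarith) ha.le

lemma hasDerivAt_inv_liftedPlane (a : ℝ) {ζ : ℂ} (hζ : ζ ≠ 0) :
    HasDerivAt (fun ζ : ℂ => ((159 / 160 * a : ℝ) : ℂ) * (ζ - 1) +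
        ((a / 8 : ℝ) : ℂ) * (ζ⁻¹ - 1 / 4))
      (((159 / 160 * a : ℝ) : ℂ) + ((a / 8 : ℝ) : ℂ) * (-(ζ ^ 2)⁻¹)) ζ := by
  have h := (((hasDerivAt_id ζ).sub_const 1).const_mul ((159 / 160 * a : ℝ) : ℂ)).add
    (((hasDerivAt_inv hζ).sub_const (1 / 4)).const_mul ((a / 8 : ℝ) : ℂ))
  exact h.congr_deriv (by rw [mul_one])

lemma re_neg_inv_sq (ζ : ℂ) :
    (-(ζ ^ 2)⁻¹).re = (‖ζ‖ ^ 2 - 2 * ζ.re ^ 2) / (‖ζ‖ ^ 2) ^ 2 := by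
  rw [Complex.neg_re, Complex.inv_re, Complex.normSq_eq_norm_sq, norm_pow, ← neg_div,
    norm_sq_eq_re_sq_add_im_sq, pow_two ζ, Complex.mul_re]
  congr 1
  ring

lemma liftedPlane_slope {a : ℝ} (ha : 0 < a) {ζ : ℂ} (h0 : liftedPlane a ζ = 0)
    (h1 : 999 / 1000 ≤ ζ.re) (h2 : ζ.re ≤ 1001 / 1000) :
    161 / 160 * a ≤ (((159 / 160 * a : ℝ) : ℂ) + ((a / 8 : ℝ) : ℂ) * (-(ζ ^ 2)⁻¹)).re := by
  rw [Complex.add_re, Complex.re_ofReal_mul, Complex.ofReal_re, re_neg_inv_sq]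
  rw [liftedPlane_eq] at h0
  have hN0 : 0 < ‖ζ‖ ^ 2 := by
    rw [norm_sq_eq_re_sq_add_im_sq]
    nlinarith
  set N := ‖ζ‖ ^ 2
  have hinv : ζ.re / N = 1 / 4 - 159 / 20 * (ζ.re - 1) := by
    linarith [(mul_eq_zero.1 h0).resolve_left ha.ne']
  have hre : ζ.re = (1 / 4 - 159 / 20 * (ζ.re - 1)) * N := (div_eq_iff hN0.ne').1 hinv
  have hN : 387 / 100 ≤ N := by nlinarith
  have : N ≤ 414 / 100 := by nlinarith
  have hquot : 1 / 10 ≤ (N - 2 * ζ.re ^ 2) / N ^ 2 := by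
    rw [le_div_iff₀ (by positivity)]
    nlinarith
  nlinarith

lemma hasFDerivAt_norm_mul_re_comp_frameCoord {F : ℂ → ℂ} {F' p k x : ℂ} (hk : k ≠ 0)
    (hF : HasDerivAt F F' (frameCoord p k x)) :
    ∃ L : ℂ →L[ℝ] ℝ, HasFDerivAt (fun y => ‖k‖ * (F (frameCoord p k y)).re) L x ∧
      L (k / ‖k‖) = F'.re := by
  have hcoord : HasDerivAt (frameCoord p k) (1 / k) x :=
    ((hasDerivAt_id x).sub_const p).div_const k
  have hcomp := (hF.comp x hcoord).hasFDerivAt.restrictScalars ℝ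
  refine ⟨_, (Complex.reCLM.hasFDerivAt.comp x hcomp).const_smul ‖k‖, ?_⟩
  have hk' : (‖k‖ : ℂ) ≠ 0 := by exact_mod_cast (norm_pos_iff.2 hk).ne'
  simp only [smul_apply, ContinuousLinearMap.comp_apply, Complex.reCLM_apply, smul_eq_mul,
    ContinuousLinearMap.coe_restrictScalars', ContinuousLinearMap.toSpanSingleton_apply]
  rw [← Complex.re_ofReal_mul]
  congr 1
  field_simp

/-- The lifted plane of slope `a` in the frame of `p` and `k`. -/
def framedLiftedPlane (p k : ℂ) (a : ℝ) (x : ℂ) : ℝ := ‖k‖ * liftedPlane a (frameCoord p k x)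

lemma harmonicAt_framedLiftedPlane (a : ℝ) {p k x : ℂ} (hx : frameCoord p k x ≠ 0) :
    InnerProductSpace.HarmonicAt (framedLiftedPlane p k a) x := by
  have hF : AnalyticAt ℂ (fun ζ : ℂ => ((159 / 160 * a : ℝ) : ℂ) * (ζ - 1) +
      ((a / 8 : ℝ) : ℂ) * (ζ⁻¹ - 1 / 4)) (frameCoord p k x) := by
    have := analyticAt_inv (𝕜 := ℂ) hx
    fun_prop
  exact (harmonicAt_re_comp_frameCoord hF).const_smul (c := ‖k‖)

lemma BelowPlane.le_of_framedLiftedPlane_le {w : ℂ → ℝ} {p k x ν : ℂ} {a α : ℝ}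
    (hB : BelowPlane w x ν α) (hν : ‖ν‖ = 1) (hk : k ≠ 0) (ha : 0 < a)
    (hx : framedLiftedPlane p k a x = 0) (h1 : 999 / 1000 ≤ (frameCoord p k x).re)
    (h2 : (frameCoord p k x).re ≤ 1001 / 1000)
    (hle : ∀ᶠ y in 𝓝 x, framedLiftedPlane p k a y ≤ w y) : 161 / 160 * a ≤ α := by
  have hk0 : ‖k‖ ≠ 0 := norm_ne_zero_iff.2 hk
  have hx0 : frameCoord p k x ≠ 0 := fun h => by
    rw [h, Complex.zero_re] at h1
    norm_num at h1
  have hslope := liftedPlane_slope ha ((mul_eq_zero.1 hx).resolve_left hk0) h1 h2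
  obtain ⟨L, hL, hLe⟩ :=
    hasFDerivAt_norm_mul_re_comp_frameCoord hk (hasDerivAt_inv_liftedPlane a hx0)
  rw [← hLe] at hslope
  refine hslope.trans (hB.apply_le_slope hν ?_ hL hx hle (lt_of_lt_of_le (by positivity) hslope))
  rw [norm_div, Complex.norm_real, norm_norm, div_self hk0]

/-- A bounded region `E ⊆ G` off `closure D` in which `u` vanishes, and which is surrounded by the
positivity set of `u`; such are the components of the interior of the zero set. -/
structure IsZeroRegion (D G : Set ℂ) (u : ℂ → ℝ) (E : Set ℂ) : Prop where
  isOpen : IsOpen E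
  isPreconnected : IsPreconnected E
  isBounded : Bornology.IsBounded E
  disjoint : Disjoint (closure E) (closure D)
  subset : E ⊆ G
  eq_zero : ∀ x ∈ E, u x = 0
  frontier_subset : frontier E ⊆ closure (posSet D u)

/-- In the frame of `p` and `k`, the transition from `u = 0` on `E` to a plane of slope close to `a`
takes place near the line `Re ζ = 1`. -/
structure IsFlatTransition (D G E : Set ℂ) (f u : ℂ → ℝ) (p k : ℂ) (a : ℝ) : Prop
    extends IsAdmissibleFrame D G f p k a where
  mem : ∀ x, ‖frameCoord p k x‖ ≤ 20 → (frameCoord p k x).re ≤ 999 / 1000 → x ∈ E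
  le_apply : ∀ x, ‖frameCoord p k x‖ ≤ 10 → 1001 / 1000 ≤ (frameCoord p k x).re →
    ‖k‖ * (159 / 160 * a * ((frameCoord p k x).re - 1)) ≤ u x

/-- The region `|ζ - 4| ≤ 4`, `|ζ| ≥ 1/2` in the frame of `p` and `k`, in which `u` is raised to the
lifted plane. -/
def liftRegion (p k : ℂ) : Set ℂ :=
  {x | ‖frameCoord p k x - 4‖ ≤ 4 ∧ 1 / 2 ≤ ‖frameCoord p k x‖}

section LiftRegion

variable {p k x : ℂ}

lemma isClosed_liftRegion (p k : ℂ) : IsClosed (liftRegion p k) := by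
  have h4 : Continuous fun x => ‖frameCoord p k x - 4‖ := by fun_prop
  have h0 : Continuous fun x => ‖frameCoord p k x‖ := by fun_prop
  exact (isClosed_le h4 continuous_const).inter (isClosed_le continuous_const h0)

lemma mem_interior_liftRegion (hx4 : ‖frameCoord p k x - 4‖ < 4)
    (hx0 : 1 / 2 < ‖frameCoord p k x‖) : x ∈ interior (liftRegion p k) := by
  have h4 : Continuous fun x => ‖frameCoord p k x - 4‖ := by fun_prop
  have h0 : Continuous fun x => ‖frameCoord p k x‖ := by fun_prop
  exact interior_maximal (s := liftRegion p k) (fun _ hy => ⟨le_of_lt hy.1, le_of_lt hy.2⟩)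
    ((isOpen_lt h4 continuous_const).inter (isOpen_lt continuous_const h0)) ⟨hx4, hx0⟩

lemma norm_frameCoord_le_eight (hx : x ∈ liftRegion p k) : ‖frameCoord p k x‖ ≤ 8 := by
  have h := norm_le_norm_sub_add (frameCoord p k x) 4
  rw [RCLike.norm_ofNat] at h
  linarith [hx.1]

lemma frameCoord_ne_zero (hx : x ∈ liftRegion p k) : frameCoord p k x ≠ 0 :=
  norm_pos_iff.1 (lt_of_lt_of_le (by norm_num) hx.2)

lemma liftRegion_subset_closedBall (hk : k ≠ 0) :
    liftRegion p k ⊆ Metric.closedBall p (20 * ‖k‖) := fun _ hx =>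
  (mem_closedBall_iff_norm_frameCoord_le hk).2 ((norm_frameCoord_le_eight hx).trans (by norm_num))

end LiftRegion

/-- The sum of `u` and a multiple of a bump `ψ`; the factor is a lower bound of the lifted plane on
the disk in which `ψ` is not subharmonic. -/
def addBump (k : ℂ) (a : ℝ) (u ψ : ℂ → ℝ) (x : ℂ) : ℝ := u x + ‖k‖ * (a / 50) * ψ x

section AddBump

variable {E : Set ℂ} {u ψ : ℂ → ℝ} {k q x : ℂ} {a σ : ℝ}

lemma addBump_of_notMem (hψ : IsPartialBump E q σ ψ) (hx : x ∉ E) : addBump k a u ψ x = u x := by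
  rw [addBump, hψ.eq_zero x hx, mul_zero, add_zero]

lemma addBump_of_eq_zero (hx : u x = 0) : addBump k a u ψ x = ‖k‖ * (a / 50) * ψ x := by
  rw [addBump, hx, zero_add]

lemma le_addBump (hψ : IsPartialBump E q σ ψ) (ha : 0 < a) (x : ℂ) : u x ≤ addBump k a u ψ x :=
  le_add_of_nonneg_right (mul_nonneg (by positivity) (hψ.nonneg x))

end AddBump

/-- The competitor of the largest subsolution in the presence of a flat transition. -/
def transitionCompetitor (p k : ℂ) (a : ℝ) (u ψ : ℂ → ℝ) : ℂ → ℝ :=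
  raiseOn (liftRegion p k) (framedLiftedPlane p k a) (addBump k a u ψ)

namespace IsFlatTransition

variable {D G E : Set ℂ} {f g u ψ : ℂ → ℝ} {p k x : ℂ} {a : ℝ}

lemma apply_pos (hT : IsFlatTransition D G E f u p k a) (ha : 0 < a)
    (hx : ‖frameCoord p k x‖ ≤ 10) (hxre : 1001 / 1000 ≤ (frameCoord p k x).re) : 0 < u x :=
  (mul_pos (norm_pos_iff.2 hT.ne_zero) (mul_pos (by positivity) (by linarith))).trans_le
    (hT.le_apply x hx hxre)

lemma notMem_closure (hT : IsFlatTransition D G E f u p k a) (hx : x ∈ liftRegion p k) :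
    x ∉ closure D :=
  hT.disjoint.notMem_of_mem_left (liftRegion_subset_closedBall hT.ne_zero hx)

lemma framedLiftedPlane_neg_or_le (hT : IsFlatTransition D G E f u p k a) (ha : 0 < a)
    (hx : x ∈ frontier (liftRegion p k)) :
    framedLiftedPlane p k a x < 0 ∨ framedLiftedPlane p k a x ≤ u x ∧ 0 < u x := by
  have hk0 : 0 < ‖k‖ := norm_pos_iff.2 hT.ne_zero
  have hxK : x ∈ liftRegion p k := (isClosed_liftRegion p k).frontier_subset hx
  rcases hxK.1.lt_or_eq with h4 | h4
  · have hhalf : ‖frameCoord p k x‖ = 1 / 2 := hxK.2.eq_or_lt.elim Eq.symm fun h0 =>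
      absurd (mem_interior_liftRegion h4 h0) hx.2
    exact Or.inl (mul_neg_of_pos_of_neg hk0 (liftedPlane_neg_of_norm_eq_half ha hhalf))
  · have heq : framedLiftedPlane p k a x =
        ‖k‖ * (159 / 160 * a * ((frameCoord p k x).re - 1) - a / 64) := by
      rw [framedLiftedPlane,
        liftedPlane_of_norm_sub_four_eq a h4 (norm_pos_iff.2 (frameCoord_ne_zero hxK))]
    have hx10 : ‖frameCoord p k x‖ ≤ 10 := (norm_frameCoord_le_eight hxK).trans (by norm_num)
    rcases le_or_gt (1001 / 1000) (frameCoord p k x).re with hre | hre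
    · refine Or.inr ⟨le_trans ?_ (hT.le_apply x hx10 hre), hT.apply_pos ha hx10 hre⟩
      rw [heq]
      gcongr
      linarith
    · rw [heq]
      exact Or.inl (mul_neg_of_pos_of_neg hk0 (by nlinarith))

lemma framedLiftedPlane_le (hT : IsFlatTransition D G E f u p k a) (hs : IsSubsolution D g f u)
    (ha : 0 < a) (hx : x ∈ frontier (liftRegion p k)) : framedLiftedPlane p k a x ≤ u x := by
  rcases hT.framedLiftedPlane_neg_or_le ha hx with hneg | hle
  · exact hneg.le.trans (hs.nonneg x fun hxD =>
      hT.notMem_closure ((isClosed_liftRegion p k).frontier_subset hx) (subset_closure hxD))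
  · exact hle.1

lemma ball_subset (hT : IsFlatTransition D G E f u p k a) :
    Metric.ball (p + (19 / 20 : ℝ) * k) (1 / 25 * ‖k‖) ⊆ E := by
  intro x hx
  have hle : ‖frameCoord p k x - (19 / 20 : ℝ)‖ ≤ 1 / 25 := by
    rw [← frameCoord_add_mul hT.ne_zero p (19 / 20 : ℝ), norm_frameCoord_sub_le_iff hT.ne_zero]
    exact (mem_ball_iff_norm.1 hx).le
  have hre := (abs_le.1 ((Complex.abs_re_le_norm _).trans hle)).2
  rw [Complex.sub_re, Complex.ofReal_re] at hre
  have hnorm := norm_le_norm_sub_add (frameCoord p k x) (19 / 20 : ℝ)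
  rw [Complex.norm_real, Real.norm_of_nonneg (by norm_num)] at hnorm
  exact hT.mem x (by linarith) (by linarith)

section Competitor

variable {σ : ℝ} {q : ℂ}

lemma le_transitionCompetitor (hψ : IsPartialBump E q σ ψ) (ha : 0 < a) (x : ℂ) :
    u x ≤ transitionCompetitor p k a u ψ x :=
  (le_addBump hψ ha x).trans (le_raiseOn x)

lemma framedLiftedPlane_le_addBump (hT : IsFlatTransition D G E f u p k a)
    (hs : IsSubsolution D g f u) (ha : 0 < a) (hψ : IsPartialBump E q σ ψ)
    (hx : x ∈ frontier (liftRegion p k)) : framedLiftedPlane p k a x ≤ addBump k a u ψ x :=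
  (hT.framedLiftedPlane_le hs ha hx).trans (le_addBump hψ ha x)

lemma continuousOn_transitionCompetitor (hT : IsFlatTransition D G E f u p k a)
    (hs : IsSubsolution D g f u) (ha : 0 < a) (hψ : IsPartialBump E q σ ψ) :
    ContinuousOn (transitionCompetitor p k a u ψ) Dᶜ :=
  continuousOn_raiseOn
    (hs.continuousOn.add (continuous_const.mul hψ.continuous).continuousOn)
    (isClosed_liftRegion p k)
    (fun _ hx => (harmonicAt_framedLiftedPlane a
      (frameCoord_ne_zero hx)).1.continuousAt.continuousWithinAt)
    (fun _ hx => hT.framedLiftedPlane_le_addBump hs ha hψ hx)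

lemma mem_interior_and_eq_framedLiftedPlane (hT : IsFlatTransition D G E f u p k a) (ha : 0 < a)
    (hψ : IsPartialBump E q σ ψ) (hux : u x = 0)
    (hx : ‖x - (p + (19 / 20 : ℝ) * k)‖ ≤ 1 / 50 * ‖k‖) :
    x ∈ interior (liftRegion p k) ∧
      transitionCompetitor p k a u ψ x = framedLiftedPlane p k a x := by
  have hζ : ‖frameCoord p k x - (19 / 20 : ℝ)‖ ≤ 1 / 50 := by
    rwa [← frameCoord_add_mul hT.ne_zero p (19 / 20 : ℝ), norm_frameCoord_sub_le_iff hT.ne_zero]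
  have hint : x ∈ interior (liftRegion p k) := mem_interior_liftRegion
    (norm_sub_four_lt_of_norm_sub_le hζ) (by linarith [(norm_mem_Icc_of_norm_sub_le hζ).1])
  refine ⟨hint, (raiseOn_of_mem (interior_subset hint)).trans (max_eq_right ?_)⟩
  calc
    addBump k a u ψ x = ‖k‖ * (a / 50) * ψ x := addBump_of_eq_zero hux
    _ ≤ ‖k‖ * (a / 50) := mul_le_of_le_one_right (by positivity) (hψ.le_one x)
    _ ≤ framedLiftedPlane p k a x := by
      rw [framedLiftedPlane]
      gcongr
      exact div_fifty_le_liftedPlane ha hζ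

lemma transitionCompetitor_cases (hT : IsFlatTransition D G E f u p k a)
    (hs : IsSubsolution D g f u) (ha : 0 < a) (hE : ∀ y ∈ E, u y = 0)
    (hψ : IsPartialBump E q σ ψ) (hx : u x < transitionCompetitor p k a u ψ x) :
    (x ∈ interior (liftRegion p k) ∧
      transitionCompetitor p k a u ψ x = framedLiftedPlane p k a x) ∨
    (x ∈ E ∧ transitionCompetitor p k a u ψ x = addBump k a u ψ x ∧
      1 / 50 * ‖k‖ < ‖x - (p + (19 / 20 : ℝ) * k)‖) := by
  rcases (le_raiseOn x).lt_or_eq with hlt | heq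
  · exact Or.inl ⟨mem_interior_of_lt_raiseOn
      (fun _ hy => hT.framedLiftedPlane_le_addBump hs ha hψ hy) hlt, raiseOn_eq_of_lt hlt⟩
  · have hxE : x ∈ E := by
      by_contra hxE
      exact hx.ne (by rw [transitionCompetitor, ← heq, addBump_of_notMem hψ hxE])
    rcases le_or_gt ‖x - (p + (19 / 20 : ℝ) * k)‖ (1 / 50 * ‖k‖) with hle | hlt
    · exact Or.inl (hT.mem_interior_and_eq_framedLiftedPlane ha hψ (hE x hxE) hle)
    · exact Or.inr ⟨hxE, heq.symm, hlt⟩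

lemma viscLaplacianNonneg_transitionCompetitor (hT : IsFlatTransition D G E f u p k a)
    (hs : IsSubsolution D g f u) (ha : 0 < a) (hE : IsOpen E) (hEu : ∀ y ∈ E, u y = 0)
    (hψ : IsPartialBump E (p + (19 / 20 : ℝ) * k) (1 / 50 * ‖k‖) ψ) (hψpos : ∀ y ∈ E, 0 < ψ y)
    (hx : u x < transitionCompetitor p k a u ψ x) :
    ViscLaplacianNonneg (transitionCompetitor p k a u ψ) x := by
  rcases hT.transitionCompetitor_cases hs ha hEu hψ hx with ⟨hxK, hwP⟩ | ⟨hxE, hwU, hxq⟩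
  · have hharm := harmonicAt_framedLiftedPlane a (frameCoord_ne_zero (interior_subset hxK))
    refine (viscLaplacianNonneg_of_harmonicAt hharm).of_touching hwP.symm ?_
    filter_upwards [isOpen_interior.mem_nhds hxK] with y hy
    exact le_raiseOn_of_mem (interior_subset hy)
  · have hm : 0 < ‖k‖ * (a / 50) := mul_pos (norm_pos_iff.2 hT.ne_zero) (by positivity)
    refine ((hψ.visc x (hψpos x hxE) hxq).const_mul hm).of_touching ?_ ?_
    · rw [hwU, addBump_of_eq_zero (hEu x hxE)]
    · filter_upwards [hE.mem_nhds hxE] with y hy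
      exact (addBump_of_eq_zero (hEu y hy)).symm.trans_le (le_raiseOn y)

lemma sqrt_le_of_transitionCompetitor (hT : IsFlatTransition D G E f u p k a)
    (hs : IsSubsolution D g f u) (ha : 0 < a) (hE : IsZeroRegion D G u E)
    (hψ : IsPartialBump E q σ ψ) (hψpos : ∀ y ∈ E, 0 < ψ y)
    (hx : x ∈ frontier (posSet D (transitionCompetitor p k a u ψ))) (hxD : x ∉ closure D)
    (hxu : x ∉ closure (posSet D u)) {ν : ℂ} {α : ℝ} (hν : ‖ν‖ = 1)
    (hB : BelowPlane (transitionCompetitor p k a u ψ) x ν α) : √(f x) ≤ α := by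
  have hK : IsClosed (liftRegion p k) := isClosed_liftRegion p k
  have hw : ContinuousAt (transitionCompetitor p k a u ψ) x :=
    continuousAt_of_notMem_closure (hT.continuousOn_transitionCompetitor hs ha hψ) hxD
  have hw0 : transitionCompetitor p k a u ψ x ≤ 0 :=
    not_lt.1 fun h => notMem_frontier_posSet hxD hw h hx
  have hux : u x ≤ 0 := (le_transitionCompetitor hψ ha x).trans hw0
  have hxE : x ∉ E := fun h => by
    have hUx := (le_raiseOn x).trans hw0
    rw [addBump_of_eq_zero (hE.eq_zero x h)] at hUx
    exact hUx.not_gt (mul_pos (mul_pos (norm_pos_iff.2 hT.ne_zero) (by positivity)) (hψpos x h))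
  have hxE' : x ∉ closure E := fun h =>
    hxu (hE.frontier_subset ⟨h, fun hint => hxE (interior_subset hint)⟩)
  have hxU : x ∉ closure (posSet D (addBump k a u ψ)) := by
    refine fun h => hxu (mem_closure_posSet_congr ?_ h)
    filter_upwards [isClosed_closure.isOpen_compl.mem_nhds hxE'] with y hy
    exact addBump_of_notMem hψ fun hyE => hy (subset_closure hyE)
  have hxK : x ∈ liftRegion p k := mem_of_mem_closure_posSet_raiseOn hK hx.1 hxU
  have hP0 : framedLiftedPlane p k a x = 0 := eq_zero_of_mem_frontier_posSet_raiseOn hxD hw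
    (fun y hy => (hs.nonneg y hy).trans (le_addBump hψ ha y))
    (harmonicAt_framedLiftedPlane a (frameCoord_ne_zero hxK)).1.continuousAt hxK hx hxU
  have hxint : x ∈ interior (liftRegion p k) := by
    by_contra h
    rcases hT.framedLiftedPlane_neg_or_le ha ⟨subset_closure hxK, h⟩ with hneg | hpos
    · exact hneg.ne hP0
    · exact hux.not_gt hpos.2
  have hx8 : ‖frameCoord p k x‖ ≤ 8 := norm_frameCoord_le_eight hxK
  have hre : 999 / 1000 ≤ (frameCoord p k x).re :=
    not_lt.1 fun h => hxE (hT.mem x (by linarith) h.le)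
  have hre' : (frameCoord p k x).re ≤ 1001 / 1000 :=
    not_lt.1 fun h => hux.not_gt (hT.apply_pos ha (by linarith) h.le)
  refine (hT.sqrt_le x (liftRegion_subset_closedBall hT.ne_zero hxK)).trans
    (hB.le_of_framedLiftedPlane_le hν hT.ne_zero ha hP0 hre hre' ?_)
  filter_upwards [isOpen_interior.mem_nhds hxint] with y hy
  exact le_raiseOn_of_mem (interior_subset hy)

lemma isCompetitor (hT : IsFlatTransition D G E f u p k a) (hs : IsSubsolution D g f u)
    (ha : 0 < a) (hE : IsZeroRegion D G u E)
    (hψ : IsPartialBump E (p + (19 / 20 : ℝ) * k) (1 / 50 * ‖k‖) ψ) (hψpos : ∀ y ∈ E, 0 < ψ y) :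
    IsCompetitor D f u G (liftRegion p k ∪ closure E) (transitionCompetitor p k a u ψ) where
  isCompact := ((isCompact_closedBall _ _).of_isClosed_subset (isClosed_liftRegion p k)
    (liftRegion_subset_closedBall hT.ne_zero)).union hE.isBounded.isCompact_closure
  disjoint := disjoint_union_left.2
    ⟨hT.disjoint.mono_left (liftRegion_subset_closedBall hT.ne_zero), hE.disjoint⟩
  eq_outside x hx := by
    rw [mem_union, not_or] at hx
    exact (raiseOn_of_notMem hx.1).trans
      (addBump_of_notMem hψ fun h => hx.2 (subset_closure h))
  continuousOn := hT.continuousOn_transitionCompetitor hs ha hψ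
  le := le_transitionCompetitor hψ ha
  mem_of_lt x hx := by
    rcases hT.transitionCompetitor_cases hs ha hE.eq_zero hψ hx with h | h
    · exact hT.subset (liftRegion_subset_closedBall hT.ne_zero (interior_subset h.1))
    · exact hE.subset h.1
  subharmonic _ hx :=
    hT.viscLaplacianNonneg_transitionCompetitor hs ha hE.isOpen hE.eq_zero hψ hψpos hx
  freeBoundary _ hx hxD hxu _ _ hν hB :=
    hT.sqrt_le_of_transitionCompetitor hs ha hE hψ hψpos hx hxD hxu hν hB

end Competitor

lemma not_isZeroRegion (hT : IsFlatTransition D G E f u p k a) (hs : IsSubsolution D g f u)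
    (hmax : MaximalOn D f u G) (ha : 0 < a) : ¬ IsZeroRegion D G u E := by
  intro hE
  have hk0 : 0 < ‖k‖ := norm_pos_iff.2 hT.ne_zero
  obtain ⟨ψ, hψ, hψpos⟩ := exists_isPartialBump_forall_pos hE.isOpen hE.isPreconnected
    (σ := 1 / 50 * ‖k‖) (by positivity) (by linarith) hT.ball_subset
  have hqE : p + (19 / 20 : ℝ) * k ∈ E := hT.ball_subset (Metric.mem_ball_self (by positivity))
  have hle := (le_raiseOn _).trans
    (hmax _ _ (hT.isCompetitor hs ha hE hψ hψpos) (p + (19 / 20 : ℝ) * k))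
  rw [addBump_of_eq_zero (hE.eq_zero _ hqE), hE.eq_zero _ hqE] at hle
  exact hle.not_gt (mul_pos (by positivity) (hψpos _ hqE))

end IsFlatTransition

/-! ### Growth next to a disk of zeros -/

lemma norm_add_smul_sub_le {V : Type*} [NormedAddCommGroup V] [InnerProductSpace ℝ V] {ν : V}
    (hν : ‖ν‖ = 1) {s : ℝ} (hs : 0 < s) (h : V) :
    ‖h + s • ν‖ - s ≤ ⟪h, ν⟫_ℝ + ‖h‖ ^ 2 / (2 * s) := by
  have hsq : ‖h + s • ν‖ ^ 2 = ‖h‖ ^ 2 + 2 * (s * ⟪h, ν⟫_ℝ) + s ^ 2 := by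
    rw [norm_add_sq_real, real_inner_smul_right, norm_smul, hν, Real.norm_of_nonneg hs.le, mul_one]
  have heq : ⟪h, ν⟫_ℝ + ‖h‖ ^ 2 / (2 * s) = (‖h + s • ν‖ ^ 2 - s ^ 2) / (2 * s) := by
    rw [hsq]
    field_simp
    ring
  rw [heq, le_div_iff₀ (by positivity)]
  nlinarith [sq_nonneg (‖h + s • ν‖ - s)]

lemma one_sub_logBump_le {q x : ℂ} {σ R : ℝ} (hσ : 0 < σ) (hR : σ < R) :
    1 - logBump q σ R x ≤ 1 / (σ * (Real.log R - Real.log σ)) * max (‖x - q‖ - σ) 0 := by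
  have hlog := log_sub_log_pos hσ hR
  have hmax : 0 < max ‖x - q‖ σ := lt_max_of_lt_right hσ
  have hle : Real.log (max ‖x - q‖ σ) - Real.log σ ≤ max ‖x - q‖ σ / σ - 1 := by
    rw [← Real.log_div hmax.ne' hσ.ne']
    exact Real.log_le_sub_one_of_pos (div_pos hmax hσ)
  have hsub : max (‖x - q‖ - σ) 0 = max ‖x - q‖ σ - σ := by
    rw [← max_sub_sub_right, sub_self]
  calc
    1 - logBump q σ R x
      = (Real.log (max ‖x - q‖ σ) - Real.log σ) / (Real.log R - Real.log σ) := by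
        rw [logBump]
        field_simp
        ring
    _ ≤ (max ‖x - q‖ σ / σ - 1) / (Real.log R - Real.log σ) := by gcongr
    _ = 1 / (σ * (Real.log R - Real.log σ)) * max (‖x - q‖ - σ) 0 := by
        rw [hsub]
        field_simp

lemma IsSubsolution.le_mul_one_sub_logBump {D : Set ℂ} {g f u : ℂ → ℝ}
    (hs : IsSubsolution D g f u) {y : ℂ} {σ R B : ℝ} (hσ : 0 < σ) (hR : σ < R) (hB : 0 ≤ B)
    (hD : Disjoint (Metric.closedBall y R) (closure D))
    (hu : ∀ x ∈ Metric.closedBall y σ, u x = 0) (huB : ∀ x ∈ Metric.closedBall y R, u x ≤ B) :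
    ∀ x ∈ Metric.closedBall y R, u x ≤ B * (1 - logBump y σ R x) := by
  have hxD : ∀ x ∈ Metric.closedBall y R, x ∉ D := fun x hx h =>
    hD.notMem_of_mem_left hx (subset_closure h)
  refine le_of_viscLaplacianNonneg (isCompact_closedBall y R) (hs.continuousOn.mono hxD)
    (continuous_const.mul (continuous_const.sub (continuous_logBump hσ))).continuousOn
    fun x hx hlt => ?_
  have hpos : 0 < u x := (mul_nonneg hB (sub_nonneg.2 (logBump_le_one hσ hR))).trans_lt hlt
  have hxσ : σ < ‖x - y‖ := not_le.1 fun h => hpos.ne' (hu x (mem_closedBall_iff_norm.2 h))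
  have hxR : ‖x - y‖ < R := by
    by_contra! h
    refine hlt.not_ge ((huB x hx).trans (le_mul_of_one_le_right hB ?_))
    linarith [logBump_nonpos hσ hR h]
  have hharm : InnerProductSpace.HarmonicAt (fun x => B * (1 - logBump y σ R x)) x :=
    ((InnerProductSpace.harmonicAt_const 1).sub (harmonicAt_logBump hσ hxσ)).const_smul (c := B)
  exact ⟨mem_of_superset (Metric.isOpen_ball.mem_nhds (mem_ball_iff_norm.2 hxR))
    Metric.ball_subset_closedBall, hs.subharmonic x ⟨hxD x hx, hpos⟩ (hD.notMem_of_mem_left hx),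
    hharm.1, hharm.2.self_of_nhds.le⟩

lemma IsSubsolution.exists_linear_bound {D : Set ℂ} {g f u : ℂ → ℝ} (hs : IsSubsolution D g f u)
    {y : ℂ} {σ R : ℝ} (hσ : 0 < σ) (hR : σ < R)
    (hD : Disjoint (Metric.closedBall y R) (closure D))
    (hu : ∀ x ∈ Metric.closedBall y σ, u x = 0) :
    ∃ C, 0 ≤ C ∧ ∀ x ∈ Metric.closedBall y R, u x ≤ C * max (‖x - y‖ - σ) 0 := by
  have hxD : ∀ x ∈ Metric.closedBall y R, x ∉ D := fun x hx h =>
    hD.notMem_of_mem_left hx (subset_closure h)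
  obtain ⟨m, hm, hmax⟩ := (isCompact_closedBall y R).exists_isMaxOn
    (Metric.nonempty_closedBall.2 (hσ.trans hR).le) (hs.continuousOn.mono hxD)
  have hlog := log_sub_log_pos hσ hR
  have hm0 : 0 ≤ u m := hs.nonneg m (hxD m hm)
  refine ⟨u m * (1 / (σ * (Real.log R - Real.log σ))), by positivity, fun x hx => ?_⟩
  rw [mul_assoc]
  exact (hs.le_mul_one_sub_logBump hσ hR hm0 hD hu (fun _ hx => hmax hx) x hx).trans
    (mul_le_mul_of_nonneg_left (one_sub_logBump_le hσ hR) hm0)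

lemma exists_ball_subset_touching {V : Type*} [NormedAddCommGroup V] [NormedSpace ℝ V]
    [ProperSpace V] {E U : Set V} (hE : IsOpen E) (hU : IsOpen U)
    (hne : (frontier E ∩ U).Nonempty) :
    ∃ y z, ∃ s > 0, Metric.ball y s ⊆ E ∧ Metric.closedBall y (2 * s) ⊆ U ∧
      z ∈ frontier E ∧ dist z y = s := by
  obtain ⟨c, hcE, hcU⟩ := hne
  obtain ⟨ε, hε, hεU⟩ := Metric.isOpen_iff.1 hU c hcU
  obtain ⟨y, hyE, hcy⟩ := Metric.mem_closure_iff.1 hcE.1 (ε / 3) (by positivity)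
  have hcE' : c ∈ Eᶜ := fun h => hcE.2 (by rwa [hE.interior_eq])
  obtain ⟨z, hzE, hz⟩ := hE.isClosed_compl.exists_infDist_eq_dist ⟨c, hcE'⟩ y
  have hle {x : V} (hx : x ∈ Eᶜ) : dist z y ≤ dist x y := by
    rw [dist_comm z y, ← hz, dist_comm x y]
    exact Metric.infDist_le_dist_of_mem hx
  have hpos : 0 < dist z y := dist_pos.2 fun h => hzE (h ▸ hyE)
  have hball : Metric.ball y (dist z y) ⊆ E := fun x hx =>
    by_contra fun hxE => (hle hxE).not_gt (Metric.mem_ball.1 hx)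
  refine ⟨y, z, dist z y, hpos, hball, fun x hx => hεU ?_, ⟨?_, fun h => hzE (interior_subset h)⟩,
    rfl⟩
  · have hzy := (hle hcE').trans_lt hcy
    rw [Metric.mem_closedBall] at hx
    rw [Metric.mem_ball]
    linarith [dist_triangle x y c, dist_comm c y]
  · refine closure_mono hball ?_
    rw [closure_ball y hpos.ne']
    exact Metric.mem_closedBall.2 le_rfl

/-! ### The slope of a function next to a disk of zeros -/

lemma TangentBallOutside.belowPlane {Ω : Set ℂ} {u : ℂ → ℝ} {y z : ℂ} {s A : ℝ}
    (hT : TangentBallOutside Ω z y s) (hA : 0 ≤ A)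
    (h : ∀ᶠ x in 𝓝 z, u x ≤ A * max (‖x - y‖ - s) 0) :
    BelowPlane u z ((s : ℂ)⁻¹ * (z - y)) A := by
  set ν := (s : ℂ)⁻¹ * (z - y)
  have hs : 0 < s := hT.1
  refine ⟨_, isLittleO_const_mul_norm_sub_sq (A / (2 * s)) z, ?_⟩
  filter_upwards [h] with x hx
  have hexp := norm_add_smul_sub_le hT.norm_normal hs (x - z)
  have hxy : x - z + s • ν = x - y := by rw [sub_add, ← hT.center_eq]
  rw [hxy] at hexp
  calc
    u x ≤ A * max (‖x - y‖ - s) 0 := hx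
    _ ≤ A * (max ⟪x - z, ν⟫_ℝ 0 + ‖x - z‖ ^ 2 / (2 * s)) := by
      gcongr
      exact max_le (hexp.trans (by gcongr; exact le_max_left _ _)) (by positivity)
    _ = A * max ⟪x - z, ν⟫_ℝ 0 + A / (2 * s) * ‖x - z‖ ^ 2 := by ring

/-- The slopes `A` of the cones `A (|x - y| - s)⁺` that lie above `u` near `z`. -/
def upperSlopes (u : ℂ → ℝ) (y : ℂ) (s : ℝ) (z : ℂ) : Set ℝ :=
  {A | 0 ≤ A ∧ ∀ᶠ x in 𝓝 z, u x ≤ A * max (‖x - y‖ - s) 0}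

section UpperSlopes

variable {u : ℂ → ℝ} {y z : ℂ} {s A : ℝ}

lemma eventually_le_of_sInf_upperSlopes_lt (hne : (upperSlopes u y s z).Nonempty)
    (hA : sInf (upperSlopes u y s z) < A) :
    ∀ᶠ x in 𝓝 z, u x ≤ A * max (‖x - y‖ - s) 0 := by
  obtain ⟨B, hB, hBA⟩ := exists_lt_of_csInf_lt hne hA
  refine hB.2.mono fun x hx => hx.trans ?_
  gcongr

lemma frequently_lt_of_lt_sInf_upperSlopes (hA0 : 0 ≤ A) (hA : A < sInf (upperSlopes u y s z)) :
    ∃ᶠ x in 𝓝 z, A * max (‖x - y‖ - s) 0 < u x := fun h =>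
  hA.not_ge (csInf_le ⟨0, fun _ hB => hB.1⟩ ⟨hA0, h.mono fun _ => not_lt.1⟩)

lemma IsSubsolution.sqrt_le_sInf_upperSlopes {D : Set ℂ} {g f : ℂ → ℝ}
    (hs : IsSubsolution D g f u) (hne : (upperSlopes u y s z).Nonempty)
    (hz : z ∈ frontier (posSet D u)) (hzD : z ∉ closure D)
    (hT : TangentBallOutside (posSet D u) z y s) : √(f z) ≤ sInf (upperSlopes u y s z) :=
  le_csInf hne fun A hA => hs.freeBoundary z hz hzD y s hT A (hT.belowPlane hA.1 hA.2)

end UpperSlopes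

/-! ### Flat frames next to a disk of zeros -/

lemma IsFlatFrame.mono {D G : Set ℂ} {f u : ℂ → ℝ} {p k : ℂ} {a δ δ' : ℝ}
    (h : IsFlatFrame D G f u p k a δ) (ha : 0 ≤ a) (hδ : 0 ≤ δ) (hle : δ ≤ δ') :
    IsFlatFrame D G f u p k a δ' where
  toIsAdmissibleFrame := h.toIsAdmissibleFrame
  le_plane x hx hre := by
    refine (h.le_plane x hx hre).trans ?_
    have : 0 ≤ (frameCoord p k x).re - 1 + δ := by linarith
    have ha0 : 0 ≤ a + δ' := by linarith
    gcongr
  le_apply := h.le_apply.trans' (by gcongr)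

lemma norm_sub_sub_le_of_radial_frame {y ν x : ℂ} {s ℓ δ : ℝ} (hν : ‖ν‖ = 1) (hs : 0 < s)
    (hℓ : 0 < ℓ) (hδ : 441 * ℓ ≤ 2 * s * δ)
    (hx : ‖frameCoord (y + (s - ℓ) * ν) (ℓ * ν) x‖ ≤ 20) :
    ‖x - y‖ - s ≤ ℓ * ((frameCoord (y + (s - ℓ) * ν) (ℓ * ν) x).re - 1 + δ) := by
  have hν0 : ν ≠ 0 := norm_ne_zero_iff.1 (hν.trans_ne one_ne_zero)
  have hk : (ℓ : ℂ) * ν ≠ 0 := mul_ne_zero (Complex.ofReal_ne_zero.2 hℓ.ne') hν0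
  set ζ := frameCoord (y + (s - ℓ) * ν) (ℓ * ν) x
  set h : ℂ := ℓ * (ζ - 1)
  have hxy : x - y = (h + s • (1 : ℂ)) * ν := by
    have hζ : y + (s - ℓ) * ν + ζ * (ℓ * ν) = x := add_frameCoord_mul hk _ x
    rw [Complex.real_smul, ← hζ]
    ring
  have hinner : ⟪h, (1 : ℂ)⟫_ℝ = ℓ * (ζ.re - 1) := by simp [h, Complex.inner]
  have hnorm : ‖h‖ ≤ 21 * ℓ := by
    rw [norm_mul, Complex.norm_real, Real.norm_of_nonneg hℓ.le, mul_comm]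
    gcongr
    exact (norm_sub_le _ _).trans (by rw [norm_one]; linarith)
  have hsq : ‖h‖ ^ 2 / (2 * s) ≤ ℓ * δ := by
    rw [div_le_iff₀ (by positivity)]
    calc
      ‖h‖ ^ 2 ≤ (21 * ℓ) ^ 2 := by gcongr
      _ = ℓ * (441 * ℓ) := by ring
      _ ≤ ℓ * δ * (2 * s) := by nlinarith
  have hexp := norm_add_smul_sub_le (norm_one (α := ℂ)) hs h
  rw [hxy, norm_mul, hν, mul_one]
  linarith

lemma isFlatFrame_radial {D G : Set ℂ} {f u : ℂ → ℝ} {y ν : ℂ} {s ℓ a δ : ℝ} (hν : ‖ν‖ = 1)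
    (hs : 0 < s) (hℓ : 0 < ℓ) (hℓδ : 441 * ℓ ≤ 2 * s * δ) (hδ : 0 < δ) (ha : 0 < a)
    (hG : ∀ x, ‖x - (y + (s + ℓ) * ν)‖ ≤ 22 * ℓ → x ∈ G ∧ x ∉ closure D)
    (hf : ∀ x, ‖x - (y + (s + ℓ) * ν)‖ ≤ 22 * ℓ → √(f x) ≤ 161 / 160 * a)
    (hup : ∀ x, ‖x - (y + (s + ℓ) * ν)‖ ≤ 22 * ℓ → u x ≤ (a + δ) * max (‖x - y‖ - s) 0)
    (hlow : (a - δ) * ℓ ≤ u (y + (s + ℓ) * ν)) :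
    IsFlatFrame D G f u (y + (s - ℓ) * ν) (ℓ * ν) a δ := by
  set p := y + (s - ℓ) * ν
  set k := (ℓ : ℂ) * ν
  have hk : ‖k‖ = ℓ := by
    rw [norm_mul, hν, mul_one, Complex.norm_real, Real.norm_of_nonneg hℓ.le]
  have hk0 : k ≠ 0 := norm_pos_iff.1 (hℓ.trans_eq hk.symm)
  have hpk : p + 2 * k = y + (s + ℓ) * ν := by ring
  have hclose : ∀ x ∈ Metric.closedBall p (20 * ‖k‖), ‖x - (y + (s + ℓ) * ν)‖ ≤ 22 * ℓ := by
    intro x hx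
    rw [mem_closedBall_iff_norm, hk] at hx
    have h2k : ‖p - (p + 2 * k)‖ = 2 * ℓ := by
      rw [sub_add_cancel_left, norm_neg, norm_mul, RCLike.norm_ofNat, hk]
    rw [← hpk]
    linarith [norm_sub_le_norm_sub_add_norm_sub x p (p + 2 * k)]
  refine ⟨⟨hk0, fun x hx => (hG x (hclose x hx)).1,
    Set.disjoint_left.2 fun x hx => (hG x (hclose x hx)).2, fun x hx => hf x (hclose x hx)⟩,
    fun x hx hre => ?_, ?_⟩
  · have hle := norm_sub_sub_le_of_radial_frame hν hs hℓ hℓδ hx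
    have hnonneg : 0 ≤ ℓ * ((frameCoord p k x).re - 1 + δ) := mul_nonneg hℓ.le (by linarith)
    calc
      u x ≤ (a + δ) * max (‖x - y‖ - s) 0 :=
        hup x (hclose x ((mem_closedBall_iff_norm_frameCoord_le hk0).2 hx))
      _ ≤ (a + δ) * (ℓ * ((frameCoord p k x).re - 1 + δ)) := by
        gcongr
        exact max_le hle hnonneg
      _ = ‖k‖ * ((a + δ) * ((frameCoord p k x).re - 1 + δ)) := by
        rw [hk]
        ring
  · rw [hk, hpk, mul_comm]
    exact hlow

lemma exists_isFlatFrame {D G : Set ℂ} {f u : ℂ → ℝ} {y z : ℂ} {s a δ : ℝ} (hs : 0 < s)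
    (hz : dist z y = s) (hδ : 0 < δ) (ha : 0 < a) (hu : ∀ x ∈ Metric.closedBall y s, u x = 0)
    (hG : ∀ᶠ x in 𝓝 z, x ∈ G ∧ x ∉ closure D) (hf : ∀ᶠ x in 𝓝 z, √(f x) ≤ 161 / 160 * a)
    (hup : ∀ᶠ x in 𝓝 z, u x ≤ (a + δ) * max (‖x - y‖ - s) 0)
    (hlow : ∃ᶠ x in 𝓝 z, (a - δ) * max (‖x - y‖ - s) 0 < u x) :
    ∃ p k, IsFlatFrame D G f u p k a δ ∧ ∀ x, ‖frameCoord p k x‖ ≤ 20 →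
      (frameCoord p k x).re < 1 - δ → x ∈ Metric.ball y s := by
  obtain ⟨ε, hε, hεz⟩ := Metric.nhds_basis_ball.mem_iff.1 (hG.and (hf.and hup))
  obtain ⟨q, hq, hqz⟩ := (hlow.and_eventually (Metric.ball_mem_nhds z
    (ε := min (ε / 24) (2 * s * δ / 441)) (by positivity))).exists
  obtain ⟨hqε, hqδ⟩ := lt_min_iff.1 (mem_ball_iff_norm.1 hqz)
  set ℓ := ‖q - y‖ - s
  have hℓ : 0 < ℓ := by
    by_contra! h
    rw [hu q (mem_closedBall_iff_norm.2 (sub_nonpos.1 h)), max_eq_right h, mul_zero] at hq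
    exact lt_irrefl _ hq
  rw [max_eq_left hℓ.le] at hq
  have hℓq : ℓ ≤ ‖q - z‖ := by
    linarith [norm_sub_le_norm_sub_add_norm_sub q z y, (dist_eq_norm z y).symm.trans hz]
  have hℓδ : 441 * ℓ ≤ 2 * s * δ := by linarith
  have hqy : 0 < ‖q - y‖ := by linarith
  set ν : ℂ := (q - y) / ‖q - y‖
  have hν : ‖ν‖ = 1 := by
    rw [norm_div, Complex.norm_real, norm_norm, div_self hqy.ne']
  have hqν : y + (s + ℓ) * ν = q := by
    rw [← Complex.ofReal_add, add_sub_cancel,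
      mul_div_cancel₀ _ (Complex.ofReal_ne_zero.2 hqy.ne'), add_sub_cancel]
  have hnear {x : ℂ} (hx : ‖x - (y + (s + ℓ) * ν)‖ ≤ 22 * ℓ) : x ∈ Metric.ball z ε := by
    rw [hqν] at hx
    rw [mem_ball_iff_norm]
    linarith [norm_sub_le_norm_sub_add_norm_sub x q z]
  refine ⟨_, _, isFlatFrame_radial hν hs hℓ hℓδ hδ ha (fun x hx => (hεz (hnear hx)).1)
    (fun x hx => (hεz (hnear hx)).2.1) (fun x hx => (hεz (hnear hx)).2.2) (hqν ▸ hq.le),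
    fun x hx hre => mem_ball_iff_norm.2 ?_⟩
  have hneg := mul_neg_of_pos_of_neg hℓ (sub_neg.2 hre)
  linarith [norm_sub_sub_le_of_radial_frame hν hs hℓ hℓδ hx]

/-! ### Bounded zero regions -/

lemma MaximalOn.exists_isFlatTransition {D G E : Set ℂ} {g f u : ℂ → ℝ} {y z : ℂ} {s a : ℝ}
    (hmax : MaximalOn D f u G) (hu : IsSubsolution D g f u) (hs : 0 < s) (hz : dist z y = s)
    (hsE : Metric.ball y s ⊆ E) (ha : 0 < a) (hu0 : ∀ x ∈ Metric.closedBall y s, u x = 0)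
    (hG : ∀ᶠ x in 𝓝 z, x ∈ G ∧ x ∉ closure D) (hf : ∀ᶠ x in 𝓝 z, √(f x) ≤ 161 / 160 * a)
    (hup : ∀ A > a, ∀ᶠ x in 𝓝 z, u x ≤ A * max (‖x - y‖ - s) 0)
    (hlow : ∀ A < a, 0 ≤ A → ∃ᶠ x in 𝓝 z, A * max (‖x - y‖ - s) 0 < u x) :
    ∃ p k, IsFlatTransition D G E f u p k a := by
  obtain ⟨δ₀, hδ₀, hflat⟩ := exists_forall_isFlatFrame_lower_bound (τ := 1 / 1000) (κ := a / 160)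
    ha (by norm_num) (by norm_num) (by positivity)
  set δ := min δ₀ (min (1 / 2000) a)
  have hδ : 0 < δ := by positivity
  have hδ1 : δ ≤ 1 / 2000 := (min_le_right _ _).trans (min_le_left _ _)
  have hδa : δ ≤ a := (min_le_right _ _).trans (min_le_right _ _)
  obtain ⟨p, k, hframe, hball⟩ := exists_isFlatFrame hs hz hδ ha hu0 hG hf
    (hup _ (lt_add_of_pos_right a hδ)) (hlow _ (sub_lt_self a hδ) (sub_nonneg.2 hδa))
  refine ⟨p, k, hframe.toIsAdmissibleFrame, fun x hx hre => hsE (hball x hx (by linarith)),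
    fun x hx hre => ?_⟩
  have hle := hflat hu hmax (hframe.mono ha.le hδ.le (min_le_left _ _)) x hx (by linarith)
  rwa [show a - a / 160 = 159 / 160 * a by ring] at hle

lemma MaximalOn.not_isZeroRegion {D G E : Set ℂ} {g f u : ℂ → ℝ} (hmax : MaximalOn D f u G)
    (hu : IsSubsolution D g f u) (hG : IsOpen G) (hf : Continuous f) (hfpos : ∀ x, 0 < f x)
    (hne : (frontier E ∩ G).Nonempty) : ¬ IsZeroRegion D G u E := by
  intro hE
  obtain ⟨c, hcE, hcG⟩ := hne
  obtain ⟨y, z, s, hs, hsE, hsG, hzE, hz⟩ := exists_ball_subset_touching hE.isOpen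
    (hG.inter isClosed_closure.isOpen_compl)
    ⟨c, hcE, hcG, hE.disjoint.notMem_of_mem_left hcE.1⟩
  have hs2 : s < 2 * s := by linarith
  have hD : Disjoint (Metric.closedBall y (2 * s)) (closure D) :=
    Set.disjoint_left.2 fun x hx => (hsG hx).2
  have hzs : z ∈ Metric.closedBall y s := Metric.mem_closedBall.2 hz.le
  have hnear : Metric.closedBall y (2 * s) ∈ 𝓝 z := mem_of_superset
    (Metric.isOpen_ball.mem_nhds (Metric.mem_ball.2 (hz.trans_lt hs2)))
    Metric.ball_subset_closedBall
  have hzD : z ∉ closure D := hE.disjoint.notMem_of_mem_left hzE.1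
  have hu0 : ∀ x ∈ Metric.closedBall y s, u x = 0 :=
    Set.EqOn.of_subset_closure (g := fun _ => 0) (fun x hx => hE.eq_zero x (hsE hx))
      (hu.continuousOn.mono fun x hx hxD => (hsG (Metric.closedBall_subset_closedBall hs2.le hx)).2
        (subset_closure hxD)) continuousOn_const Metric.ball_subset_closedBall
      (closure_ball y hs.ne').ge
  obtain ⟨C, hC0, hC⟩ := hu.exists_linear_bound hs hs2 hD hu0
  have hslopes : (upperSlopes u y s z).Nonempty :=
    ⟨C, hC0, mem_of_superset hnear hC⟩
  have hzu : z ∈ frontier (posSet D u) :=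
    ⟨hE.frontier_subset hzE, fun h => (interior_subset h).2.ne' (hu0 z hzs)⟩
  have hT : TangentBallOutside (posSet D u) z y s :=
    ⟨hs, hz, Set.disjoint_left.2 fun x hx hxu => hxu.2.ne' (hE.eq_zero x (hsE hx))⟩
  have hfa := hu.sqrt_le_sInf_upperSlopes hslopes hzu hzD hT
  have ha : 0 < sInf (upperSlopes u y s z) := (Real.sqrt_pos.2 (hfpos z)).trans_le hfa
  obtain ⟨p, k, hflat⟩ := hmax.exists_isFlatTransition hu hs hz hsE ha hu0
    (mem_of_superset hnear hsG)
    ((hf.sqrt.tendsto z).eventually_le_const (by linarith))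
    (fun A hA => eventually_le_of_sInf_upperSlopes_lt hslopes hA)
    (fun A hA hA0 => frequently_lt_of_lt_sInf_upperSlopes hA0 hA)
  exact hflat.not_isZeroRegion hu hmax ha hE

/-! ### Components of the zero set -/

lemma frontier_connectedComponentIn_subset_compl {X : Type*} [TopologicalSpace X]
    [LocallyConnectedSpace X] {U : Set X} (hU : IsOpen U) (x : X) :
    frontier (connectedComponentIn U x) ⊆ Uᶜ := by
  intro y hy hyU
  obtain ⟨z, hzy, hzx⟩ := mem_closure_iff.1 hy.1 _ hU.connectedComponentIn
    (mem_connectedComponentIn hyU)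
  have heq : connectedComponentIn U x = connectedComponentIn U y :=
    (connectedComponentIn_eq hzx).trans (connectedComponentIn_eq hzy).symm
  rw [heq, hU.connectedComponentIn.frontier_eq] at hy
  exact hy.2 (mem_connectedComponentIn hyU)

lemma inter_frontier_nonempty_of_isPreconnected {X : Type*} [TopologicalSpace X] {S E : Set X}
    (hS : IsPreconnected S) (hE : IsOpen E) (hSE : (S ∩ E).Nonempty) (hne : ¬ S ⊆ E) :
    (frontier E ∩ S).Nonempty := by
  contrapose! hne
  refine hS.subset_of_closure_inter_subset hE hSE fun z hz => ?_
  by_contra hzE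
  exact (hne ▸ ⟨hE.frontier_eq ▸ ⟨hz.1, hzE⟩, hz.2⟩ : z ∈ (∅ : Set X))

lemma subset_ball_of_frontier_subset_closedBall {V : Type*} [NormedAddCommGroup V]
    [NormedSpace ℝ V] [ProperSpace V] {E : Set V} {R : ℝ} (hE : IsOpen E)
    (hEb : Bornology.IsBounded E) (hR : 0 < R) (hfr : frontier E ⊆ Metric.closedBall 0 R) :
    E ⊆ Metric.ball 0 R := by
  rw [← interior_closedBall (0 : V) hR.ne']
  refine interior_maximal (fun y hy => ?_) hE
  obtain ⟨z, hz, hmax⟩ := hEb.isCompact_closure.exists_isMaxOn ⟨y, subset_closure hy⟩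
    continuous_norm.continuousOn
  rw [mem_closedBall_zero_iff]
  refine (hmax (subset_closure hy)).trans ?_
  by_contra! hzR
  -- A point of largest norm cannot be interior, since it can be pushed outwards.
  have hzE : z ∈ E := by
    by_contra hzE
    exact hzR.not_ge (mem_closedBall_zero_iff.1 (hfr (hE.frontier_eq ▸ ⟨hz, hzE⟩)))
  have hcont : ContinuousAt (fun t : ℝ => t • z) 1 := by fun_prop
  have hev : ∀ᶠ t : ℝ in 𝓝[>] 1, t • z ∈ E :=
    (hcont.eventually (hE.mem_nhds (by simpa only [one_smul] using hzE))).filter_mono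
      nhdsWithin_le_nhds
  obtain ⟨t, htE, ht⟩ := (hev.and eventually_mem_nhdsWithin).exists
  have ht1 : 1 < t := ht
  have hle : ‖t • z‖ ≤ ‖z‖ := hmax (subset_closure htE)
  rw [norm_smul, Real.norm_of_nonneg (by linarith)] at hle
  nlinarith

/-- The change of variables in `normalized`, as a homeomorphism. -/
def rescaling (x₀ : ℂ) {ρ : ℝ} (hρ : ρ ≠ 0) : ℂ ≃ₜ ℂ :=
  (Homeomorph.mulLeft₀ (ρ : ℂ) (Complex.ofReal_ne_zero.2 hρ)).trans (Homeomorph.subLeft x₀)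

section Rescaling

variable {D : Set ℂ} {u : ℂ → ℝ} {x₀ x : ℂ} {ρ : ℝ}

lemma normalized_eq_zero_iff (hρ : ρ ≠ 0) : normalized u x₀ ρ x = 0 ↔ u (rescaling x₀ hρ x) = 0 :=
  div_eq_zero_iff.trans (or_iff_left hρ)

lemma rescaling_mem_ball (hρ : 0 < ρ) (hx : x ∈ Metric.ball (0 : ℂ) 1) :
    rescaling x₀ hρ.ne' x ∈ Metric.ball x₀ ρ := by
  change x₀ - ρ * x ∈ Metric.ball x₀ ρ
  rw [mem_ball_iff_norm, sub_sub_cancel_left, norm_neg, norm_mul, Complex.norm_real,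
    Real.norm_of_nonneg hρ.le]
  exact mul_lt_of_lt_one_right hρ (mem_ball_zero_iff.1 hx)

lemma rescaling_mem_closure_posSet (hu : ∀ z ∉ D, 0 ≤ u z) (hρ : 0 < ρ)
    (hball : Metric.ball x₀ ρ ⊆ Dᶜ) (hx : x ∈ Metric.ball (0 : ℂ) 1)
    (hxZ : x ∉ zeroInterior (normalized u x₀ ρ)) :
    rescaling x₀ hρ.ne' x ∈ closure (posSet D u) := by
  have hxcl : x ∈ closure {z | z ∈ Metric.ball (0 : ℂ) 1 ∧ normalized u x₀ ρ z = 0}ᶜ := by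
    rwa [closure_compl]
  refine map_mem_closure (rescaling x₀ hρ.ne').continuous
    (Metric.isOpen_ball.inter_closure ⟨hx, hxcl⟩) fun z hz => ?_
  have hzD := hball (rescaling_mem_ball hρ hz.1)
  exact ⟨hzD, (hu _ hzD).lt_of_ne' fun h => hz.2 ⟨hz.1, (normalized_eq_zero_iff hρ.ne').2 h⟩⟩

lemma isZeroRegion_rescaling_image {R : ℝ} (hu : ∀ z ∉ D, 0 ≤ u z) (hR : 0 < R)
    (hpos : posSet D u ⊆ Metric.closedBall 0 R) (hρ : 0 < ρ) (hball : Metric.ball x₀ ρ ⊆ Dᶜ)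
    (hcl : closure (connectedComponentIn (zeroInterior (normalized u x₀ ρ)) x) ⊆
      Metric.ball (0 : ℂ) 1) :
    IsZeroRegion D (Metric.ball 0 R) u
      (rescaling x₀ hρ.ne' '' connectedComponentIn (zeroInterior (normalized u x₀ ρ)) x) := by
  set Φ := rescaling x₀ hρ.ne'
  set C := connectedComponentIn (zeroInterior (normalized u x₀ ρ)) x
  have hopen : IsOpen (Φ '' C) := Φ.isOpenMap _ isOpen_interior.connectedComponentIn
  have hclosure : closure (Φ '' C) ⊆ Metric.ball x₀ ρ := by
    rw [← Φ.image_closure, image_subset_iff]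
    exact fun z hz => rescaling_mem_ball hρ (hcl hz)
  have hbdd : Bornology.IsBounded (Φ '' C) :=
    Metric.isBounded_ball.subset (subset_closure.trans hclosure)
  have hfrontier : frontier (Φ '' C) ⊆ closure (posSet D u) := by
    rw [← Φ.image_frontier, image_subset_iff]
    exact fun z hz => rescaling_mem_closure_posSet hu hρ hball (hcl hz.1)
      (frontier_connectedComponentIn_subset_compl isOpen_interior x hz)
  exact
    { isOpen := hopen
      isPreconnected := isPreconnected_connectedComponentIn.image _ Φ.continuous.continuousOn
      isBounded := hbdd
      disjoint := ((disjoint_compl_left.mono_left hball).closure_right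
        Metric.isOpen_ball).mono_left hclosure
      subset := subset_ball_of_frontier_subset_closedBall hopen hbdd hR
        (hfrontier.trans (closure_minimal hpos Metric.isClosed_closedBall))
      eq_zero := by
        rintro _ ⟨z, hz, rfl⟩
        exact (normalized_eq_zero_iff hρ.ne').1
          (interior_subset (connectedComponentIn_subset _ _ hz)).2
      frontier_subset := hfrontier }

end Rescaling

lemma IsLargestSubsolution.posSet_subset_closedBall {D : Set ℂ} {g f u : ℂ → ℝ} {lam M r : ℝ}
    (hu : IsLargestSubsolution D g f lam M r u) (hr : 0 < r) (hR : r < outerRadius lam M r) :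
    posSet D u ⊆ Metric.closedBall 0 (outerRadius lam M r) := by
  intro x hx
  by_contra hxR
  rw [mem_closedBall_zero_iff, not_le] at hxR
  exact ((hu.le_barrier hx.1).trans_eq (barrier_eq_zero hr hR hxR.le)).not_gt hx.2

end FreeBoundary

end

open FreeBoundary

theorem lemma4p1_general {D : Set ℂ} {g f u : ℂ → ℝ} {lam M r ρ : ℝ} {x₀ : ℂ} (hD : IsOpen D)
    (h0 : (0 : ℂ) ∈ D) (hf : Continuous f) (hfpos : ∀ x, 0 < f x) (hlam : 0 < lam) (hM : 0 < M)
    (hr : 0 < r) (hu : IsLargestSubsolution D g f lam M r u) (hρ : 0 < ρ)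
    (hball : Metric.ball x₀ ρ ⊆ Dᶜ) :
    ∀ x ∈ zeroInterior (normalized u x₀ ρ),
      ¬ closure (connectedComponentIn (zeroInterior (normalized u x₀ ρ)) x) ⊆
        Metric.ball (0 : ℂ) 1 := by
  intro x hx hcl
  have hsub := hu.isSubsolution hD hf hfpos
  have hR := lt_outerRadius hlam hM hr
  have hR0 := hr.trans hR
  have hE := isZeroRegion_rescaling_image hsub.nonneg hR0 (hu.posSet_subset_closedBall hr hR)
    hρ hball hcl
  have hxE := mem_image_of_mem (rescaling x₀ hρ.ne') (mem_connectedComponentIn hx)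
  have h0E := fun h => hE.disjoint.notMem_of_mem_left (subset_closure h) (subset_closure h0)
  exact (hu.maximalOn hD h0 hf hfpos hr hR).not_isZeroRegion hsub Metric.isOpen_ball hf hfpos
    (inter_frontier_nonempty_of_isPreconnected (convex_ball 0 _).isPreconnected hE.isOpen
      ⟨_, hE.subset hxE, hxE⟩ fun h => h0E (h (Metric.mem_ball_self hR0))) hE

theorem lemma4p1 (D : Set ℂ) (hD : IsOpen D) (hDb : Bornology.IsBounded D) (h0 : (0 : ℂ) ∈ D)
    (g : ℂ → ℝ) (hg : ContinuousOn g (frontier D)) (hgpos : ∀ x ∈ frontier D, 0 < g x)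
    (f : ℂ → ℝ) (hf : Continuous f) (lam Lam : ℝ) (hlam : 0 < lam)
    (hfb : ∀ x, lam < f x ∧ f x < Lam)
    (M r : ℝ) (hM : 0 < M) (hr : 0 < r) (hDr : D ⊆ Metric.ball 0 r)
    (u : ℂ → ℝ) (hu : FreeBoundary.IsLargestSubsolution D g f lam M r u)
    (x₀ : ℂ) (hx₀ : x₀ ∈ frontier (FreeBoundary.posSet D u))
    (ρ : ℝ) (hρ : 0 < ρ) (hball : Metric.ball x₀ ρ ⊆ Dᶜ) :
    ∀ x ∈ FreeBoundary.zeroInterior (FreeBoundary.normalized u x₀ ρ),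
      ¬ closure (connectedComponentIn
          (FreeBoundary.zeroInterior (FreeBoundary.normalized u x₀ ρ)) x) ⊆
        Metric.ball (0 : ℂ) 1 := by
  exact lemma4p1_general hD h0 hf (fun x => hlam.trans (hfb x).1) hlam hM hr hu hρ hball
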